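/- Let $d\ge 1$, let $\Omega\subset\mathbb R^d$ be a nonempty bounded open set, and let $K>0$. Let $H^1_0(\Omega)$ be the closure of $C_c^\infty(\Omega)$ in $H^1(\Omega)$. Then there are eigenpairs $\{\lambda_i^2,\phi_i\}_{i\ge 1}$ of $-K\Delta$ on $\Omega$ with homogeneous Dirichlet boundary condition, that is, $\phi_i\in H^1_0(\Omega)$ with $K(\nabla\phi_i,\nabla w)_{L^2}=\lambda_i^2(\phi_i,w)_{L^2}$ for all $w\in H^1_0(\Omega)$, such that $\{\phi_i\}$ is an orthonormal basis of $L^2(\Omega)$ and $0<\lambda_1\le\lambda_2\le\dots$. For any such eigenpairs and integers $s\ge 0$ put $$\|q\|_{\check H^s}^2=\sum_{i\ge 1}\lambda_i^{2s}(q,\phi_i)^2,\qquad \check H^s=\{q\in L^2(\Omega):\|q\|_{\check H^s}<\infty\}.$$ For $X=L^2=L^2(\Omega)$ or $X=\check H^s$ write $H^m(X)=H^m(0,T;X)$, with norm $\|u\|_{H^m(X)}^2=\sum_{j\le m}\int_0^T\|\partial_t^ju(t)\|_X^2\,dt$ (weak derivatives in time), and $L^2(X)=H^0(X)$. Let $T>0$,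 and let $\alpha:[0,T]\to\mathbb R$ be twice differentiable with $$0\le\alpha(t)\le\alpha^*<1,\quad |\alpha'(t)|,|\alpha''(t)|\le B\ \text{ on }[0,T],\quad \alpha(0)=\alpha'(0)=0$$ (Assumption A). Put $k(t)=\frac{d}{dt}\Big(\frac{t^{-\alpha(t)}}{\Gamma(1-\alpha(t))}\Big)$ and $(k*g)(t)=\int_0^tk(t-s)g(s)\,ds$, and consider the problem $$\partial_t^2u-K\Delta u=f+K\,k*\Delta u\ \text{ in }\Omega\times(0,T],\qquad u(0)=u_0,\quad \partial_tu(0)=\hat u_0,\qquad u=0\ \text{ on }\partial\Omega\times[0,T]. \tag{Model}$$ A solution $u\in H^1(L^2)$ is understood in the weak sense: $u\in L^2(0,T;H^1_0(\Omega))$; $u(0)=u_0$; and for every $w\in H^1_0(\Omega)$ the function $t\mapsto(\partial_tu,w)$ has the weak derivative $$\frac{d}{dt}(\partial_tu,w)=(f,w)-K(\nabla u,\nabla w)-K\,k*(\nabla u,\nabla w)\quad\text{on }(0,T)$$ and the value $(\hat u_0,w)$ at $t=0$ (initial values are those of the representatives that are continuous on $[0,T]$). There is a constant $Q>0$, depending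 only on $\Omega,K,T,\alpha^*,B$, such that for all such $\alpha$ and all $f\in L^2(L^2)$, $u_0\in\check H^1$, $\hat u_0\in L^2$, problem (Model) has a unique solution $u\in H^1(L^2)$ (unique up to equality for almost every $t$), and $$\|u\|_{H^1(L^2)}\le Q\big(\|u_0\|_{\check H^1}+\|\hat u_0\|_{L^2}+\|f\|_{L^2(L^2)}\big).$$ Moreover: 1. if $f\in H^1(L^2)\cap L^2(\check H^1)$, $u_0\in\check H^2$ and $\hat u_0\in\check H^1$, then $$\|u\|_{H^2(L^2)}+\|u\|_{L^2(\check H^2)}\le Q\big(\|u_0\|_{\check H^2}+\|\hat u_0\|_{\check H^1}+\|f\|_{H^1(L^2)}+\|f\|_{L^2(\check H^1)}\big);$$ 2. if $f\in H^1(\check H^1)\cap L^2(\check H^2)$, $u_0\in\check H^3$ and $\hat u_0\in\check H^2$, then $$\|u\|_{H^3(L^2)}+\|u\|_{H^1(\check H^2)}\le Q\big(\|u_0\|_{\check H^3}+\|\hat u_0\|_{\check H^2}+\|f\|_{H^1(\check H^1)}+\|f\|_{L^2(\check H^2)}\big);$$ 3. if $f\in H^2(\check H^2)\cap L^2(\check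 H^3)$, $u_0\in\check H^4$ and $\hat u_0\in\check H^3$, then $$\|u\|_{H^4(L^2)}+\|u\|_{H^2(\check H^2)}\le Q\big(\|u_0\|_{\check H^4}+\|\hat u_0\|_{\check H^3}+\|f\|_{H^2(\check H^2)}+\|f\|_{L^2(\check H^3)}\big).$$ In each case the norms on the left are finite, that is, $u$ belongs to the corresponding spaces. -/

import Mathlib

open MeasureTheory Set
open scoped ENNReal ContDiff

noncomputable section

namespace VOWave

/-! ### Spaces in the space variable -/

/-- The real Hilbert space `L²(Ω)` for `Ω ⊆ ℝᵈ`. -/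
abbrev L2 {d : ℕ} (Ω : Set (EuclideanSpace ℝ (Fin d))) : Type :=
  Lp ℝ 2 (volume.restrict Ω)

/-- The real Hilbert space `L²(Ω; ℝᵈ)` of square integrable vector fields. -/
abbrev L2Vec {d : ℕ} (Ω : Set (EuclideanSpace ℝ (Fin d))) : Type :=
  Lp (EuclideanSpace ℝ (Fin d)) 2 (volume.restrict Ω)

/-- The pairs `(ψ, ∇ψ)` in `L²(Ω) × L²(Ω; ℝᵈ)` with `ψ ∈ C_c^∞(Ω)`. -/
def testGraph {d : ℕ} (Ω : Set (EuclideanSpace ℝ (Fin d))) : Set (L2 Ω × L2Vec Ω) :=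
  {p | ∃ ψ : EuclideanSpace ℝ (Fin d) → ℝ,
    ContDiff ℝ ∞ ψ ∧ HasCompactSupport ψ ∧ tsupport ψ ⊆ Ω ∧
    p.1 =ᵐ[volume.restrict Ω] ψ ∧ p.2 =ᵐ[volume.restrict Ω] gradient ψ}

/-- The space `H¹₀(Ω)`, the completion of `C_c^∞(Ω)` in the `H¹(Ω)` norm, as the set of the pairs
`(w, ∇w)` with `w ∈ H¹₀(Ω)`: this is the closure of `{(ψ, ∇ψ) : ψ ∈ C_c^∞(Ω)}` in
`L²(Ω) × L²(Ω; ℝᵈ)`. -/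
def h10Graph {d : ℕ} (Ω : Set (EuclideanSpace ℝ (Fin d))) : Set (L2 Ω × L2Vec Ω) :=
  closure (testGraph Ω)

/-- `(lam i ^ 2, φ i)`, `i = 0, 1, 2, …`, are the eigenpairs of `-KΔ` on `Ω` with the homogeneous
Dirichlet boundary condition: `φ` is an orthonormal basis of `L²(Ω)`, the `lam i` are positive and
non-decreasing, `φ i ∈ H¹₀(Ω)`, and `K (∇φ i, ∇w) = lam i ^ 2 (φ i, w)` for all `w ∈ H¹₀(Ω)`. -/
structure IsDirichletEigenbasis {d : ℕ} (Ω : Set (EuclideanSpace ℝ (Fin d))) (K : ℝ)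
    (lam : ℕ → ℝ) (φ : HilbertBasis ℕ ℝ (L2 Ω)) : Prop where
  pos : ∀ i, 0 < lam i
  mono : Monotone lam
  eigen : ∀ i, ∃ G : L2Vec Ω, (φ i, G) ∈ h10Graph Ω ∧
    ∀ p ∈ h10Graph Ω, K * inner ℝ G p.2 = lam i ^ 2 * inner ℝ (φ i) p.1

/-- The norm `‖q‖_{Ȟˢ(Ω)} = (∑ᵢ λᵢ²ˢ (q, φᵢ)²)^{1/2}` of `q ∈ L²(Ω)`, with value `∞` when
`q ∉ Ȟˢ(Ω)`. -/
def hNorm {d : ℕ} {Ω : Set (EuclideanSpace ℝ (Fin d))} (lam : ℕ → ℝ)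
    (φ : HilbertBasis ℕ ℝ (L2 Ω)) (s : ℕ) (q : L2 Ω) : ℝ≥0∞ :=
  (∑' i, ENNReal.ofReal (lam i ^ (2 * s) * (inner ℝ q (φ i)) ^ 2)) ^ (1 / 2 : ℝ)

/-! ### Functions of time with values in a Banach space -/

/-- Lebesgue measure on the time interval `(0, T)`. -/
abbrev timeMeasure (T : ℝ) : Measure ℝ := volume.restrict (Ioo 0 T)

/-- `w` is the weak derivative of `u` on `(0, T)`: `∫ η′ u = -∫ η w` for all `η ∈ C_c^∞(0, T)`.
It is only applied to functions that are square integrable on `(0, T)`. -/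
def HasWeakTimeDeriv {X : Type*} [NormedAddCommGroup X] [NormedSpace ℝ X]
    (T : ℝ) (u w : ℝ → X) : Prop :=
  ∀ η : ℝ → ℝ, ContDiff ℝ ∞ η → HasCompactSupport η → tsupport η ⊆ Ioo 0 T →
    ∫ t in Ioo 0 T, deriv η t • u t = -∫ t in Ioo 0 T, η t • w t

/-- `u ∈ Hᵐ(0, T; X)`, with weak derivatives `D 0 = u, D 1, …, D m` in `L²(0, T; X)`. -/
structure IsWeakDerivs {X : Type*} [NormedAddCommGroup X] [NormedSpace ℝ X]
    (T : ℝ) (m : ℕ) (u : ℝ → X) (D : ℕ → ℝ → X) : Prop where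
  zero : D 0 =ᵐ[timeMeasure T] u
  memLp : ∀ j ≤ m, MemLp (D j) 2 (timeMeasure T)
  deriv : ∀ j < m, HasWeakTimeDeriv T (D j) (D (j + 1))

/-- For `N` the norm of a subspace `Y` of `X` (with value `∞` off `Y`), the norm
`‖u‖_{Hᵐ(0,T;Y)} = (∑_{j ≤ m} ∫₀ᵀ N(∂ₜʲ u)² dt)^{1/2}`, with value `∞` when
`u ∉ Hᵐ(0, T; Y)`. The weak derivatives of `u` are unique almost everywhere, so the infimum is over
a single value if they exist, and it is `∞` if they do not. -/
def sobNorm {X : Type*} [NormedAddCommGroup X] [NormedSpace ℝ X]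
    (T : ℝ) (m : ℕ) (N : X → ℝ≥0∞) (u : ℝ → X) : ℝ≥0∞ :=
  ⨅ (D : ℕ → ℝ → X) (_ : IsWeakDerivs T m u D),
    (∑ j ∈ Finset.range (m + 1), ∫⁻ t in Ioo 0 T, N (D j t) ^ 2) ^ (1 / 2 : ℝ)

/-- The norm of `Hᵐ(0, T; L²(Ω))`; for `m = 0` that of `L²(0, T; L²(Ω))`. -/
def normHL2 {d : ℕ} {Ω : Set (EuclideanSpace ℝ (Fin d))} (T : ℝ) (m : ℕ) (u : ℝ → L2 Ω) : ℝ≥0∞ :=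
  sobNorm T m (fun q => ‖q‖ₑ) u

/-- The norm of `Hᵐ(0, T; Ȟˢ(Ω))`; for `m = 0` that of `L²(0, T; Ȟˢ(Ω))`. -/
def normHH {d : ℕ} {Ω : Set (EuclideanSpace ℝ (Fin d))} (lam : ℕ → ℝ)
    (φ : HilbertBasis ℕ ℝ (L2 Ω)) (T : ℝ) (m s : ℕ) (u : ℝ → L2 Ω) : ℝ≥0∞ :=
  sobNorm T m (hNorm lam φ s) u

/-- The continuous representative on `[0, T]` of `w` exists and has the value `w₀` at `t = 0`. -/
def HasInitialValue {X : Type*} [NormedAddCommGroup X] (T : ℝ) (w : ℝ → X) (w₀ : X) : Prop :=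
  ∃ g : ℝ → X, ContinuousOn g (Icc 0 T) ∧ g =ᵐ[timeMeasure T] w ∧ g 0 = w₀

/-! ### The model -/

/-- The assumption on the variable order `α` on `[0, T]`: `0 ≤ α ≤ αs < 1`, `|α′|, |α″| ≤ B`,
`α(0) = α′(0) = 0`. -/
def AssumptionA (T αs B : ℝ) (α : ℝ → ℝ) : Prop :=
  αs < 1 ∧ (∀ t ∈ Icc 0 T, 0 ≤ α t ∧ α t ≤ αs) ∧
  ∃ α₁ α₂ : ℝ → ℝ,
    (∀ t ∈ Icc 0 T, HasDerivWithinAt α (α₁ t) (Icc 0 T) t ∧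
      HasDerivWithinAt α₁ (α₂ t) (Icc 0 T) t ∧ |α₁ t| ≤ B ∧ |α₂ t| ≤ B) ∧
    α 0 = 0 ∧ α₁ 0 = 0

/-- The kernel `k(t) = d/dt (t^{-α(t)} / Γ(1 - α(t)))`. -/
def kernel (α : ℝ → ℝ) (t : ℝ) : ℝ :=
  deriv (fun s : ℝ => s ^ (-α s) / Real.Gamma (1 - α s)) t

/-- The convolution `(k * g)(t) = ∫₀ᵗ k(t - s) g(s) ds`. -/
def conv (k g : ℝ → ℝ) (t : ℝ) : ℝ := ∫ s in (0 : ℝ)..t, k (t - s) * g s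

/-- `u ∈ H¹(0, T; L²(Ω))` is a (weak) solution of
`∂ₜ²u - KΔu = f + K k * Δu` in `Ω × (0, T]`, `u = 0` on `∂Ω × [0, T]`,
`u(0) = u₀`, `∂ₜu(0) = u₁`.
Here `ut` is the time derivative and `G` the spatial gradient of `u`; the boundary condition reads
`u ∈ L²(0, T; H¹₀(Ω))`; and for every `w ∈ H¹₀(Ω)`,
`d/dt (∂ₜu, w) = (f, w) - K (∇u, ∇w) - K k * (∇u, ∇w)` weakly on `(0, T)`, where `(∂ₜu, w)` has
the value `(u₁, w)` at `t = 0`. -/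
def IsSolution {d : ℕ} (Ω : Set (EuclideanSpace ℝ (Fin d))) (K T : ℝ) (α : ℝ → ℝ)
    (f : ℝ → L2 Ω) (u₀ u₁ : L2 Ω) (u : ℝ → L2 Ω) : Prop :=
  MemLp u 2 (timeMeasure T) ∧
  ∃ (ut : ℝ → L2 Ω) (G : ℝ → L2Vec Ω),
    MemLp ut 2 (timeMeasure T) ∧ HasWeakTimeDeriv T u ut ∧
    MemLp G 2 (timeMeasure T) ∧ (∀ᵐ t ∂(timeMeasure T), (u t, G t) ∈ h10Graph Ω) ∧
    HasInitialValue T u u₀ ∧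
    ∀ p ∈ h10Graph Ω,
      HasWeakTimeDeriv T (fun t => inner ℝ (ut t) p.1)
        (fun t => inner ℝ (f t) p.1 - K * inner ℝ (G t) p.2
          - K * conv (kernel α) (fun s => inner ℝ (G s) p.2) t) ∧
      HasInitialValue T (fun t => inner ℝ (ut t) p.1) (inner ℝ u₁ p.1)

end VOWave

end

/-!
# The wave equation with a variable-order memory term

The solution is expanded in the Dirichlet eigenfunctions of `-KΔ`, and everything is reduced to
estimates, uniform in the frequency `lam`, for the scalar equation `u'' + lam² (u + k * u) = f` of a
single mode.

*The kernel.* Since `α(0) = α'(0) = 0`, the order is `O(t²)` near `0` and its derivative `O(t)`.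
Hence `k` vanishes at `0` and is the primitive of a function `k₁ = O(1 + |log t|)`, whose norms in
`L¹(0, T)` and `L²(0, T)` are bounded in terms of `T`, `B` and the upper bound of the order
(`exists_kernel_primitive`). This is the only information on `α` that is used.

*A single mode.* In Duhamel's formula the memory term is `-lam (sin (lam ·) * k * u)`. As `k` is a
primitive of `k₁`, one integration by parts in time turns it into `(cos (lam ·) - 1) * (k₁ * u)`,
where no power of `lam` is left. So the formula is solved by a contraction in an exponentially
weighted norm, and `lam |u|` and `|u'|` are bounded by the energy of the data with a constant that
does not depend on `lam` (`exists_mode`). The equation, and its first two derivatives in time, then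
bound the derivatives of `u` up to the fourth (`exists_mode_bounds`); here `(k * u)' = k₁ * u` and
`(k₁ * u)' = u(0) k₁ + k₁ * u'`, and the square integrability of `k₁` is what the fourth derivative
needs.

*Existence and uniqueness.* The sum of the modes is a weak solution (`exists_solution`): the
gradient of `∑ uᵢ φᵢ` is the image of `∑ lamᵢ uᵢ φᵢ` under a bounded operator
(`exists_gradient_operator`), so the weak equation against any `w ∈ H¹₀(Ω)` follows from the
equations of the modes. Conversely the modes of a weak solution are primitives of their weak
derivatives, by the lemma of du Bois-Reymond, and solve the mode equations, whose solutions are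
unique (`IsSolution.ae_unique`). Summation of the bounds of the modes gives the estimates
(`regularity_estimates`).

*The eigenbasis.* A test function differs from its translate by `z` by at most `‖z‖ ‖∇ψ‖` in `L²`. A
translation which moves `Ω` off itself gives the Poincaré inequality (`exists_poincare`), and so a
lower bound for the frequencies. An average over small translations shows that `ψ` is close to its
averages over the cells of a fine grid, so that the inclusion `J` of `H¹₀(Ω)` in `L²(Ω)` is a limit
of operators of finite rank (`isCompactOperator_h10Incl`). The spectral theorem for `J J*`
(`exists_antitone_eigenbasis`) yields the eigenbasis (`exists_isDirichletEigenbasis`).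
-/

namespace VOWave

/-! ### Causal convolution on a bounded interval -/

theorem conv_comm (k g : ℝ → ℝ) (t : ℝ) : conv k g t = conv g k t := by
  have h := intervalIntegral.integral_comp_sub_left (fun s => k s * g (t - s)) t
    (a := (0 : ℝ)) (b := t)
  simp only [sub_sub_cancel, sub_self, sub_zero] at h
  simp only [conv]
  rw [h]
  exact intervalIntegral.integral_congr fun s _ => mul_comm _ _

theorem intervalIntegrable_conv_integrand {T t : ℝ} {k g : ℝ → ℝ}
    (hk : IntervalIntegrable k volume 0 T) (hg : ContinuousOn g (Icc 0 T)) (ht : t ∈ Icc 0 T) :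
    IntervalIntegrable (fun s => k (t - s) * g s) volume 0 t := by
  have h1 : IntervalIntegrable k volume 0 t :=
    hk.mono_set (by
      rw [uIcc_of_le ht.1, uIcc_of_le (ht.1.trans ht.2)]; exact Icc_subset_Icc_right ht.2)
  have h2 := (h1.comp_sub_left t).symm
  simp only [sub_self, sub_zero] at h2
  refine h2.mul_continuousOn (hg.mono ?_)
  rw [uIcc_of_le ht.1]; exact Icc_subset_Icc_right ht.2

theorem conv_sub {T t : ℝ} {k g h : ℝ → ℝ} (hk : IntervalIntegrable k volume 0 T)
    (hg : ContinuousOn g (Icc 0 T)) (hh : ContinuousOn h (Icc 0 T)) (ht : t ∈ Icc 0 T) :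
    conv k (fun s => g s - h s) t = conv k g t - conv k h t := by
  simp only [conv]
  rw [← intervalIntegral.integral_sub (intervalIntegrable_conv_integrand hk hg ht)
    (intervalIntegrable_conv_integrand hk hh ht)]
  exact intervalIntegral.integral_congr fun s _ => mul_sub _ _ _

theorem conv_congr {T t : ℝ} {k g h : ℝ → ℝ} (ht : t ∈ Icc 0 T) (hgh : ∀ s ∈ Icc 0 T, g s = h s) :
    conv k g t = conv k h t := by
  refine intervalIntegral.integral_congr fun s hs => ?_
  rw [uIcc_of_le ht.1] at hs
  simp only [hgh s ⟨hs.1, hs.2.trans ht.2⟩]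

theorem conv_congr_left {T t : ℝ} {k l g : ℝ → ℝ} (ht : t ∈ Icc 0 T)
    (hkl : ∀ s ∈ Ioo 0 T, k s = l s) : conv k g t = conv l g t := by
  simp only [conv]
  rw [intervalIntegral.integral_of_le ht.1, intervalIntegral.integral_of_le ht.1,
    integral_Ioc_eq_integral_Ioo, integral_Ioc_eq_integral_Ioo]
  refine setIntegral_congr_fun measurableSet_Ioo fun s hs => ?_
  simp only [hkl (t - s) ⟨by linarith [hs.2], by linarith [hs.1, ht.2]⟩]

/-- On `[0, T]` the causal convolution is a convolution over `ℝ` of functions cut off to `[0, T]`.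
-/
theorem conv_eq_integral_indicator {T t : ℝ} (k g : ℝ → ℝ) (ht : t ∈ Icc 0 T) :
    conv k g t = ∫ s, (Ioc 0 T).indicator g s * (Icc 0 T).indicator k (t - s) := by
  simp only [conv]
  rw [intervalIntegral.integral_of_le ht.1, ← integral_indicator measurableSet_Ioc]
  congr 1
  ext s
  by_cases h1 : s ∈ Ioc 0 t
  · have h2 : s ∈ Ioc 0 T := ⟨h1.1, h1.2.trans ht.2⟩
    have h3 : t - s ∈ Icc 0 T := ⟨by linarith [h1.2], by linarith [h1.1, ht.2]⟩
    simp [h1, h2, h3, mul_comm]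
  · rw [indicator_of_notMem h1]
    by_cases h2 : s ∈ Ioc 0 T
    · have h3 : t - s ∉ Icc 0 T := fun h => h1 ⟨h2.1, by linarith [h.1]⟩
      simp [h3]
    · simp [h2]

theorem integrable_conv_cutoff {T : ℝ} (hT : 0 ≤ T) {k g : ℝ → ℝ}
    (hk : IntervalIntegrable k volume 0 T) (hg : IntervalIntegrable g volume 0 T) :
    Integrable (fun p : ℝ × ℝ => (Ioc 0 T).indicator g p.2 * (Icc 0 T).indicator k (p.1 - p.2))
      (volume.prod volume) := by
  have hg' : Integrable ((Ioc 0 T).indicator g) :=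
    ((intervalIntegrable_iff_integrableOn_Ioc_of_le hT).1 hg).integrable_indicator measurableSet_Ioc
  have hk' : Integrable ((Icc 0 T).indicator k) :=
    ((intervalIntegrable_iff_integrableOn_Icc_of_le hT).1 hk).integrable_indicator measurableSet_Icc
  exact hg'.convolution_integrand (ContinuousLinearMap.mul ℝ ℝ) hk'

theorem intervalIntegrable_conv {T : ℝ} (hT : 0 ≤ T) {k g : ℝ → ℝ}
    (hk : IntervalIntegrable k volume 0 T) (hg : IntervalIntegrable g volume 0 T) :
    IntervalIntegrable (conv k g) volume 0 T := by
  rw [intervalIntegrable_iff_integrableOn_Icc_of_le hT]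
  have h := (integrable_conv_cutoff hT hk hg).integral_prod_left
  refine (h.integrableOn (s := Icc 0 T)).congr_fun (fun t ht => ?_) measurableSet_Icc
  exact (conv_eq_integral_indicator k g ht).symm

/-- `1 * (k * g) = (1 * k) * g` for causal convolution. -/
theorem integral_conv {T t : ℝ} {k g : ℝ → ℝ}
    (hk : IntervalIntegrable k volume 0 T) (hg : IntervalIntegrable g volume 0 T)
    (ht : t ∈ Icc 0 T) :
    ∫ s in (0 : ℝ)..t, conv k g s = conv (fun x => ∫ r in (0 : ℝ)..x, k r) g t := by
  have hT : 0 ≤ T := ht.1.trans ht.2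
  rw [intervalIntegral.integral_of_le ht.1]
  have h0 : ∫ s in Ioc 0 t, conv k g s = ∫ s in Ioc 0 t,
      ∫ r, (Ioc 0 T).indicator g r * (Icc 0 T).indicator k (s - r) :=
    setIntegral_congr_fun measurableSet_Ioc fun s hs =>
      conv_eq_integral_indicator k g ⟨hs.1.le, hs.2.trans ht.2⟩
  rw [h0, integral_integral_swap, conv_eq_integral_indicator _ g ht]
  · congr 1
    ext r
    rw [integral_const_mul]
    by_cases hr : r ∈ Ioc 0 T
    swap
    · simp [hr]
    congr 1
    -- For fixed `r`, the substitution `x = s - r` turns the inner integral into the primitive of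
    -- `k` at `t - r`.
    by_cases h3 : t - r ∈ Icc 0 T
    · rw [indicator_of_mem h3, ← integral_indicator measurableSet_Ioc,
        intervalIntegral.integral_of_le h3.1, ← integral_indicator measurableSet_Ioc,
        ← integral_add_right_eq_self _ r]
      refine integral_congr_ae ?_
      have : ∀ᵐ x : ℝ, x ≠ 0 := by simp [ae_iff]
      filter_upwards [this] with x hx
      simp only [indicator, mem_Ioc, mem_Icc, add_sub_cancel_right]
      by_cases hx1 : 0 < x ∧ x ≤ t - r
      · have h5 : 0 < x + r ∧ x + r ≤ t := ⟨by linarith [hr.1], by linarith⟩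
        have h6 : 0 ≤ x ∧ x ≤ T := ⟨hx1.1.le, by linarith [hr.1, ht.2]⟩
        simp [hx1, h5, h6]
      · rw [if_neg hx1]
        by_cases h7 : 0 < x
        · have : ¬ (0 < x + r ∧ x + r ≤ t) := fun h => hx1 ⟨h7, by linarith [h.2]⟩
          rw [if_neg this]
        · have : ¬ (0 ≤ x ∧ x ≤ T) := fun h => h7 (lt_of_le_of_ne h.1 (Ne.symm hx))
          rw [if_neg this]; simp
    · rw [indicator_of_notMem h3]
      refine setIntegral_eq_zero_of_forall_eq_zero fun x hx => ?_
      refine indicator_of_notMem (fun h => h3 ⟨by linarith [h.1, hx.2], by linarith [hr.1, ht.2]⟩) _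
  · have := integrable_conv_cutoff hT hk hg
    exact this.mono_measure (Measure.prod_mono Measure.restrict_le_self le_rfl)

theorem continuousOn_primitive {T : ℝ} (hT : 0 ≤ T) {g : ℝ → ℝ}
    (hg : IntervalIntegrable g volume 0 T) :
    ContinuousOn (fun t => ∫ s in (0 : ℝ)..t, g s) (Icc 0 T) := by
  have := intervalIntegral.continuousOn_primitive_interval (μ := volume) (f := g) (a := 0) (b := T)
    (by rw [uIcc_of_le hT]; exact (intervalIntegrable_iff_integrableOn_Icc_of_le hT).1 hg)
  rwa [uIcc_of_le hT] at this

theorem continuousOn_conv_primitive {T : ℝ} (hT : 0 ≤ T) {k g : ℝ → ℝ}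
    (hk : IntervalIntegrable k volume 0 T) (hg : IntervalIntegrable g volume 0 T) :
    ContinuousOn (conv (fun x => ∫ r in (0 : ℝ)..x, k r) g) (Icc 0 T) :=
  (continuousOn_primitive hT (intervalIntegrable_conv hT hk hg)).congr fun _ ht =>
    (integral_conv hk hg ht).symm

/-- In the weight `exp (γ t)` integration gains the factor `1 / γ`. -/
theorem abs_integral_le_of_exp {γ D t : ℝ} {g : ℝ → ℝ} (hγ : 0 < γ) (ht : 0 ≤ t) (hD : 0 ≤ D)
    (hg : ∀ s ∈ Icc 0 t, |g s| ≤ D * Real.exp (γ * s)) :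
    |∫ s in (0 : ℝ)..t, g s| ≤ D / γ * Real.exp (γ * t) := by
  have hc : IntervalIntegrable (fun s => D * Real.exp (γ * s)) volume 0 t := by
    apply Continuous.intervalIntegrable; fun_prop
  have h1 : ‖∫ s in (0 : ℝ)..t, g s‖ ≤ ∫ s in (0 : ℝ)..t, D * Real.exp (γ * s) :=
    intervalIntegral.norm_integral_le_of_norm_le (μ := volume) ht
      (Filter.Eventually.of_forall fun s hs => hg s ⟨hs.1.le, hs.2⟩) hc
  have h2 : ∫ s in (0 : ℝ)..t, D * Real.exp (γ * s)
      = D / γ * Real.exp (γ * t) - D / γ * Real.exp (γ * 0) := by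
    refine intervalIntegral.integral_eq_sub_of_hasDerivAt
      (f := fun s => D / γ * Real.exp (γ * s)) (fun s _ => ?_) hc
    have := (((hasDerivAt_id s).const_mul γ).exp).const_mul (D / γ)
    convert! this using 1
    simp only [id]; field_simp
  have h3 : 0 ≤ D / γ * Real.exp (γ * 0) := by positivity
  rw [Real.norm_eq_abs] at h1
  linarith

/-- In the weight `exp (γ t)` convolution with `k` is bounded by the `L¹` norm of `k`. -/
theorem abs_conv_le_of_exp {γ D T t : ℝ} {k g : ℝ → ℝ} (hγ : 0 ≤ γ) (hD : 0 ≤ D)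
    (hk : IntervalIntegrable k volume 0 T) (ht : t ∈ Icc 0 T)
    (hg : ∀ s ∈ Icc 0 t, |g s| ≤ D * Real.exp (γ * s)) :
    |conv k g t| ≤ (∫ s in (0 : ℝ)..T, |k s|) * D * Real.exp (γ * t) := by
  have hk1 : IntervalIntegrable k volume 0 t :=
    hk.mono_set (by
      rw [uIcc_of_le ht.1, uIcc_of_le (ht.1.trans ht.2)]; exact Icc_subset_Icc_right ht.2)
  have h2 := (hk1.comp_sub_left t).symm
  simp only [sub_self, sub_zero] at h2
  have h1 : ‖conv k g t‖ ≤ ∫ s in (0 : ℝ)..t, |k (t - s)| * (D * Real.exp (γ * t)) := by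
    refine intervalIntegral.norm_integral_le_of_norm_le (μ := volume) ht.1
      (Filter.Eventually.of_forall fun s hs => ?_) (h2.abs.mul_const _)
    rw [Real.norm_eq_abs, abs_mul]
    gcongr
    refine (hg s ⟨hs.1.le, hs.2⟩).trans ?_
    gcongr
    exact hs.2
  refine h1.trans ?_
  rw [intervalIntegral.integral_mul_const,
    intervalIntegral.integral_comp_sub_left (fun s => |k s|) t, ← mul_assoc]
  simp only [sub_self, sub_zero]
  gcongr
  rw [intervalIntegral.integral_of_le ht.1, intervalIntegral.integral_of_le (ht.1.trans ht.2)]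
  exact setIntegral_mono_set
    ((intervalIntegrable_iff_integrableOn_Ioc_of_le (ht.1.trans ht.2)).1 hk.abs)
    (Filter.Eventually.of_forall fun _ => abs_nonneg _) (Ioc_subset_Ioc_right ht.2).eventuallyLE

/-! ### The scalar equation of a single mode -/

theorem conv_const_mul (k g : ℝ → ℝ) (c t : ℝ) : conv k (fun s => c * g s) t = c * conv k g t := by
  simp only [conv]
  rw [← intervalIntegral.integral_const_mul]
  exact intervalIntegral.integral_congr fun s _ => mul_left_comm _ _ _

theorem conv_one_left (g : ℝ → ℝ) (t : ℝ) : conv (fun _ => 1) g t = ∫ s in (0 : ℝ)..t, g s := by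
  simp [conv]

theorem integral_cos_mul {lam : ℝ} (hl : 0 < lam) (x : ℝ) :
    ∫ r in (0 : ℝ)..x, Real.cos (lam * r) = Real.sin (lam * x) / lam := by
  rw [intervalIntegral.integral_comp_mul_left _ hl.ne', integral_cos]
  simp [div_eq_inv_mul]

theorem integral_sin_mul {lam : ℝ} (hl : 0 < lam) (x : ℝ) :
    ∫ r in (0 : ℝ)..x, Real.sin (lam * r) = (1 - Real.cos (lam * x)) / lam := by
  rw [intervalIntegral.integral_comp_mul_left _ hl.ne', integral_sin]
  simp [div_eq_inv_mul]

theorem intervalIntegrable_cos_mul (lam T : ℝ) :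
    IntervalIntegrable (fun r => Real.cos (lam * r)) volume 0 T := by
  apply Continuous.intervalIntegrable; fun_prop

theorem intervalIntegrable_sin_mul (lam T : ℝ) :
    IntervalIntegrable (fun r => Real.sin (lam * r)) volume 0 T := by
  apply Continuous.intervalIntegrable; fun_prop

theorem integral_conv_cos {lam T t : ℝ} (hl : 0 < lam) {g : ℝ → ℝ}
    (hg : IntervalIntegrable g volume 0 T) (ht : t ∈ Icc 0 T) :
    ∫ s in (0 : ℝ)..t, conv (fun r => Real.cos (lam * r)) g s
      = conv (fun r => Real.sin (lam * r)) g t / lam := by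
  rw [integral_conv (intervalIntegrable_cos_mul lam T) hg ht]
  simp only [integral_cos_mul hl, div_eq_inv_mul]
  rw [conv_comm, conv_const_mul, conv_comm]

theorem integral_conv_sin {lam T t : ℝ} (hl : 0 < lam) {g : ℝ → ℝ}
    (hg : IntervalIntegrable g volume 0 T) (ht : t ∈ Icc 0 T) :
    lam * ∫ s in (0 : ℝ)..t, conv (fun r => Real.sin (lam * r)) g s
      = (∫ s in (0 : ℝ)..t, g s) - conv (fun r => Real.cos (lam * r)) g t := by
  rw [integral_conv (intervalIntegrable_sin_mul lam T) hg ht]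
  simp only [integral_sin_mul hl, div_eq_inv_mul]
  rw [conv_comm, conv_const_mul, conv_sub hg (by fun_prop) (by fun_prop) ht,
    conv_comm g, conv_comm g, conv_one_left, mul_inv_cancel_left₀ hl.ne']

theorem abs_conv_le_of_abs_le_one {T t : ℝ} {c g : ℝ → ℝ} (hc : ∀ x, |c x| ≤ 1)
    (hg : IntervalIntegrable g volume 0 T) (ht : t ∈ Icc 0 T) :
    |conv c g t| ≤ ∫ s in (0 : ℝ)..T, |g s| := by
  have h := abs_conv_le_of_exp (γ := 0) (D := 1) (k := g) (g := c) le_rfl zero_le_one hg ht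
    (fun s _ => by simpa using hc s)
  rw [conv_comm]
  simpa using h

/-- The growth factor of the modes: it depends on the kernel only through a bound `M` of
`∫ |k₁|`, and not on the frequency. -/
noncomputable def modeConst (T M : ℝ) : ℝ := 2 * Real.exp ((4 * M + 1) * T) * (1 + T * M)

/-- The integrated form of the equation of a mode. Here `g₁ = k₁ * u`; the term
`conv cos g₁ - ∫ g₁` comes from one integration by parts in time of the memory term in Duhamel's
formula, and it carries no power of `lam`: this makes the fixed point argument, and hence the
bound, uniform in the frequency. -/
theorem exists_mode_fixedPoint {T M : ℝ} (hT : 0 < T) (hM : 0 ≤ M) {k₁ : ℝ → ℝ}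
    (hk : IntervalIntegrable k₁ volume 0 T) (hkM : ∫ s in (0 : ℝ)..T, |k₁ s| ≤ M)
    {lam : ℝ} (hl : 0 < lam) {U₀ : ℝ → ℝ} {A : ℝ} (hU₀ : ContinuousOn U₀ (Icc 0 T))
    (hA : ∀ t ∈ Icc 0 T, |U₀ t| ≤ A) :
    ∃ u : ℝ → ℝ, Continuous u ∧
      (∀ t ∈ Icc 0 T, |u t| ≤ 2 * Real.exp ((4 * M + 1) * T) * A) ∧
      ∀ t ∈ Icc 0 T, u t = U₀ t + (conv (fun r => Real.cos (lam * r)) (conv k₁ u) t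
        - ∫ s in (0 : ℝ)..t, conv k₁ u s) := by
  -- The map is a contraction by the factor `1 / 2` in the weight `exp (-γ t)`: its kernel is `(cos
  -- (lam ·) - 1) * k₁`, where `|cos - 1| ≤ 2` and `∫ |k₁| ≤ M`, and the remaining integration in
  -- time gains `1 / γ`.
  set γ : ℝ := 4 * M + 1 with hγ
  have hγ0 : 0 < γ := by positivity
  -- The unknown is `x t = exp (-γ t) u t`; `ext x` is the corresponding `u`, extended to the line.
  let ext : C(Icc 0 T, ℝ) → ℝ → ℝ := fun x t => Real.exp (γ * t) * IccExtend hT.le x t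
  have hext : ∀ x, Continuous (ext x) := fun x => by
    have : Continuous (IccExtend hT.le x) := x.continuous.Icc_extend'
    fun_prop
  have hext0 : ∀ s, ext 0 s = 0 := fun s => by simp [ext, IccExtend, Function.comp]
  have hg1 : ∀ x, IntervalIntegrable (conv k₁ (ext x)) volume 0 T := fun x =>
    intervalIntegrable_conv hT.le hk ((hext x).intervalIntegrable _ _)
  let R : (ℝ → ℝ) → ℝ → ℝ := fun g t => conv (fun r => Real.cos (lam * r)) g t
        - ∫ s in (0 : ℝ)..t, g s
  have hR : ∀ g, IntervalIntegrable g volume 0 T → ∀ t ∈ Icc 0 T,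
      R g t = -(lam * ∫ s in (0 : ℝ)..t, conv (fun r => Real.sin (lam * r)) g s) := by
    intro g hg t ht
    rw [integral_conv_sin hl hg ht]; simp only [R]; ring
  have hRc : ∀ g, IntervalIntegrable g volume 0 T → ContinuousOn (R g) (Icc 0 T) := fun g hg =>
    ((continuousOn_primitive hT.le
      (intervalIntegrable_conv hT.le (intervalIntegrable_sin_mul lam T) hg)).const_mul
        lam).neg.congr (hR g hg)
  have hRint : ∀ g t, t ∈ Icc 0 T → IntervalIntegrable g volume 0 T →
      R g t = ∫ s in (0 : ℝ)..t, (Real.cos (lam * (t - s)) - 1) * g s := by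
    intro g t ht hg
    simp only [R, conv]
    have hg' : IntervalIntegrable g volume 0 t :=
      hg.mono_set (by rw [uIcc_of_le ht.1, uIcc_of_le hT.le]; exact Icc_subset_Icc_right ht.2)
    rw [← intervalIntegral.integral_sub (hg'.continuousOn_mul (by fun_prop)) hg']
    exact intervalIntegral.integral_congr fun s _ => by ring
  have hRle : ∀ g t D, 0 ≤ D → t ∈ Icc 0 T → IntervalIntegrable g volume 0 T →
      (∀ s ∈ Icc 0 t, |g s| ≤ D * Real.exp (γ * s)) →
      |R g t| ≤ 2 * D / γ * Real.exp (γ * t) := by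
    intro g t D hD ht hg hgD
    rw [hRint g t ht hg]
    refine abs_integral_le_of_exp hγ0 ht.1 (by positivity) fun s hs => ?_
    rw [abs_mul, mul_assoc]
    refine mul_le_mul ?_ (hgD s hs) (abs_nonneg _) zero_le_two
    have h1 := Real.neg_one_le_cos (lam * (t - s))
    have h2 := Real.cos_le_one (lam * (t - s))
    rw [abs_le]; constructor <;> linarith
  have hsubR : ∀ x y : C(Icc 0 T, ℝ), ∀ t ∈ Icc 0 T,
      R (conv k₁ (ext x)) t - R (conv k₁ (ext y)) t
        = R (fun s => conv k₁ (ext x) s - conv k₁ (ext y) s) t := by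
    intro x y t ht
    have hg' : ∀ z, IntervalIntegrable (conv k₁ (ext z)) volume 0 t := fun z =>
      (hg1 z).mono_set
        (by rw [uIcc_of_le ht.1, uIcc_of_le hT.le]; exact Icc_subset_Icc_right ht.2)
    rw [hRint _ t ht (hg1 x), hRint _ t ht (hg1 y), hRint _ t ht ((hg1 x).sub (hg1 y)),
      ← intervalIntegral.integral_sub ((hg' x).continuousOn_mul (by fun_prop))
        ((hg' y).continuousOn_mul (by fun_prop))]
    exact intervalIntegral.integral_congr fun s _ => by ring
  have hextD : ∀ x y : C(Icc 0 T, ℝ), ∀ s ∈ Icc 0 T,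
      |ext x s - ext y s| ≤ dist x y * Real.exp (γ * s) := by
    intro x y s hs
    simp only [ext, IccExtend_of_mem hT.le _ hs]
    rw [← mul_sub, abs_mul, abs_of_pos (Real.exp_pos _), mul_comm]
    refine mul_le_mul_of_nonneg_right ?_ (Real.exp_pos _).le
    rw [← Real.dist_eq]
    exact ContinuousMap.dist_apply_le_dist _
  let Φ : C(Icc 0 T, ℝ) → C(Icc 0 T, ℝ) := fun x =>
    ⟨fun t => Real.exp (-(γ * t)) * (U₀ t + R (conv k₁ (ext x)) t), by
      have h := (hU₀.add (hRc _ (hg1 x))).domRestrict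
      have h2 : Continuous fun t : Icc (0 : ℝ) T => Real.exp (-(γ * t)) := by fun_prop
      exact h2.mul h⟩
  have hγ2 : 2 * M / γ ≤ 1 / 2 := by rw [div_le_div_iff₀ hγ0 two_pos]; linarith
  have hdist : ∀ x y : C(Icc 0 T, ℝ), dist (Φ x) (Φ y) ≤ 1 / 2 * dist x y := by
    intro x y
    rw [ContinuousMap.dist_le (by positivity)]
    rintro ⟨t, ht⟩
    have h1 : |R (conv k₁ (ext x)) t - R (conv k₁ (ext y)) t|
        ≤ 2 * (M * dist x y) / γ * Real.exp (γ * t) := by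
      rw [hsubR x y t ht]
      refine hRle _ t _ (by positivity) ht ((hg1 x).sub (hg1 y)) fun s hs => ?_
      have hs' : s ∈ Icc 0 T := ⟨hs.1, hs.2.trans ht.2⟩
      rw [← conv_sub hk (hext x).continuousOn (hext y).continuousOn hs']
      refine (abs_conv_le_of_exp hγ0.le dist_nonneg hk hs' fun r hr =>
        hextD x y r ⟨hr.1, hr.2.trans hs'.2⟩).trans ?_
      gcongr
    simp only [Φ, ContinuousMap.coe_mk, Real.dist_eq]
    rw [← mul_sub, add_sub_add_left_eq_sub, abs_mul, abs_of_pos (Real.exp_pos _)]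
    calc _ ≤ Real.exp (-(γ * t)) * (2 * (M * dist x y) / γ * Real.exp (γ * t)) := by gcongr
      _ = 2 * M / γ * dist x y * (Real.exp (-(γ * t)) * Real.exp (γ * t)) := by ring
      _ = 2 * M / γ * dist x y := by rw [← Real.exp_add]; simp
      _ ≤ _ := by gcongr
  have hctr : ContractingWith (1 / 2 : NNReal) Φ := by
    refine ⟨by rw [div_lt_one two_pos]; exact one_lt_two,
      LipschitzWith.of_dist_le_mul fun x y => ?_⟩
    simpa using hdist x y
  obtain ⟨x, hx⟩ : ∃ x, Φ x = x := ⟨_, hctr.fixedPoint_isFixedPt⟩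
  have hA0 : 0 ≤ A := (abs_nonneg _).trans (hA 0 ⟨le_rfl, hT.le⟩)
  have hfix : ∀ t ∈ Icc 0 T, ext x t = U₀ t + R (conv k₁ (ext x)) t := by
    intro t ht
    have h1 : Φ x ⟨t, ht⟩ = x ⟨t, ht⟩ := by rw [hx]
    simp only [Φ, ContinuousMap.coe_mk] at h1
    simp only [ext, IccExtend_of_mem hT.le _ ht]
    rw [← h1, ← mul_assoc, ← Real.exp_add]
    simp [ext]
  -- The a priori bound: compare the fixed point with the image of `0`.
  have hΦ0 : ‖Φ 0‖ ≤ A := by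
    rw [ContinuousMap.norm_le _ hA0]
    rintro ⟨t, ht⟩
    have h0 : R (conv k₁ (ext 0)) t = 0 := by
      have : conv k₁ (ext 0) = fun _ => 0 := by
        ext s; simp [conv, hext0]
      simp [R, this, conv]
    simp only [Φ, ContinuousMap.coe_mk, h0, add_zero]
    rw [Real.norm_eq_abs, abs_mul, abs_of_pos (Real.exp_pos _)]
    have h3 : Real.exp (-(γ * t)) ≤ 1 := Real.exp_le_one_iff.2 (by nlinarith [ht.1])
    calc _ ≤ 1 * |U₀ t| := by gcongr
      _ ≤ A := by rw [one_mul]; exact hA t ht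
  have hxn : ‖x‖ ≤ 2 * A := by
    have h1 := hdist x 0
    rw [hx, dist_zero_right] at h1
    have h2 : ‖x‖ ≤ dist x (Φ 0) + ‖Φ 0‖ := by
      rw [dist_eq_norm]; simpa using norm_add_le (x - Φ 0) (Φ 0)
    linarith
  refine ⟨ext x, hext x, fun t ht => ?_, hfix⟩
  have h1 := hextD x 0 t ht
  rw [hext0, sub_zero, dist_zero_right] at h1
  refine h1.trans ?_
  have h3 : Real.exp (γ * t) ≤ Real.exp (γ * T) := by gcongr; exact ht.2
  calc ‖x‖ * Real.exp (γ * t) ≤ (2 * A) * Real.exp (γ * T) := by gcongr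
    _ = _ := by ring

/-- The mode equation `u'' + lam² (u + κ * u) = f`, `u(0) = a`, `u'(0) = b`, `κ = ∫ k₁`, in
integrated form, with a bound which is uniform in `lam`. -/
theorem exists_mode {T M : ℝ} (hT : 0 < T) (hM : 0 ≤ M) {k₁ : ℝ → ℝ}
    (hk : IntervalIntegrable k₁ volume 0 T) (hkM : ∫ s in (0 : ℝ)..T, |k₁ s| ≤ M)
    {lam : ℝ} (hl : 0 < lam) (a b : ℝ) {f : ℝ → ℝ} (hf : IntervalIntegrable f volume 0 T) :
    ∃ u v : ℝ → ℝ, ContinuousOn u (Icc 0 T) ∧ ContinuousOn v (Icc 0 T) ∧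
      (∀ t ∈ Icc 0 T, u t = a + ∫ s in (0 : ℝ)..t, v s) ∧
      (∀ t ∈ Icc 0 T, v t = b + ∫ s in (0 : ℝ)..t,
        (f s - lam ^ 2 * (u s + conv (fun x => ∫ r in (0 : ℝ)..x, k₁ r) u s))) ∧
      ∀ t ∈ Icc 0 T,
        lam * |u t| ≤ modeConst T M * (lam * |a| + |b| + ∫ s in (0 : ℝ)..T, |f s|) ∧
        |v t| ≤ modeConst T M * (lam * |a| + |b| + ∫ s in (0 : ℝ)..T, |f s|) := by
  set A : ℝ := lam * |a| + |b| + ∫ s in (0 : ℝ)..T, |f s| with hAdef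
  have hf0 : 0 ≤ ∫ s in (0 : ℝ)..T, |f s| :=
    intervalIntegral.integral_nonneg hT.le fun _ _ => abs_nonneg _
  have hA0 : 0 ≤ A := by positivity
  set S : (ℝ → ℝ) → ℝ → ℝ := fun g => conv (fun r => Real.sin (lam * r)) g with hS
  set C : (ℝ → ℝ) → ℝ → ℝ := fun g => conv (fun r => Real.cos (lam * r)) g with hC
  have hsint := intervalIntegrable_sin_mul lam T
  have hcint := intervalIntegrable_cos_mul lam T
  have hmono : ∀ {g : ℝ → ℝ} {t : ℝ}, t ∈ Icc 0 T → IntervalIntegrable g volume 0 T →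
      IntervalIntegrable g volume 0 t := fun {g t} ht hg =>
    hg.mono_set (by rw [uIcc_of_le ht.1, uIcc_of_le hT.le]; exact Icc_subset_Icc_right ht.2)
  have hSc : ∀ g, IntervalIntegrable g volume 0 T → ContinuousOn (S g) (Icc 0 T) := fun g hg =>
    ((continuousOn_primitive hT.le (intervalIntegrable_conv hT.le hcint hg)).const_mul lam).congr
      fun t ht => by beta_reduce; rw [integral_conv_cos hl hg ht, mul_div_cancel₀ _ hl.ne']
  have hCc : ∀ g, IntervalIntegrable g volume 0 T → ContinuousOn (C g) (Icc 0 T) := fun g hg =>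
    ((continuousOn_primitive hT.le hg).sub
      ((continuousOn_primitive hT.le (intervalIntegrable_conv hT.le hsint hg)).const_mul
        lam)).congr fun t ht => by
          simp only [Pi.sub_apply]; rw [integral_conv_sin hl hg ht]; simp [hC]
  -- Duhamel's formula: `U₀` is the solution for `κ = 0`.
  obtain ⟨u, huc, hub, hu⟩ := exists_mode_fixedPoint hT hM hk hkM hl (A := A / lam)
    (U₀ := fun t => a * Real.cos (lam * t) + b * (Real.sin (lam * t) / lam) + S f t / lam)
    (by
      have := hSc f hf
      have h1 : Continuous fun t => a * Real.cos (lam * t) + b * (Real.sin (lam * t) / lam) := by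
        fun_prop
      exact h1.continuousOn.add (this.div_const lam))
    (by
      intro t ht
      rw [le_div_iff₀ hl, ← abs_of_pos hl, ← abs_mul, abs_of_pos hl]
      have h1 : (a * Real.cos (lam * t) + b * (Real.sin (lam * t) / lam) + S f t / lam) * lam
          = lam * a * Real.cos (lam * t) + b * Real.sin (lam * t) + S f t := by field_simp
      rw [h1]
      refine (abs_add_le _ _).trans (add_le_add ((abs_add_le _ _).trans (add_le_add ?_ ?_)) ?_)
      · rw [abs_mul, abs_mul, abs_of_pos hl]
        exact mul_le_of_le_one_right (by positivity) (Real.abs_cos_le_one _)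
      · rw [abs_mul]
        exact mul_le_of_le_one_right (abs_nonneg _) (Real.abs_sin_le_one _)
      · exact abs_conv_le_of_abs_le_one (fun x => Real.abs_sin_le_one _) hf ht)
  set g := conv k₁ u with hgdef
  have hg : IntervalIntegrable g volume 0 T :=
    intervalIntegrable_conv hT.le hk (huc.intervalIntegrable _ _)
  -- the formal derivative of the right-hand side of Duhamel's formula
  set v : ℝ → ℝ := fun t => -(a * lam) * Real.sin (lam * t) + b * Real.cos (lam * t) + C f t
    - lam * S g t with hv
  have hvc : ContinuousOn v (Icc 0 T) := by
    have h1 : Continuous fun t => -(a * lam) * Real.sin (lam * t) + b * Real.cos (lam * t) := by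
      fun_prop
    exact (h1.continuousOn.add (hCc f hf)).sub ((hSc g hg).const_mul lam)
  have hexp : 1 ≤ Real.exp ((4 * M + 1) * T) := Real.one_le_exp (by positivity)
  refine ⟨u, v, huc.continuousOn, hvc, fun t ht => ?_, fun t ht => ?_, fun t ht => ⟨?_, ?_⟩⟩
  · have h1 : ∫ s in (0 : ℝ)..t, v s = -(a * lam) * ((1 - Real.cos (lam * t)) / lam)
        + b * (Real.sin (lam * t) / lam) + S f t / lam
        - ((∫ s in (0 : ℝ)..t, g s) - C g t) := by
      simp only [hv]
      rw [intervalIntegral.integral_sub, intervalIntegral.integral_add,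
        intervalIntegral.integral_add, intervalIntegral.integral_const_mul,
        intervalIntegral.integral_const_mul, intervalIntegral.integral_const_mul,
        integral_sin_mul hl, integral_cos_mul hl, integral_conv_cos hl hf ht,
        integral_conv_sin hl hg ht]
      · exact (hmono ht hsint).const_mul _
      · exact (hmono ht hcint).const_mul _
      · exact ((hmono ht hsint).const_mul _).add ((hmono ht hcint).const_mul _)
      · exact hmono ht (intervalIntegrable_conv hT.le hcint hf)
      · exact (((hmono ht hsint).const_mul _).add ((hmono ht hcint).const_mul _)).add
          (hmono ht (intervalIntegrable_conv hT.le hcint hf))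
      · exact (hmono ht (intervalIntegrable_conv hT.le hsint hg)).const_mul _
    rw [h1, hu t ht]
    simp only [hC]
    field_simp
    ring
  · have h1 : ∀ s ∈ uIcc 0 t, f s - lam ^ 2 * (u s + conv (fun x => ∫ r in (0 : ℝ)..x, k₁ r) u s)
        = -(a * lam ^ 2) * Real.cos (lam * s) - (b * lam) * Real.sin (lam * s) + f s
          - lam * S f s - lam ^ 2 * C g s := by
      intro s hs
      rw [uIcc_of_le ht.1] at hs
      have hs' : s ∈ Icc 0 T := ⟨hs.1, hs.2.trans ht.2⟩
      rw [← integral_conv hk (huc.intervalIntegrable _ _) hs', hu s hs']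
      simp only [hC, hgdef]
      field_simp
      ring
    rw [intervalIntegral.integral_congr h1, intervalIntegral.integral_sub,
      intervalIntegral.integral_sub, intervalIntegral.integral_add,
      intervalIntegral.integral_sub, intervalIntegral.integral_const_mul,
      intervalIntegral.integral_const_mul, intervalIntegral.integral_const_mul,
      intervalIntegral.integral_const_mul,
      integral_sin_mul hl, integral_cos_mul hl, integral_conv_cos hl hg ht,
      integral_conv_sin hl hf ht]
    · simp only [hv, hC, hS]
      field_simp
      ring
    · exact (hmono ht hcint).const_mul _
    · exact (hmono ht hsint).const_mul _
    · exact ((hmono ht hcint).const_mul _).sub ((hmono ht hsint).const_mul _)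
    · exact hmono ht hf
    · exact (((hmono ht hcint).const_mul _).sub ((hmono ht hsint).const_mul _)).add (hmono ht hf)
    · exact (hmono ht (intervalIntegrable_conv hT.le hsint hf)).const_mul _
    · exact ((((hmono ht hcint).const_mul _).sub ((hmono ht hsint).const_mul _)).add
        (hmono ht hf)).sub ((hmono ht (intervalIntegrable_conv hT.le hsint hf)).const_mul _)
    · exact (hmono ht (intervalIntegrable_conv hT.le hcint hg)).const_mul _
  · calc lam * |u t| ≤ lam * (2 * Real.exp ((4 * M + 1) * T) * (A / lam)) := by
          gcongr; exact hub t ht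
      _ = 2 * Real.exp ((4 * M + 1) * T) * 1 * A := by field_simp
      _ ≤ modeConst T M * A := by
          unfold modeConst
          gcongr
          nlinarith [mul_nonneg hT.le hM]
  · have hgb : lam * ∫ s in (0 : ℝ)..T, |g s| ≤ T * M * (2 * Real.exp ((4 * M + 1) * T)) * A := by
      have h2 : ∀ s ∈ Icc 0 T, |g s| ≤ M * (2 * Real.exp ((4 * M + 1) * T) * (A / lam)) := by
        intro s hs
        have := abs_conv_le_of_exp (γ := 0) (D := 2 * Real.exp ((4 * M + 1) * T) * (A / lam))
          le_rfl (by positivity) hk hs (fun r hr => by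
            simpa using hub r ⟨hr.1, hr.2.trans hs.2⟩)
        simp only [zero_mul, Real.exp_zero, mul_one] at this
        refine this.trans ?_
        gcongr
      have h3 : ∫ s in (0 : ℝ)..T, |g s|
          ≤ ∫ s in (0 : ℝ)..T, M * (2 * Real.exp ((4 * M + 1) * T) * (A / lam)) :=
        intervalIntegral.integral_mono_on hT.le hg.abs intervalIntegrable_const h2
      rw [intervalIntegral.integral_const, sub_zero, smul_eq_mul] at h3
      calc _ ≤ lam * (T * (M * (2 * Real.exp ((4 * M + 1) * T) * (A / lam)))) := by gcongr
        _ = _ := by field_simp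
    have h1 : |v t| ≤ A + T * M * (2 * Real.exp ((4 * M + 1) * T)) * A := by
      simp only [hv]
      refine (abs_sub _ _).trans (add_le_add ((abs_add_le _ _).trans (add_le_add
        ((abs_add_le _ _).trans (add_le_add ?_ ?_)) ?_)) ?_)
      · rw [abs_mul, abs_neg, abs_mul, abs_of_pos hl, mul_comm |a|]
        exact mul_le_of_le_one_right (by positivity) (Real.abs_sin_le_one _)
      · rw [abs_mul]
        exact mul_le_of_le_one_right (abs_nonneg _) (Real.abs_cos_le_one _)
      · exact abs_conv_le_of_abs_le_one (fun x => Real.abs_cos_le_one _) hf ht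
      · rw [abs_mul, abs_of_pos hl]
        refine le_trans ?_ hgb
        gcongr
        exact abs_conv_le_of_abs_le_one (fun x => Real.abs_sin_le_one _) hg ht
    refine h1.trans ?_
    unfold modeConst
    nlinarith [mul_le_mul_of_nonneg_right hexp hA0]

/-- Uniqueness for the homogeneous mode equation with a bounded kernel. -/
theorem mode_unique {T M : ℝ} (hT : 0 < T) {κ : ℝ → ℝ} (hκ : IntervalIntegrable κ volume 0 T)
    (hκM : ∫ s in (0 : ℝ)..T, |κ s| ≤ M) {lam : ℝ} {δ : ℝ → ℝ} (hδ : ContinuousOn δ (Icc 0 T))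
    (h : ∀ t ∈ Icc 0 T, δ t = -∫ s in (0 : ℝ)..t, ∫ r in (0 : ℝ)..s,
      lam ^ 2 * (δ r + conv κ δ r)) :
    ∀ t ∈ Icc 0 T, δ t = 0 := by
  have hM : 0 ≤ M := (intervalIntegral.integral_nonneg hT.le fun _ _ => abs_nonneg _).trans hκM
  -- With this weight the right-hand side is a contraction by the factor `1 / 2`.
  set γ : ℝ := 2 * lam ^ 2 * (1 + M) + 1 with hγ
  have hγ1 : 1 ≤ γ := by rw [hγ]; nlinarith [mul_nonneg (sq_nonneg lam) hM, sq_nonneg lam]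
  have hγ0 : 0 < γ := by linarith
  -- `D` is the norm of `δ` in the weight `exp (-γ t)`, attained at `t₀`.
  obtain ⟨t₀, ht₀, hmax⟩ := isCompact_Icc.exists_isMaxOn (nonempty_Icc.2 hT.le)
    (f := fun t => Real.exp (-(γ * t)) * |δ t|)
    (ContinuousOn.mul (by fun_prop) hδ.abs)
  set D := Real.exp (-(γ * t₀)) * |δ t₀| with hD
  have hD0 : 0 ≤ D := by positivity
  have hb : ∀ t ∈ Icc 0 T, |δ t| ≤ D * Real.exp (γ * t) := by
    intro t ht
    have h1 : Real.exp (-(γ * t)) * |δ t| ≤ D := hmax ht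
    calc |δ t| = Real.exp (-(γ * t)) * |δ t| * Real.exp (γ * t) := by
          rw [mul_right_comm, ← Real.exp_add]; simp
      _ ≤ _ := by gcongr
  have h1 : |δ t₀| ≤ lam ^ 2 * (1 + M) * D / γ / γ * Real.exp (γ * t₀) := by
    rw [h t₀ ht₀, abs_neg]
    refine abs_integral_le_of_exp hγ0 ht₀.1 (by positivity) fun s hs => ?_
    refine abs_integral_le_of_exp hγ0 hs.1 (by positivity) fun r hr => ?_
    have hr' : r ∈ Icc 0 T := ⟨hr.1, hr.2.trans (hs.2.trans ht₀.2)⟩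
    rw [abs_mul, abs_of_nonneg (sq_nonneg lam), mul_assoc, mul_assoc]
    gcongr
    refine (abs_add_le _ _).trans ?_
    have h2 := abs_conv_le_of_exp hγ0.le hD0 hκ hr' (fun x hx => hb x ⟨hx.1, hx.2.trans hr'.2⟩)
    have h3 : (∫ s in (0 : ℝ)..T, |κ s|) * D * Real.exp (γ * r) ≤ M * D * Real.exp (γ * r) := by
      gcongr
    linarith [hb r hr']
  have h2 : D ≤ lam ^ 2 * (1 + M) * D / γ / γ := by
    calc D ≤ Real.exp (-(γ * t₀)) * (lam ^ 2 * (1 + M) * D / γ / γ * Real.exp (γ * t₀)) := by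
          rw [hD]; gcongr
      _ = lam ^ 2 * (1 + M) * D / γ / γ * (Real.exp (-(γ * t₀)) * Real.exp (γ * t₀)) := by ring
      _ = _ := by rw [← Real.exp_add]; simp
  have hD1 : D = 0 := by
    rw [div_div, le_div_iff₀ (by positivity)] at h2
    have h4 : γ ≤ γ * γ := by nlinarith
    have h5 : 2 * (lam ^ 2 * (1 + M) * D) ≤ γ * D := by rw [hγ]; nlinarith
    have h6 : D * γ ≤ D * (γ * γ) := by gcongr
    by_contra hne
    have h7 : 0 < D := lt_of_le_of_ne hD0 (Ne.symm hne)
    nlinarith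
  intro t ht
  have := hb t ht
  rw [hD1, zero_mul] at this
  exact abs_eq_zero.1 (le_antisymm this (abs_nonneg _))

/-! ### The kernel -/

/-- The function `x ↦ 1 / Γ(1 - x)`, which is smooth on the whole line. -/
noncomputable def recGamma (x : ℝ) : ℝ := (Real.Gamma (1 - x))⁻¹

theorem contDiff_recGamma : ContDiff ℝ ∞ recGamma := by
  have h1 : ContDiff ℂ ∞ fun s : ℂ => (Complex.Gamma (1 - s))⁻¹ :=
    Complex.differentiable_one_div_Gamma.contDiff.comp (contDiff_const.sub contDiff_id)
  rw [contDiff_iff_contDiffAt]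
  intro x
  have h2 := (h1.contDiffAt (x := (x : ℂ))).real_of_complex
  refine h2.congr_of_eventuallyEq (Filter.Eventually.of_forall fun y => ?_)
  simp only [recGamma]
  rw [← Complex.ofReal_one, ← Complex.ofReal_sub, Complex.Gamma_ofReal, ← Complex.ofReal_inv,
    Complex.ofReal_re]

theorem exists_bound_recGamma (αs : ℝ) : ∃ P, 0 ≤ P ∧ ∀ x ∈ Icc 0 αs, |recGamma x| ≤ P ∧
    |deriv recGamma x| ≤ P ∧ |deriv (deriv recGamma) x| ≤ P := by
  have hc0 : Continuous recGamma := contDiff_recGamma.continuous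
  have hd1 : ContDiff ℝ ∞ (deriv recGamma) := (contDiff_infty_iff_deriv.1 contDiff_recGamma).2
  have hd2 : ContDiff ℝ ∞ (deriv (deriv recGamma)) := (contDiff_infty_iff_deriv.1 hd1).2
  obtain ⟨P0, h0⟩ := isCompact_Icc.exists_bound_of_continuousOn (s := Icc 0 αs) hc0.continuousOn
  obtain ⟨P1, h1⟩ := isCompact_Icc.exists_bound_of_continuousOn (s := Icc 0 αs)
    hd1.continuous.continuousOn
  obtain ⟨P2, h2⟩ := isCompact_Icc.exists_bound_of_continuousOn (s := Icc 0 αs)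
    hd2.continuous.continuousOn
  refine ⟨max 0 (max P0 (max P1 P2)), le_max_left _ _, fun x hx => ⟨?_, ?_, ?_⟩⟩
  · exact (h0 x hx).trans (by simp)
  · exact (h1 x hx).trans (by simp)
  · exact (h2 x hx).trans (by simp)

theorem abs_log_le_add_inv {t : ℝ} (ht : 0 < t) : t * |Real.log t| ≤ t ^ 2 + 1 := by
  have h1 := Real.log_le_sub_one_of_pos ht
  have h2 := Real.log_le_sub_one_of_pos (inv_pos.2 ht)
  rw [Real.log_inv] at h2
  have h3 : |Real.log t| ≤ t + t⁻¹ := by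
    rw [abs_le]; constructor <;> linarith [inv_pos.2 ht]
  calc t * |Real.log t| ≤ t * (t + t⁻¹) := by gcongr
    _ = _ := by field_simp

/-- `|log t|` is square integrable near `0`, being bounded by a multiple of `t ^ (-1 / 4)`. -/
theorem integrableOn_sq_log (T C₀ C₁ : ℝ) :
    IntegrableOn (fun t => (C₀ + C₁ * |Real.log t|) ^ 2) (Ioo 0 T) := by
  rcases le_or_gt T 0 with hT | hT
  · simp [Ioo_eq_empty_of_le hT]
  have hb : ∀ t ∈ Ioo 0 T, |Real.log t| * t ^ (1 / 4 : ℝ) ≤ 4 + T * T ^ (1 / 4 : ℝ) := by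
    intro t ht
    rcases le_or_gt t 1 with h1 | h1
    · have := Real.abs_log_mul_self_rpow_lt t (1 / 4) ht.1 h1 (by norm_num)
      rw [abs_mul, abs_of_nonneg (Real.rpow_nonneg ht.1.le _)] at this
      have h2 : 0 ≤ T * T ^ (1 / 4 : ℝ) := by positivity
      norm_num at this ⊢; linarith
    · have h2 : |Real.log t| ≤ T := by
        rw [abs_of_nonneg (Real.log_nonneg h1.le)]
        linarith [Real.log_le_sub_one_of_pos ht.1, ht.2]
      have h3 : t ^ (1 / 4 : ℝ) ≤ T ^ (1 / 4 : ℝ) :=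
        Real.rpow_le_rpow ht.1.le ht.2.le (by norm_num)
      have : |Real.log t| * t ^ (1 / 4 : ℝ) ≤ T * T ^ (1 / 4 : ℝ) := by
        gcongr
      linarith
  set W := 4 + T * T ^ (1 / 4 : ℝ)
  have hint : IntegrableOn (fun t : ℝ => 2 * C₀ ^ 2 + 2 * (C₁ ^ 2 * W ^ 2) * t ^ (-(1 / 2) : ℝ))
      (Ioo 0 T) := by
    have h1 : IntervalIntegrable (fun t : ℝ => t ^ (-(1 / 2) : ℝ)) volume 0 T :=
      intervalIntegral.intervalIntegrable_rpow' (by norm_num)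
    exact ((intervalIntegrable_iff_integrableOn_Ioo_of_le hT.le).1
      (intervalIntegrable_const.add (h1.const_mul _)))
  refine hint.mono' (by fun_prop) ?_
  filter_upwards [ae_restrict_mem measurableSet_Ioo] with t ht
  rw [Real.norm_eq_abs, abs_of_nonneg (sq_nonneg _)]
  have h1 : |Real.log t| ^ 2 ≤ W ^ 2 * t ^ (-(1 / 2) : ℝ) := by
    have hp : 0 < t ^ (1 / 4 : ℝ) := Real.rpow_pos_of_pos ht.1 _
    have h2 : t ^ (-(1 / 2) : ℝ) = (t ^ (1 / 4 : ℝ) * t ^ (1 / 4 : ℝ))⁻¹ := by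
      rw [← Real.rpow_add ht.1, ← Real.rpow_neg ht.1.le]; norm_num
    rw [h2, ← div_eq_mul_inv, le_div_iff₀ (by positivity)]
    have h3 := hb t ht
    calc _ = (|Real.log t| * t ^ (1 / 4 : ℝ)) ^ 2 := by ring
      _ ≤ _ := by gcongr
  nlinarith [sq_nonneg (C₀ - C₁ * |Real.log t|), mul_le_mul_of_nonneg_left h1 (sq_nonneg C₁)]

/-- The closed form of the kernel, with `a₁` the derivative of the order `a`. -/
noncomputable def kernelForm (a a₁ : ℝ → ℝ) (t : ℝ) : ℝ :=
  Real.exp (-(a t) * Real.log t) * ((-(a₁ t) * Real.log t - a t / t) * recGamma (a t)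
    + deriv recGamma (a t) * a₁ t)

/-- The closed form of the derivative of the kernel, with `a₁`, `a₂` the derivatives of `a`. -/
noncomputable def kernelDerivForm (a a₁ a₂ : ℝ → ℝ) (t : ℝ) : ℝ :=
  let L := -(a₁ t) * Real.log t - a t / t
  Real.exp (-(a t) * Real.log t) * (L * (L * recGamma (a t) + deriv recGamma (a t) * a₁ t)
    + ((-(a₂ t) * Real.log t - 2 * (a₁ t / t) + a t / t ^ 2) * recGamma (a t)
      + L * (deriv recGamma (a t) * a₁ t)
      + (deriv (deriv recGamma) (a t) * a₁ t * a₁ t + deriv recGamma (a t) * a₂ t)))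

theorem hasDerivAt_exp_neg_mul_log {a : ℝ → ℝ} {a₁ t : ℝ} (ht : 0 < t) (h : HasDerivAt a a₁ t) :
    HasDerivAt (fun s => Real.exp (-(a s) * Real.log s))
      (Real.exp (-(a t) * Real.log t) * (-a₁ * Real.log t - a t / t)) t := by
  convert! (h.neg.mul (Real.hasDerivAt_log ht.ne')).exp using 1
  simp only [Pi.neg_apply, Pi.mul_apply]
  ring

theorem kernel_eq_kernelForm {a a₁ : ℝ → ℝ} {t : ℝ} (ht : 0 < t) (h : HasDerivAt a (a₁ t) t) :
    kernel a t = kernelForm a a₁ t := by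
  have h1 : HasDerivAt (fun s => Real.exp (-(a s) * Real.log s) * recGamma (a s))
      (kernelForm a a₁ t) t := by
    have hr : HasDerivAt recGamma (deriv recGamma (a t)) (a t) :=
      (contDiff_recGamma.differentiable (by simp) _).hasDerivAt
    convert! (hasDerivAt_exp_neg_mul_log ht h).mul (hr.comp t h) using 1
    simp only [kernelForm, Function.comp]
    ring
  refine (h1.congr_of_eventuallyEq ?_).deriv
  filter_upwards [lt_mem_nhds ht] with s hs
  rw [Real.rpow_def_of_pos hs, recGamma, div_eq_mul_inv, mul_comm (Real.log s)]

theorem hasDerivAt_kernelForm {a a₁ a₂ : ℝ → ℝ} {t : ℝ} (ht : 0 < t)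
    (h : HasDerivAt a (a₁ t) t) (h' : HasDerivAt a₁ (a₂ t) t) :
    HasDerivAt (kernelForm a a₁) (kernelDerivForm a a₁ a₂ t) t := by
  have hd1 : ContDiff ℝ ∞ (deriv recGamma) := (contDiff_infty_iff_deriv.1 contDiff_recGamma).2
  have hr : HasDerivAt (fun s => recGamma (a s)) (deriv recGamma (a t) * a₁ t) t :=
    (contDiff_recGamma.differentiable (by simp) _).hasDerivAt.comp t h
  have hr1 : HasDerivAt (fun s => deriv recGamma (a s)) (deriv (deriv recGamma) (a t) * a₁ t) t :=
    (hd1.differentiable (by simp) _).hasDerivAt.comp t h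
  have hL : HasDerivAt (fun s => -(a₁ s) * Real.log s - a s / s)
      (-(a₂ t) * Real.log t - 2 * (a₁ t / t) + a t / t ^ 2) t := by
    convert! (h'.neg.mul (Real.hasDerivAt_log ht.ne')).sub (h.div (hasDerivAt_id t) ht.ne') using 1
    simp only [id, Pi.neg_apply]
    field_simp
    ring
  convert! (hasDerivAt_exp_neg_mul_log ht h).mul ((hL.mul hr).add (hr1.mul h')) using 1
  simp only [kernelDerivForm, Pi.mul_apply, Pi.add_apply]
  ring

/-- Under the assumption on the order, the kernel is the primitive of a square integrable function
`k₁`, bounded in `L¹` and `L²` in terms of the constants of the assumption only. In particular, it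
vanishes at `0`. Near `0` the order is `O(t²)` and its derivative is `O(t)`, so that
`k₁ = O(1 + |log t|)`. -/
theorem exists_kernel_primitive {T : ℝ} (hT : 0 < T) (αs B : ℝ) :
    ∃ M, 0 ≤ M ∧ ∀ α, AssumptionA T αs B α → ∃ k₁ : ℝ → ℝ,
      IntervalIntegrable k₁ volume 0 T ∧ IntervalIntegrable (fun t => k₁ t ^ 2) volume 0 T ∧
      ∫ t in (0 : ℝ)..T, |k₁ t| ≤ M ∧ ∫ t in (0 : ℝ)..T, k₁ t ^ 2 ≤ M ∧
      ∀ t ∈ Ioo 0 T, kernel α t = ∫ s in (0 : ℝ)..t, k₁ s := by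
  obtain ⟨P, hP0, hP⟩ := exists_bound_recGamma αs
  -- On `(0, T)`: `t |log t| ≤ W`, `exp (-α log t) ≤ E₀`, `|α' log t + α / t| ≤ L₀`, and
  -- `C₀ + C₁ |log t|` bounds the derivative of the kernel.
  set W := T ^ 2 + 1 with hW
  set E₀ := Real.exp (B * T * W)
  set L₀ := B * W + B * T with hL₀
  set C₀ := E₀ * (L₀ * (L₀ * P + P * (B * T)) + (3 * B * P + L₀ * (P * (B * T))
    + (P * (B * T) * (B * T) + P * B))) with hC₀
  set C₁ := E₀ * (B * P) with hC₁
  set Ψ : ℝ → ℝ := fun t => (C₀ + C₁ * |Real.log t|) ^ 2 with hΨ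
  have hΨi : IntegrableOn Ψ (Ioo 0 T) := integrableOn_sq_log T C₀ C₁
  have hI : ∀ f : ℝ → ℝ, ∫ t in (0 : ℝ)..T, f t = ∫ t in Ioo 0 T, f t := fun f => by
    rw [intervalIntegral.integral_of_le hT.le, integral_Ioc_eq_integral_Ioo]
  have hΨ0 : 0 ≤ ∫ t in Ioo 0 T, Ψ t := integral_nonneg fun t => sq_nonneg _
  -- The summand `T` comes from `|k₁| ≤ 1 + k₁²`.
  refine ⟨T + ∫ t in Ioo 0 T, Ψ t, by positivity, fun α hα => ?_⟩
  obtain ⟨-, hα0, a₁, a₂, hd, h0, h10⟩ := hα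
  have hB : 0 ≤ B := (abs_nonneg _).trans (hd 0 ⟨le_rfl, hT.le⟩).2.2.1
  have hmv : ∀ {f f' : ℝ → ℝ} {C : ℝ}, (∀ t ∈ Icc 0 T, HasDerivWithinAt f (f' t) (Icc 0 T) t) →
      ∀ t ∈ Icc 0 T, (∀ s ∈ Icc 0 t, |f' s| ≤ C) → f 0 = 0 → |f t| ≤ C * t := by
    intro f f' C hf t ht hC hf0
    have := Convex.norm_image_sub_le_of_norm_hasDerivWithin_le (f := f) (f' := f')
      (s := Icc 0 t) (C := C) (x := 0) (y := t)
      (fun s hs => (hf s ⟨hs.1, hs.2.trans ht.2⟩).mono (Icc_subset_Icc_right ht.2))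
      (fun s hs => hC s hs) (convex_Icc 0 t) ⟨le_rfl, ht.1⟩ ⟨ht.1, le_rfl⟩
    simpa [hf0, abs_of_nonneg ht.1] using this
  have ha1 : ∀ t ∈ Icc 0 T, |a₁ t| ≤ B * t := fun t ht =>
    hmv (fun s hs => (hd s hs).2.1) t ht (fun s hs => (hd s ⟨hs.1, hs.2.trans ht.2⟩).2.2.2) h10
  have ha : ∀ t ∈ Icc 0 T, |α t| ≤ B * t * t := fun t ht =>
    hmv (fun s hs => (hd s hs).1) t ht (fun s hs => (ha1 s ⟨hs.1, hs.2.trans ht.2⟩).trans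
      (by gcongr; exact hs.2)) h0
  have hda : ∀ t ∈ Ioo 0 T, HasDerivAt α (a₁ t) t := fun t ht =>
    (hd t (Ioo_subset_Icc_self ht)).1.hasDerivAt (Icc_mem_nhds ht.1 ht.2)
  have hda1 : ∀ t ∈ Ioo 0 T, HasDerivAt a₁ (a₂ t) t := fun t ht =>
    (hd t (Ioo_subset_Icc_self ht)).2.1.hasDerivAt (Icc_mem_nhds ht.1 ht.2)
  have hlog : ∀ t ∈ Ioo 0 T, t * |Real.log t| ≤ W := fun t ht =>
    (abs_log_le_add_inv ht.1).trans (by rw [hW]; gcongr; exact ht.1.le; exact ht.2.le)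
  have hE : ∀ t ∈ Ioo 0 T, |Real.exp (-(α t) * Real.log t)| ≤ E₀ := by
    intro t ht
    rw [abs_of_pos (Real.exp_pos _)]
    refine Real.exp_le_exp.2 ((le_abs_self _).trans ?_)
    rw [abs_mul, abs_neg]
    calc |α t| * |Real.log t| ≤ B * t * t * |Real.log t| := by
          gcongr; exact ha t (Ioo_subset_Icc_self ht)
      _ = B * t * (t * |Real.log t|) := by ring
      _ ≤ B * T * W := by
          have := hlog t ht
          have h2 := ht.1.le
          gcongr
          exact ht.2.le
  have hdiv : ∀ t ∈ Ioo 0 T, |α t / t| ≤ B * t ∧ |a₁ t / t| ≤ B ∧ |α t / t ^ 2| ≤ B := by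
    intro t ht
    have h1 := ha t (Ioo_subset_Icc_self ht)
    have h2 := ha1 t (Ioo_subset_Icc_self ht)
    have h3 := ht.1
    refine ⟨?_, ?_, ?_⟩
    · rw [abs_div, abs_of_pos ht.1, div_le_iff₀ ht.1]; exact h1
    · rw [abs_div, abs_of_pos ht.1, div_le_iff₀ ht.1]; exact h2
    · rw [abs_div, abs_of_pos (pow_pos ht.1 2), div_le_iff₀ (pow_pos ht.1 2)]; linarith
  have hL : ∀ t ∈ Ioo 0 T, |-(a₁ t) * Real.log t - α t / t| ≤ B * (t * |Real.log t|) + B * t := by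
    intro t ht
    refine (abs_sub _ _).trans (add_le_add ?_ (hdiv t ht).1)
    rw [abs_mul, abs_neg, ← mul_assoc]
    gcongr
    exact ha1 t (Ioo_subset_Icc_self ht)
  have hL' : ∀ t ∈ Ioo 0 T, |-(a₁ t) * Real.log t - α t / t| ≤ L₀ := fun t ht =>
    (hL t ht).trans (by have := hlog t ht; have := ht.2; rw [hL₀]; gcongr)
  have hL0' : 0 ≤ L₀ := by rw [hL₀]; positivity
  have hk1 : ∀ t ∈ Ioo 0 T, |kernelDerivForm α a₁ a₂ t| ≤ C₀ + C₁ * |Real.log t| := by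
    intro t ht
    obtain ⟨hp0, hp1, hp2⟩ := hP (α t) (hα0 t (Ioo_subset_Icc_self ht))
    have hb1 : |a₁ t| ≤ B * T := (ha1 t (Ioo_subset_Icc_self ht)).trans
      (by gcongr; exact ht.2.le)
    have hb2 := (hd t (Ioo_subset_Icc_self ht)).2.2.2
    have hLd : |-(a₂ t) * Real.log t - 2 * (a₁ t / t) + α t / t ^ 2|
        ≤ B * |Real.log t| + 3 * B := by
      have h1 : |-(a₂ t) * Real.log t| ≤ B * |Real.log t| := by
        rw [abs_mul, abs_neg]; gcongr
      have h2 := (hdiv t ht).2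
      refine (abs_add_le _ _).trans ?_
      refine (add_le_add_left (abs_sub _ _) _).trans ?_
      rw [abs_mul 2, abs_two]
      linarith [h2.1, h2.2]
    have e1 : C₀ + C₁ * |Real.log t| = E₀ * (L₀ * (L₀ * P + P * (B * T))
      + ((B * |Real.log t| + 3 * B) * P + L₀ * (P * (B * T))
      + (P * (B * T) * (B * T) + P * B))) := by rw [hC₀, hC₁]; ring
    rw [e1]
    simp only [kernelDerivForm]
    have m : ∀ {x y X Y : ℝ}, |x| ≤ X → |y| ≤ Y → |x * y| ≤ X * Y := fun {x y X Y} hx hy => by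
      rw [abs_mul]; exact mul_le_mul hx hy (abs_nonneg _) ((abs_nonneg _).trans hx)
    have p : ∀ {x y X Y : ℝ}, |x| ≤ X → |y| ≤ Y → |x + y| ≤ X + Y := fun {x y X Y} hx hy =>
      (abs_add_le _ _).trans (add_le_add hx hy)
    exact m (hE t ht) (p (m (hL' t ht) (p (m (hL' t ht) hp0) (m hp1 hb1)))
      (p (p (m hLd hp0) (m (hL' t ht) (m hp1 hb1))) (p (m (m hp2 hb1) hb1) (m hp1 hb2))))
  have hk0 : ∀ t ∈ Ioo 0 T, |kernelForm α a₁ t|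
      ≤ E₀ * ((B * |t * Real.log t| + B * t) * P + P * (B * t)) := by
    intro t ht
    obtain ⟨hp0, hp1, -⟩ := hP (α t) (hα0 t (Ioo_subset_Icc_self ht))
    simp only [kernelForm]
    rw [abs_mul]
    have h1 := hE t ht
    refine mul_le_mul h1 ((abs_add_le _ _).trans ?_) (abs_nonneg _) (Real.exp_pos _).le
    rw [abs_mul, abs_mul, abs_mul t, abs_of_pos ht.1]
    have := ha1 t (Ioo_subset_Icc_self ht)
    have h3 := hL t ht
    have h4 : 0 ≤ B * (t * |Real.log t|) + B * t := (abs_nonneg _).trans h3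
    gcongr
  have hder : ∀ t ∈ Ioo 0 T, HasDerivAt (kernelForm α a₁) (kernelDerivForm α a₁ a₂ t) t :=
    fun t ht => hasDerivAt_kernelForm ht.1 (hda t ht) (hda1 t ht)
  have hdeq : ∀ t ∈ Ioo 0 T, deriv (kernelForm α a₁) t = kernelDerivForm α a₁ a₂ t :=
    fun t ht => (hder t ht).deriv
  -- `k₁` is taken as `deriv` of the kernel, since any `deriv` is measurable.
  have hmeas : Measurable (deriv (kernelForm α a₁)) := measurable_deriv _
  have hsq : ∀ t ∈ Ioo 0 T, deriv (kernelForm α a₁) t ^ 2 ≤ Ψ t := by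
    intro t ht
    rw [hdeq t ht, ← sq_abs]
    exact pow_le_pow_left₀ (abs_nonneg _) (hk1 t ht) 2
  have hab : ∀ t ∈ Ioo 0 T, |deriv (kernelForm α a₁) t| ≤ 1 + Ψ t := by
    intro t ht
    have := hsq t ht
    rw [← sq_abs] at this
    nlinarith [sq_nonneg (|deriv (kernelForm α a₁) t| - 1)]
  have h1Ψ : IntegrableOn (fun t => 1 + Ψ t) (Ioo 0 T) := (integrable_const _).add hΨi
  have hi1 : IntegrableOn (deriv (kernelForm α a₁)) (Ioo 0 T) := by
    refine h1Ψ.mono' hmeas.aestronglyMeasurable ?_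
    filter_upwards [ae_restrict_mem measurableSet_Ioo] with t ht using hab t ht
  have hi2 : IntegrableOn (fun t => deriv (kernelForm α a₁) t ^ 2) (Ioo 0 T) := by
    refine hΨi.mono' (hmeas.pow_const 2).aestronglyMeasurable ?_
    filter_upwards [ae_restrict_mem measurableSet_Ioo] with t ht
    rw [Real.norm_eq_abs, abs_of_nonneg (sq_nonneg _)]
    exact hsq t ht
  have hii := (intervalIntegrable_iff_integrableOn_Ioo_of_le hT.le).2 hi1
  refine ⟨deriv (kernelForm α a₁), hii,
    (intervalIntegrable_iff_integrableOn_Ioo_of_le hT.le).2 hi2, ?_, ?_, fun t ht => ?_⟩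
  · rw [hI]
    refine (setIntegral_mono_on hi1.abs h1Ψ measurableSet_Ioo hab).trans ?_
    rw [integral_add (integrable_const _) hΨi]
    simp [hT.le]
  · rw [hI]
    refine (setIntegral_mono_on hi2 hΨi measurableSet_Ioo hsq).trans ?_
    linarith
  · rw [kernel_eq_kernelForm ht.1 (hda t ht), intervalIntegral.integral_eq_sub_of_hasDerivAt_of_le
      (f := kernelForm α a₁) ht.1.le ?_ ?_ ?_]
    · simp [kernelForm, h10, h0]
    · intro s hs
      rcases eq_or_lt_of_le hs.1 with h | h
      · subst h
        -- With the conventions `log 0 = 0` and `x / 0 = 0`, the value of `kernelForm` at `0` is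
        -- `0`, which is its limit there.
        have hz : kernelForm α a₁ 0 = 0 := by simp [kernelForm, h10, h0]
        rw [ContinuousWithinAt, hz]
        have hlim : Filter.Tendsto
            (fun x => E₀ * ((B * |x * Real.log x| + B * x) * P + P * (B * x)))
            (nhdsWithin 0 (Icc 0 t)) (nhds 0) := by
          have hc : Continuous fun x =>
              E₀ * ((B * |x * Real.log x| + B * x) * P + P * (B * x)) := by
            have := Real.continuous_mul_log
            fun_prop
          have := hc.tendsto 0
          simp only [mul_zero, zero_mul, abs_zero, add_zero] at this
          exact this.mono_left nhdsWithin_le_nhds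
        refine squeeze_zero_norm' ?_ hlim
        filter_upwards [self_mem_nhdsWithin] with x hx
        rcases eq_or_lt_of_le hx.1 with h | h
        · subst h; simp [hz]
        · exact hk0 x ⟨h, hx.2.trans_lt ht.2⟩
      · exact (hder s ⟨h, hs.2.trans_lt ht.2⟩).continuousAt.continuousWithinAt
    · intro s hs
      have hs' : s ∈ Ioo 0 T := ⟨hs.1, hs.2.trans ht.2⟩
      rw [hdeq s hs']
      exact hder s hs'
    · exact hii.mono_set (by
        rw [uIcc_of_le ht.1.le, uIcc_of_le hT.le]; exact Icc_subset_Icc_right ht.2.le)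

/-! ### Weak derivatives in time -/

section Weak

variable {X : Type*} [NormedAddCommGroup X] [NormedSpace ℝ X] {T : ℝ}

/-- A continuous function with compact support is a bounded multiplier of integrable functions. -/
theorem integrable_test_smul {η : ℝ → ℝ} (hη : Continuous η) (hc : HasCompactSupport η)
    {u : ℝ → X} (hu : Integrable u (timeMeasure T)) :
    Integrable (fun t => η t • u t) (timeMeasure T) := by
  obtain ⟨C, hC⟩ := hη.bounded_above_of_compact_support hc
  exact hu.bdd_smul C hη.aestronglyMeasurable (Filter.Eventually.of_forall hC)

theorem continuous_deriv_of_smooth {η : ℝ → ℝ} (hη : ContDiff ℝ ∞ η) : Continuous (deriv η) :=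
  hη.continuous_deriv (by simp)

theorem HasWeakTimeDeriv.congr {u u' w w' : ℝ → X} (h : HasWeakTimeDeriv T u w)
    (hu : u' =ᵐ[timeMeasure T] u) (hw : w' =ᵐ[timeMeasure T] w) : HasWeakTimeDeriv T u' w' := by
  intro η h1 h2 h3
  rw [integral_congr_ae (hu.mono fun t ht => by simp only [ht] :
      (fun t => deriv η t • u' t) =ᵐ[timeMeasure T] fun t => deriv η t • u t),
    integral_congr_ae (hw.mono fun t ht => by simp only [ht] :
      (fun t => η t • w' t) =ᵐ[timeMeasure T] fun t => η t • w t)]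
  exact h η h1 h2 h3

theorem HasWeakTimeDeriv.sub {u u' w w' : ℝ → X} (h : HasWeakTimeDeriv T u w)
    (h' : HasWeakTimeDeriv T u' w')
    (hu : Integrable u (timeMeasure T)) (hw : Integrable w (timeMeasure T))
    (hu' : Integrable u' (timeMeasure T)) (hw' : Integrable w' (timeMeasure T)) :
    HasWeakTimeDeriv T (fun t => u t - u' t) (fun t => w t - w' t) := by
  intro η h1 h2 h3
  have hd := continuous_deriv_of_smooth h1
  simp only [smul_sub]
  rw [integral_sub (integrable_test_smul hd h2.deriv hu) (integrable_test_smul hd h2.deriv hu'),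
    integral_sub (integrable_test_smul h1.continuous h2 hw)
      (integrable_test_smul h1.continuous h2 hw'), h η h1 h2 h3, h' η h1 h2 h3]
  abel

theorem HasWeakTimeDeriv.const_mul {u w : ℝ → ℝ} (h : HasWeakTimeDeriv T u w) (c : ℝ) :
    HasWeakTimeDeriv T (fun t => c * u t) (fun t => c * w t) := by
  intro η h1 h2 h3
  have := h η h1 h2 h3
  simp only [smul_eq_mul, mul_left_comm _ c] at this ⊢
  rw [integral_const_mul, integral_const_mul, this, mul_neg]

theorem integrable_timeMeasure_iff (hT : 0 ≤ T) {g : ℝ → ℝ} :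
    Integrable g (timeMeasure T) ↔ IntervalIntegrable g volume 0 T :=
  (intervalIntegrable_iff_integrableOn_Ioo_of_le hT).symm

theorem integral_timeMeasure (hT : 0 ≤ T) (g : ℝ → ℝ) :
    ∫ t in Ioo 0 T, g t = ∫ t in (0 : ℝ)..T, g t := by
  rw [intervalIntegral.integral_of_le hT, integral_Ioc_eq_integral_Ioo]

theorem test_eq_zero {η : ℝ → ℝ} (h3 : tsupport η ⊆ Ioo 0 T) : η 0 = 0 ∧ η T = 0 :=
  ⟨image_eq_zero_of_notMem_tsupport fun h => lt_irrefl _ (h3 h).1,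
    image_eq_zero_of_notMem_tsupport fun h => lt_irrefl _ (h3 h).2⟩

/-- A primitive of an integrable function has this function as its weak derivative. -/
theorem hasWeakTimeDeriv_primitive (hT : 0 < T) {u g : ℝ → ℝ} {c : ℝ}
    (hg : IntervalIntegrable g volume 0 T)
    (hu : ∀ t ∈ Ioo 0 T, u t = c + ∫ s in (0 : ℝ)..t, g s) : HasWeakTimeDeriv T u g := by
  intro η h1 h2 h3
  obtain ⟨h0, hT0⟩ := test_eq_zero h3
  have hηac : AbsolutelyContinuousOnInterval η 0 T :=
    (h1.of_le (by exact_mod_cast le_top)).contDiffOn.absolutelyContinuousOnInterval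
  have hGac : AbsolutelyContinuousOnInterval (fun t => ∫ s in (0 : ℝ)..t, g s) 0 T :=
    hg.absolutelyContinuousOnInterval_intervalIntegral (by simp)
  have hparts := hηac.integral_mul_deriv_eq_deriv_mul hGac
  have e1 : ∫ t in Ioo 0 T, deriv η t • u t
      = ∫ t in (0 : ℝ)..T, (deriv η t * c + deriv η t * ∫ s in (0 : ℝ)..t, g s) := by
    rw [← integral_timeMeasure hT.le]
    refine setIntegral_congr_fun measurableSet_Ioo fun t ht => ?_
    simp only [hu t ht, smul_eq_mul, mul_add]
  have e2 : ∫ t in Ioo 0 T, η t • g t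
      = ∫ t in (0 : ℝ)..T, η t * deriv (fun t => ∫ s in (0 : ℝ)..t, g s) t := by
    simp only [smul_eq_mul]
    rw [integral_timeMeasure hT.le]
    refine intervalIntegral.integral_congr_ae ?_
    filter_upwards [hg.ae_hasDerivAt_integral] with t ht hmem
    rw [(ht (uIoc_subset_uIcc hmem) 0 (by simp)).deriv]
  have hd := continuous_deriv_of_smooth h1
  have hcont : ContinuousOn (fun t => ∫ s in (0 : ℝ)..t, g s) (uIcc 0 T) := by
    rw [uIcc_of_le hT.le]; exact continuousOn_primitive hT.le hg
  have e3 : ∫ t in (0 : ℝ)..T, deriv η t * c = 0 := by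
    rw [intervalIntegral.integral_mul_const, hηac.integral_deriv_eq_sub, h0, hT0]; simp
  rw [e1, e2, hparts, h0, hT0, intervalIntegral.integral_add, e3]
  · simp
  · exact (hd.intervalIntegrable _ _).mul_const _
  · exact (hd.continuousOn.mul hcont).intervalIntegrable

/-- A function with vanishing weak derivative is constant (du Bois-Reymond). -/
theorem ae_eq_const_of_hasWeakTimeDeriv_zero (hT : 0 < T) {z : ℝ → ℝ}
    (hz : Integrable z (timeMeasure T)) (h : HasWeakTimeDeriv T z fun _ => 0) :
    ∃ c, ∀ᵐ t ∂timeMeasure T, z t = c := by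
  -- The constant is the mean of `z` against a fixed test function `ρ` with integral `1`.
  let bump : ContDiffBump (T / 2) := ⟨T / 8, T / 4, by positivity, by linarith⟩
  set ρ : ℝ → ℝ := bump.normed volume with hρ
  have hρs : ContDiff ℝ ∞ ρ := bump.contDiff_normed
  have hρc : HasCompactSupport ρ := bump.hasCompactSupport_normed
  have hρt : tsupport ρ ⊆ Ioo 0 T := by
    rw [hρ, bump.tsupport_normed_eq]
    intro x hx
    have hr : bump.rOut = T / 4 := rfl
    rw [Metric.mem_closedBall, Real.dist_eq, abs_le, hr] at hx
    constructor <;> linarith [hx.1, hx.2]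
  have hρi : ∫ t, ρ t = 1 := bump.integral_normed
  have hρne : (tsupport ρ).Nonempty := by
    rw [hρ, bump.tsupport_normed_eq]
    exact ⟨T / 2, Metric.mem_closedBall_self bump.rOut_pos.le⟩
  refine ⟨∫ t in Ioo 0 T, ρ t • z t, ?_⟩
  set c := ∫ t in Ioo 0 T, ρ t • z t with hc
  have hkey : ∀ᵐ t, t ∈ Ioo 0 T → z t - c = 0 := by
    refine isOpen_Ioo.ae_eq_zero_of_integral_contDiff_smul_eq_zero
      (IntegrableOn.locallyIntegrableOn (hz.sub (integrable_const c)))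
      fun ψ hψ hψc hψt => ?_
    -- The primitive of `ψ - (∫ ψ) ρ` is a test function.
    set m := ∫ t, ψ t with hm
    set θ : ℝ → ℝ := fun t => ψ t - m * ρ t with hθ
    have hθs : ContDiff ℝ ∞ θ := hψ.sub (contDiff_const.mul hρs)
    have hψint : Integrable ψ := hψ.continuous.integrable_of_hasCompactSupport hψc
    have hρint : Integrable ρ := hρs.continuous.integrable_of_hasCompactSupport hρc
    have hθint : Integrable θ := hψint.sub (hρint.const_mul m)
    have hθ0 : ∫ t, θ t = 0 := by
      rw [hθ, integral_sub hψint (hρint.const_mul m), integral_const_mul, hρi]; simp [hm]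
    set η : ℝ → ℝ := fun t => ∫ s in (0 : ℝ)..t, θ s with hη
    have hηd : ∀ t, HasDerivAt η (θ t) t := fun t =>
      (hθs.continuous.integral_hasStrictDerivAt 0 t).hasDerivAt
    have hdη : deriv η = θ := funext fun t => (hηd t).deriv
    have hηs : ContDiff ℝ ∞ η :=
      contDiff_infty_iff_deriv.2 ⟨fun t => (hηd t).differentiableAt, by rw [hdη]; exact hθs⟩
    have hKc : IsCompact (tsupport ψ ∪ tsupport ρ) := hψc.isCompact.union hρc.isCompact
    have hKne : (tsupport ψ ∪ tsupport ρ).Nonempty := hρne.mono subset_union_right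
    have hKT : tsupport ψ ∪ tsupport ρ ⊆ Ioo 0 T := union_subset hψt hρt
    obtain ⟨p, hpK, hp⟩ := hKc.exists_isLeast hKne
    obtain ⟨q, hqK, hq⟩ := hKc.exists_isGreatest hKne
    have hθz : ∀ t, t ∉ Icc p q → θ t = 0 := by
      intro t ht
      have : t ∉ tsupport ψ ∪ tsupport ρ := fun h => ht ⟨hp h, hq h⟩
      rw [mem_union, not_or] at this
      simp [hθ, image_eq_zero_of_notMem_tsupport this.1, image_eq_zero_of_notMem_tsupport this.2]
    have hp0 := (hKT hpK).1
    have hqT := (hKT hqK).2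
    have hηz : ∀ t, t ∉ Icc p q → η t = 0 := by
      intro t ht
      rcases lt_or_ge t p with h1 | h1
      · refine (intervalIntegral.integral_congr (g := fun _ => 0) fun s hs => ?_).trans (by simp)
        refine hθz s fun h => ?_
        rcases le_total 0 t with h2 | h2
        · rw [uIcc_of_le h2] at hs; linarith [h.1, hs.2]
        · rw [uIcc_of_ge h2] at hs; linarith [h.1, hs.2]
      · have h2 : q < t := by by_contra hcon; exact ht ⟨h1, not_lt.1 hcon⟩
        have h3 : 0 ≤ t := by linarith [hp0]
        simp only [hη]
        rw [intervalIntegral.integral_of_le h3, ← hθ0]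
        refine setIntegral_eq_integral_of_forall_compl_eq_zero fun s hs => hθz s fun h => hs ?_
        exact ⟨by linarith [h.1], by linarith [h.2]⟩
    have hηt : tsupport η ⊆ Icc p q :=
      closure_minimal (fun t ht => by_contra fun hcon => ht (hηz t hcon)) isClosed_Icc
    have hηc : HasCompactSupport η := isCompact_Icc.of_isClosed_subset (isClosed_tsupport _) hηt
    have h0 := h η hηs hηc (hηt.trans fun t ht => ⟨hp0.trans_le ht.1, ht.2.trans_lt hqT⟩)
    rw [hdη] at h0
    simp only [smul_zero, integral_zero, neg_zero] at h0
    have e1 : ∫ t, ψ t • (z t - c) = ∫ t in Ioo 0 T, ψ t • (z t - c) := by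
      refine (setIntegral_eq_integral_of_forall_compl_eq_zero fun t ht => ?_).symm
      rw [image_eq_zero_of_notMem_tsupport fun h => ht (hψt h), zero_smul]
    have e2 : ∫ t in Ioo 0 T, ψ t = m := by
      refine setIntegral_eq_integral_of_forall_compl_eq_zero fun t ht => ?_
      rw [image_eq_zero_of_notMem_tsupport fun h => ht (hψt h)]
    have i1 := integrable_test_smul (T := T) hψ.continuous hψc hz
    have i2 := integrable_test_smul (T := T) hρs.continuous hρc hz
    have e3 : ∫ t in Ioo 0 T, θ t • z t
        = (∫ t in Ioo 0 T, ψ t • z t) - m * ∫ t in Ioo 0 T, ρ t • z t := by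
      rw [← integral_const_mul, ← integral_sub i1 (i2.const_mul m)]
      refine integral_congr_ae (Filter.Eventually.of_forall fun t => ?_)
      simp only [hθ, smul_eq_mul]; ring
    rw [e1]
    simp only [smul_sub]
    rw [integral_sub i1 (hψint.integrableOn.smul_const c), integral_smul_const, e2]
    rw [e3] at h0
    simpa [hc] using h0
  rw [← ae_restrict_iff' measurableSet_Ioo] at hkey
  filter_upwards [hkey] with t ht
  linarith

/-- A function with integrable weak derivative is a primitive of it. -/
theorem HasWeakTimeDeriv.ae_eq_primitive (hT : 0 < T) {u w : ℝ → ℝ}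
    (h : HasWeakTimeDeriv T u w) (hu : Integrable u (timeMeasure T))
    (hw : Integrable w (timeMeasure T)) :
    ∃ c, ∀ᵐ t ∂timeMeasure T, u t = c + ∫ s in (0 : ℝ)..t, w s := by
  have hw' := (integrable_timeMeasure_iff hT.le).1 hw
  have hp : HasWeakTimeDeriv T (fun t => ∫ s in (0 : ℝ)..t, w s) w :=
    hasWeakTimeDeriv_primitive hT hw' (c := 0) fun t _ => by simp
  have hpi : Integrable (fun t => ∫ s in (0 : ℝ)..t, w s) (timeMeasure T) :=
    (integrable_timeMeasure_iff hT.le).2 (ContinuousOn.intervalIntegrable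
      (by rw [uIcc_of_le hT.le]; exact continuousOn_primitive hT.le hw'))
  have h0 := h.sub hp hu hw hpi hw
  simp only [sub_self] at h0
  obtain ⟨c, hc⟩ := ae_eq_const_of_hasWeakTimeDeriv_zero hT (hu.sub hpi) h0
  exact ⟨c, hc.mono fun t ht => by simp only [Pi.sub_apply] at ht; linarith⟩

/-- Two functions which agree almost everywhere in `(0, T)` and are continuous on `[0, T]` agree
on `[0, T]`. -/
theorem eqOn_of_ae_eq_of_continuousOn (hT : 0 < T) {u w : ℝ → ℝ} (hu : ContinuousOn u (Icc 0 T))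
    (hw : ContinuousOn w (Icc 0 T)) (h : u =ᵐ[timeMeasure T] w) : EqOn u w (Icc 0 T) := by
  have h1 : EqOn u w (Ioo 0 T) := Measure.eqOn_open_of_ae_eq h isOpen_Ioo
    (hu.mono Ioo_subset_Icc_self) (hw.mono Ioo_subset_Icc_self)
  refine h1.of_subset_closure hu hw Ioo_subset_Icc_self ?_
  rw [closure_Ioo hT.ne]

end Weak

/-! ### Functions of time with values in a Hilbert space, by their modes -/

section Modes

variable {H : Type*} [NormedAddCommGroup H] [InnerProductSpace ℝ H]

theorem enorm_sq_eq_tsum [CompleteSpace H] (φ : HilbertBasis ℕ ℝ H) (q : H) :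
    ‖q‖ₑ ^ 2 = ∑' i, ENNReal.ofReal (inner ℝ q (φ i) ^ 2) := by
  have h := φ.hasSum_inner_mul_inner q q
  have h1 : (fun i => inner ℝ q (φ i) * inner ℝ (φ i) q) = fun i => inner ℝ q (φ i) ^ 2 := by
    ext i; rw [real_inner_comm q (φ i), sq]
  rw [h1, real_inner_self_eq_norm_sq] at h
  rw [← ENNReal.ofReal_tsum_of_nonneg (fun i => sq_nonneg _) h.summable, h.tsum_eq,
    ENNReal.ofReal_pow (norm_nonneg _), ofReal_norm]

theorem eq_of_forall_inner_basis [CompleteSpace H] (φ : HilbertBasis ℕ ℝ H) {x y : H}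
    (h : ∀ i, inner ℝ x (φ i) = inner ℝ y (φ i)) : x = y := by
  rw [← sub_eq_zero, ← enorm_eq_zero, ← pow_eq_zero_iff (n := 2) two_ne_zero, enorm_sq_eq_tsum φ]
  simp [inner_sub_left, h]

/-- Functions `c i` with `∑ᵢ ∫ (c i)² < ∞` are the modes of a square integrable function. -/
theorem exists_of_modes [CompleteSpace H] (φ : HilbertBasis ℕ ℝ H) {μ : Measure ℝ} {c : ℕ → ℝ → ℝ}
    (hc : ∀ i, AEStronglyMeasurable (c i) μ)
    (hs : ∑' i, ∫⁻ t, ENNReal.ofReal (c i t ^ 2) ∂μ ≠ ⊤) :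
    ∃ U : ℝ → H, MemLp U 2 μ ∧ ∀ᵐ t ∂μ, ∀ i, inner ℝ (U t) (φ i) = c i t := by
  classical
  have hcm : ∀ i, AEMeasurable (fun t => ENNReal.ofReal (c i t ^ 2)) μ := fun i =>
    ((hc i).aemeasurable.pow_const 2).ennreal_ofReal
  rw [← lintegral_tsum hcm] at hs
  have hfin := ae_lt_top' (AEMeasurable.tsum hcm) hs
  have hmem : ∀ᵐ t ∂μ, Memℓp (fun i => c i t) 2 := by
    filter_upwards [hfin] with t ht
    rw [memℓp_gen_iff (by norm_num)]
    have h1 : Summable fun i => c i t ^ 2 := by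
      have := ENNReal.summable_toReal ht.ne
      simpa [ENNReal.toReal_ofReal (sq_nonneg _)] using this
    simpa using h1
  set U : ℝ → H := fun t => if h : Memℓp (fun i => c i t) 2 then φ.repr.symm ⟨_, h⟩ else 0 with hU
  have hmodes : ∀ᵐ t ∂μ, ∀ i, inner ℝ (U t) (φ i) = c i t := by
    filter_upwards [hmem] with t ht i
    rw [real_inner_comm, ← φ.repr_apply_apply]
    simp [hU, ht]
  have hmeas : AEStronglyMeasurable U μ := by
    refine aestronglyMeasurable_of_tendsto_ae Filter.atTop
      (f := fun n t => ∑ i ∈ Finset.range n, c i t • φ i) (fun n => ?_) ?_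
    · exact Finset.aestronglyMeasurable_fun_sum _ fun i _ => (hc i).smul_const _
    · filter_upwards [hmodes] with t ht
      have := (φ.hasSum_repr (U t)).tendsto_sum_nat
      refine this.congr fun n => Finset.sum_congr rfl fun i _ => ?_
      rw [φ.repr_apply_apply, real_inner_comm, ht i]
  refine ⟨U, ⟨hmeas, ?_⟩, hmodes⟩
  rw [eLpNorm_lt_top_iff_lintegral_rpow_enorm_lt_top (by norm_num) (by norm_num)]
  refine lt_of_le_of_lt (le_of_eq ?_) (lt_top_iff_ne_top.2 hs)
  refine lintegral_congr_ae ?_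
  filter_upwards [hmodes] with t ht
  have h2 : (2 : ℝ≥0∞).toReal = ((2 : ℕ) : ℝ) := by norm_num
  rw [h2, ENNReal.rpow_natCast, enorm_sq_eq_tsum φ]
  simp only [ht]

variable {T : ℝ}

theorem integrable_of_memLp_two {X : Type*} [NormedAddCommGroup X] {u : ℝ → X}
    (hu : MemLp u 2 (timeMeasure T)) : Integrable u (timeMeasure T) :=
  hu.integrable (by norm_num)

theorem HasWeakTimeDeriv.inner_const [CompleteSpace H] {U W : ℝ → H} (h : HasWeakTimeDeriv T U W)
    (hU : Integrable U (timeMeasure T)) (hW : Integrable W (timeMeasure T)) (x : H) :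
    HasWeakTimeDeriv T (fun t => inner ℝ (U t) x) (fun t => inner ℝ (W t) x) := by
  intro η h1 h2 h3
  have := congrArg (fun y => inner ℝ x y) (h η h1 h2 h3)
  simp only [inner_neg_right] at this
  rw [← integral_inner (integrable_test_smul (continuous_deriv_of_smooth h1) h2.deriv hU),
    ← integral_inner (integrable_test_smul h1.continuous h2 hW)] at this
  simpa only [inner_smul_right, real_inner_comm, smul_eq_mul] using this

theorem hasWeakTimeDeriv_of_modes [CompleteSpace H] (φ : HilbertBasis ℕ ℝ H) {U W : ℝ → H}
    (hU : Integrable U (timeMeasure T)) (hW : Integrable W (timeMeasure T))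
    (h : ∀ i, HasWeakTimeDeriv T (fun t => inner ℝ (U t) (φ i)) (fun t => inner ℝ (W t) (φ i))) :
    HasWeakTimeDeriv T U W := by
  intro η h1 h2 h3
  refine eq_of_forall_inner_basis φ fun i => ?_
  have := h i η h1 h2 h3
  rw [inner_neg_left, real_inner_comm, real_inner_comm (φ i),
    ← integral_inner (integrable_test_smul (continuous_deriv_of_smooth h1) h2.deriv hU),
    ← integral_inner (integrable_test_smul h1.continuous h2 hW)]
  simpa only [inner_smul_right, real_inner_comm, smul_eq_mul] using this

theorem HasWeakTimeDeriv.ae_unique {X : Type*} [NormedAddCommGroup X] [NormedSpace ℝ X]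
    [CompleteSpace X] {u w w' : ℝ → X} (h : HasWeakTimeDeriv T u w) (h' : HasWeakTimeDeriv T u w')
    (hw : Integrable w (timeMeasure T)) (hw' : Integrable w' (timeMeasure T)) :
    w =ᵐ[timeMeasure T] w' := by
  have hkey : ∀ᵐ t, t ∈ Ioo 0 T → w t - w' t = 0 := by
    refine isOpen_Ioo.ae_eq_zero_of_integral_contDiff_smul_eq_zero
      (IntegrableOn.locallyIntegrableOn (hw.sub hw')) fun ψ hψ hψc hψt => ?_
    have e1 : ∫ t, ψ t • (w t - w' t) = ∫ t in Ioo 0 T, ψ t • (w t - w' t) := by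
      refine (setIntegral_eq_integral_of_forall_compl_eq_zero fun t ht => ?_).symm
      rw [image_eq_zero_of_notMem_tsupport fun h => ht (hψt h), zero_smul]
    rw [e1]
    simp only [smul_sub]
    rw [integral_sub (integrable_test_smul hψ.continuous hψc hw)
      (integrable_test_smul hψ.continuous hψc hw'), sub_eq_zero, ← neg_inj,
      ← h ψ hψ hψc hψt, ← h' ψ hψ hψc hψt]
  rw [← ae_restrict_iff' measurableSet_Ioo] at hkey
  filter_upwards [hkey] with t ht
  exact sub_eq_zero.1 ht

theorem IsWeakDerivs.ae_unique {X : Type*} [NormedAddCommGroup X] [NormedSpace ℝ X]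
    [CompleteSpace X] {m : ℕ} {u : ℝ → X} {D E : ℕ → ℝ → X} (hD : IsWeakDerivs T m u D)
    (hE : IsWeakDerivs T m u E) : ∀ j ≤ m, D j =ᵐ[timeMeasure T] E j := by
  intro j
  induction j with
  | zero => exact fun _ => hD.zero.trans hE.zero.symm
  | succ j ih =>
    intro hj
    have h1 := ih (by omega)
    exact (hD.deriv j hj).ae_unique ((hE.deriv j hj).congr h1 .rfl)
      (integrable_of_memLp_two (hD.memLp _ hj)) (integrable_of_memLp_two (hE.memLp _ hj))

/-- The infimum in the definition of a Sobolev norm is over a single value, since weak derivatives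
are unique. -/
theorem sobNorm_eq {X : Type*} [NormedAddCommGroup X] [NormedSpace ℝ X] [CompleteSpace X]
    {m : ℕ} (N : X → ℝ≥0∞) {u : ℝ → X} {D : ℕ → ℝ → X} (hD : IsWeakDerivs T m u D) :
    sobNorm T m N u
      = (∑ j ∈ Finset.range (m + 1), ∫⁻ t in Ioo 0 T, N (D j t) ^ 2) ^ (1 / 2 : ℝ) := by
  refine le_antisymm (iInf₂_le D hD) (le_iInf₂ fun E hE => le_of_eq ?_)
  congr 1
  refine Finset.sum_congr rfl fun j hj => lintegral_congr_ae ?_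
  filter_upwards [hD.ae_unique hE j (by simpa [Nat.lt_succ_iff] using hj)] with t ht
  rw [ht]

theorem exists_of_sobNorm_lt_top {X : Type*} [NormedAddCommGroup X] [NormedSpace ℝ X]
    {m : ℕ} {N : X → ℝ≥0∞} {u : ℝ → X} (h : sobNorm T m N u < ⊤) :
    ∃ D, IsWeakDerivs T m u D := by
  simp only [sobNorm, iInf_lt_iff] at h
  obtain ⟨D, hD, -⟩ := h
  exact ⟨D, hD⟩

theorem isWeakDerivs_zero {X : Type*} [NormedAddCommGroup X] [NormedSpace ℝ X]
    {u : ℝ → X} (hu : MemLp u 2 (timeMeasure T)) : IsWeakDerivs T 0 u fun _ => u :=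
  ⟨.rfl, fun _ _ => hu, fun _ hj => absurd hj (Nat.not_lt_zero _)⟩

end Modes

section Norms

variable {d : ℕ} {Ω : Set (EuclideanSpace ℝ (Fin d))} {T : ℝ}

theorem rpow_half_sq (x : ℝ≥0∞) : (x ^ (1 / 2 : ℝ)) ^ 2 = x := by
  rw [← ENNReal.rpow_natCast, ← ENNReal.rpow_mul]; norm_num

theorem sq_rpow_half (x : ℝ≥0∞) : (x ^ 2) ^ (1 / 2 : ℝ) = x := by
  rw [← ENNReal.rpow_natCast, ← ENNReal.rpow_mul]; norm_num

theorem hNorm_sq (lam : ℕ → ℝ) (φ : HilbertBasis ℕ ℝ (L2 Ω)) (s : ℕ) (q : L2 Ω) :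
    hNorm lam φ s q ^ 2 = ∑' i, ENNReal.ofReal (lam i ^ (2 * s) * inner ℝ q (φ i) ^ 2) :=
  rpow_half_sq _

theorem hNorm_zero_eq (lam : ℕ → ℝ) (φ : HilbertBasis ℕ ℝ (L2 Ω)) (q : L2 Ω) :
    hNorm lam φ 0 q = ‖q‖ₑ := by
  rw [← sq_rpow_half (hNorm lam φ 0 q), hNorm_sq, ← sq_rpow_half ‖q‖ₑ, enorm_sq_eq_tsum φ]
  simp

theorem normHL2_eq (lam : ℕ → ℝ) (φ : HilbertBasis ℕ ℝ (L2 Ω)) (m : ℕ) (u : ℝ → L2 Ω) :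
    normHL2 T m u = normHH lam φ T m 0 u := by
  simp only [normHL2, normHH]
  congr 1
  ext q
  rw [hNorm_zero_eq]

theorem lintegral_sq_eq (hT : 0 ≤ T) {g : ℝ → ℝ} (hg : MemLp g 2 (timeMeasure T)) {r : ℝ}
    (hr : 0 ≤ r) : ∫⁻ t in Ioo 0 T, ENNReal.ofReal (r * g t ^ 2)
      = ENNReal.ofReal (r * ∫ t in (0 : ℝ)..T, g t ^ 2) := by
  rw [← intervalIntegral.integral_const_mul, ← integral_timeMeasure hT,
    ofReal_integral_eq_lintegral_ofReal]
  · exact hg.integrable_sq.const_mul r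
  · exact Filter.Eventually.of_forall fun t => by positivity

theorem lintegral_hNorm_sq (hT : 0 ≤ T) {lam : ℕ → ℝ} (hl : ∀ i, 0 < lam i)
    (φ : HilbertBasis ℕ ℝ (L2 Ω)) (s : ℕ) {U : ℝ → L2 Ω} {c : ℕ → ℝ → ℝ}
    (hc : ∀ i, MemLp (c i) 2 (timeMeasure T))
    (hU : ∀ᵐ t ∂timeMeasure T, ∀ i, inner ℝ (U t) (φ i) = c i t) :
    ∫⁻ t in Ioo 0 T, hNorm lam φ s (U t) ^ 2
      = ∑' i, ENNReal.ofReal (lam i ^ (2 * s) * ∫ t in (0 : ℝ)..T, c i t ^ 2) := by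
  have h1 : ∫⁻ t in Ioo 0 T, hNorm lam φ s (U t) ^ 2
      = ∫⁻ t in Ioo 0 T, ∑' i, ENNReal.ofReal (lam i ^ (2 * s) * c i t ^ 2) := by
    refine lintegral_congr_ae ?_
    filter_upwards [hU] with t ht
    simp only [hNorm_sq, ht]
  rw [h1, lintegral_tsum fun i =>
    (((hc i).1.aemeasurable.pow_const 2).const_mul (lam i ^ (2 * s))).ennreal_ofReal]
  exact tsum_congr fun i => lintegral_sq_eq hT (hc i) (pow_nonneg (hl i).le _)

theorem memLp_modes {U : ℝ → L2 Ω} (hU : MemLp U 2 (timeMeasure T)) (x : L2 Ω) :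
    MemLp (fun t => inner ℝ (U t) x) 2 (timeMeasure T) :=
  hU.inner_const x

/-- A Sobolev norm in time is bounded by bounds of the modes and of their weak derivatives. -/
theorem normHH_le_of_modes (hT : 0 < T) {lam : ℕ → ℝ} {c₀ : ℝ} (hc₀ : 0 < c₀)
    (hl : ∀ i, c₀ ≤ lam i) (φ : HilbertBasis ℕ ℝ (L2 Ω)) (m s : ℕ) {u : ℝ → L2 Ω}
    {c : ℕ → ℕ → ℝ → ℝ} (hu : ∀ᵐ t ∂timeMeasure T, ∀ i, inner ℝ (u t) (φ i) = c 0 i t)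
    (hc : ∀ j ≤ m, ∀ i, MemLp (c j i) 2 (timeMeasure T))
    (hw : ∀ j < m, ∀ i, HasWeakTimeDeriv T (c j i) (c (j + 1) i))
    {R : ℕ → ℝ} {C : ℝ} (hC : 0 ≤ C)
    (hb : ∀ j ≤ m, ∀ i, lam i ^ (2 * s) * ∫ t in (0 : ℝ)..T, c j i t ^ 2 ≤ C * R i)
    (hR : ∑' i, ENNReal.ofReal (R i) ≠ ⊤) :
    normHH lam φ T m s u
      ≤ ENNReal.ofReal (√((m + 1) * C)) * (∑' i, ENNReal.ofReal (R i)) ^ (1 / 2 : ℝ) := by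
  have hl0 : ∀ i, 0 < lam i := fun i => hc₀.trans_le (hl i)
  have hsum : ∀ j ≤ m, ∑' i, ENNReal.ofReal (lam i ^ (2 * s) * ∫ t in (0 : ℝ)..T, c j i t ^ 2)
      ≤ ENNReal.ofReal C * ∑' i, ENNReal.ofReal (R i) := by
    intro j hj
    rw [← ENNReal.tsum_mul_left]
    refine ENNReal.tsum_le_tsum fun i => ?_
    rw [← ENNReal.ofReal_mul hC]
    exact ENNReal.ofReal_le_ofReal (hb j hj i)
  -- The lower bound `c₀` of the frequencies makes the weighted bounds control the `L²` norms.
  have hex : ∀ j ≤ m, ∃ U : ℝ → L2 Ω, MemLp U 2 (timeMeasure T) ∧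
      ∀ᵐ t ∂timeMeasure T, ∀ i, inner ℝ (U t) (φ i) = c j i t := by
    intro j hj
    refine exists_of_modes φ (fun i => (hc j hj i).1) ?_
    have h1 : ∀ i, ∫⁻ t in Ioo 0 T, ENNReal.ofReal (c j i t ^ 2) ≤
        ENNReal.ofReal ((c₀ ^ (2 * s))⁻¹) *
          ENNReal.ofReal (lam i ^ (2 * s) * ∫ t in (0 : ℝ)..T, c j i t ^ 2) := by
      intro i
      have := lintegral_sq_eq hT.le (hc j hj i) zero_le_one
      simp only [one_mul] at this
      rw [this, ← ENNReal.ofReal_mul (by positivity)]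
      refine ENNReal.ofReal_le_ofReal ?_
      have h0 : 0 ≤ ∫ t in (0 : ℝ)..T, c j i t ^ 2 :=
        intervalIntegral.integral_nonneg hT.le fun _ _ => sq_nonneg _
      rw [← mul_assoc]
      refine le_mul_of_one_le_left h0 ?_
      rw [← div_eq_inv_mul, one_le_div (by positivity)]
      exact pow_le_pow_left₀ hc₀.le (hl i) _
    refine ne_top_of_le_ne_top ?_ (ENNReal.tsum_le_tsum h1)
    rw [ENNReal.tsum_mul_left]
    exact ENNReal.mul_ne_top ENNReal.ofReal_ne_top
      (ne_top_of_le_ne_top (ENNReal.mul_ne_top ENNReal.ofReal_ne_top hR) (hsum j hj))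
  choose! D hD hDm using hex
  have hWD : IsWeakDerivs T m u D := by
    refine ⟨?_, hD, fun j hj => ?_⟩
    · filter_upwards [hu, hDm 0 (Nat.zero_le _)] with t h1 h2
      exact eq_of_forall_inner_basis φ fun i => by rw [h1, h2]
    · refine hasWeakTimeDeriv_of_modes φ (integrable_of_memLp_two (hD j hj.le))
        (integrable_of_memLp_two (hD (j + 1) hj)) fun i => (hw j hj i).congr ?_ ?_
      · filter_upwards [hDm j hj.le] with t h using h i
      · filter_upwards [hDm (j + 1) hj] with t h using h i
  rw [normHH, sobNorm_eq _ hWD]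
  have h1 : ∑ j ∈ Finset.range (m + 1), ∫⁻ t in Ioo 0 T, hNorm lam φ s (D j t) ^ 2
      ≤ ENNReal.ofReal ((m + 1) * C) * ∑' i, ENNReal.ofReal (R i) := by
    calc _ ≤ ∑ j ∈ Finset.range (m + 1), ENNReal.ofReal C * ∑' i, ENNReal.ofReal (R i) := by
          refine Finset.sum_le_sum fun j hj => ?_
          have hj' : j ≤ m := by simpa [Nat.lt_succ_iff] using hj
          rw [lintegral_hNorm_sq hT.le hl0 φ s (hc j hj') (hDm j hj')]
          exact hsum j hj'
      _ = _ := by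
          rw [Finset.sum_const, Finset.card_range, nsmul_eq_mul, ← mul_assoc,
            ENNReal.ofReal_mul (by positivity)]
          congr 2
          rw [← Nat.cast_succ, ENNReal.ofReal_natCast]
  refine (ENNReal.rpow_le_rpow h1 (by norm_num)).trans (le_of_eq ?_)
  rw [ENNReal.mul_rpow_of_nonneg _ _ (by norm_num), ENNReal.ofReal_rpow_of_nonneg (by positivity)
    (by norm_num), Real.sqrt_eq_rpow]

/-- The value of the norm of `L²(0, T; Ȟˢ)`. -/
theorem normHH_zero_sq {lam : ℕ → ℝ} (φ : HilbertBasis ℕ ℝ (L2 Ω)) (s : ℕ) {f : ℝ → L2 Ω}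
    (hf : MemLp f 2 (timeMeasure T)) :
    normHH lam φ T 0 s f ^ 2 = ∫⁻ t in Ioo 0 T, hNorm lam φ s (f t) ^ 2 := by
  rw [normHH, sobNorm_eq _ (isWeakDerivs_zero hf), rpow_half_sq]
  simp

theorem lintegral_le_normHH_sq {lam : ℕ → ℝ} (φ : HilbertBasis ℕ ℝ (L2 Ω)) {m s j : ℕ}
    {f : ℝ → L2 Ω} {D : ℕ → ℝ → L2 Ω} (hD : IsWeakDerivs T m f D) (hj : j ≤ m) :
    ∫⁻ t in Ioo 0 T, hNorm lam φ s (D j t) ^ 2 ≤ normHH lam φ T m s f ^ 2 := by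
  rw [normHH, sobNorm_eq _ hD, rpow_half_sq]
  exact Finset.single_le_sum (f := fun j => ∫⁻ t in Ioo 0 T, hNorm lam φ s (D j t) ^ 2)
    (fun _ _ => zero_le) (Finset.mem_range.2 (by omega))

end Norms

/-! ### Regularity of a single mode -/

/-- `u` solves the mode equation `u'' + lam² (u + κ * u) = f`, `u(0) = a`, `u'(0) = b` with
`κ = ∫ k₁`, in integrated form with `v = u'`, and obeys the bound of `exists_mode`. -/
structure IsMode (T M : ℝ) (k₁ : ℝ → ℝ) (lam a b : ℝ) (f u v : ℝ → ℝ) : Prop where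
  cont : ContinuousOn u (Icc 0 T)
  cont' : ContinuousOn v (Icc 0 T)
  eq : ∀ t ∈ Icc 0 T, u t = a + ∫ s in (0 : ℝ)..t, v s
  eq' : ∀ t ∈ Icc 0 T, v t = b + ∫ s in (0 : ℝ)..t,
    (f s - lam ^ 2 * (u s + conv (fun x => ∫ r in (0 : ℝ)..x, k₁ r) u s))
  bound : ∀ t ∈ Icc 0 T,
    lam * |u t| ≤ modeConst T M * (lam * |a| + |b| + ∫ s in (0 : ℝ)..T, |f s|)
  bound' : ∀ t ∈ Icc 0 T,
    |v t| ≤ modeConst T M * (lam * |a| + |b| + ∫ s in (0 : ℝ)..T, |f s|)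

/-- The second time derivative of a mode. -/
noncomputable def modeAcc (k₁ : ℝ → ℝ) (lam : ℝ) (f u : ℝ → ℝ) (t : ℝ) : ℝ :=
  f t - lam ^ 2 * (u t + conv (fun x => ∫ r in (0 : ℝ)..x, k₁ r) u t)

/-- The third time derivative of a mode with velocity `v`, where `f'` is the derivative of `f`. -/
noncomputable def modeJerk (k₁ : ℝ → ℝ) (lam : ℝ) (f' u v : ℝ → ℝ) (t : ℝ) : ℝ :=
  f' t - lam ^ 2 * (v t + conv k₁ u t)

/-- The fourth time derivative of a mode with `u(0) = a`, velocity `v` and acceleration `h`, where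
`f''` is the second derivative of `f`. -/
noncomputable def modeSnap (k₁ : ℝ → ℝ) (lam a : ℝ) (f'' v h : ℝ → ℝ) (t : ℝ) : ℝ :=
  f'' t - lam ^ 2 * (h t + (a * k₁ t + conv k₁ v t))

/-- The hypotheses on the derivative `k₁` of the kernel. -/
structure KernelBound (T M : ℝ) (k₁ : ℝ → ℝ) : Prop where
  nonneg : 0 ≤ M
  int : IntervalIntegrable k₁ volume 0 T
  int_sq : IntervalIntegrable (fun t => k₁ t ^ 2) volume 0 T
  le : ∫ t in (0 : ℝ)..T, |k₁ t| ≤ M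
  le_sq : ∫ t in (0 : ℝ)..T, k₁ t ^ 2 ≤ M

section

variable {T M : ℝ} {k₁ : ℝ → ℝ} {lam a b : ℝ} {f f' f'' u v : ℝ → ℝ}

theorem memLp_of_continuousOn {g : ℝ → ℝ} (hg : ContinuousOn g (Icc 0 T)) :
    MemLp g 2 (timeMeasure T) := by
  obtain ⟨C, hC⟩ := isCompact_Icc.exists_bound_of_continuousOn hg
  refine MemLp.of_bound ((hg.mono Ioo_subset_Icc_self).aestronglyMeasurable measurableSet_Ioo) C ?_
  filter_upwards [ae_restrict_mem measurableSet_Ioo] with t ht using hC t (Ioo_subset_Icc_self ht)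

theorem KernelBound.memLp (hT : 0 < T) (hk : KernelBound T M k₁) :
    MemLp k₁ 2 (timeMeasure T) := by
  rw [memLp_two_iff_integrable_sq]
  · exact (integrable_timeMeasure_iff hT.le).2 hk.int_sq
  · exact ((integrable_timeMeasure_iff hT.le).2 hk.int).1

theorem KernelBound.abs_conv_le (hk : KernelBound T M k₁) {g : ℝ → ℝ} {D t : ℝ}
    (ht : t ∈ Icc 0 T) (hg : ∀ s ∈ Icc 0 T, |g s| ≤ D) : |conv k₁ g t| ≤ M * D := by
  have hD : 0 ≤ D := (abs_nonneg _).trans (hg t ht)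
  have := abs_conv_le_of_exp (γ := 0) le_rfl hD hk.int ht
    (fun s hs => by simpa using hg s ⟨hs.1, hs.2.trans ht.2⟩)
  simp only [zero_mul, Real.exp_zero, mul_one] at this
  exact this.trans (by gcongr; exact hk.le)

theorem KernelBound.abs_primitive_le (hk : KernelBound T M k₁) {t : ℝ} (ht : t ∈ Icc 0 T) :
    |∫ s in (0 : ℝ)..t, k₁ s| ≤ M := by
  have := hk.abs_conv_le (g := fun _ => 1) (D := 1) ht (fun s _ => by simp)
  rwa [conv_comm, conv_one_left, mul_one] at this

theorem intervalIntegrable_primitive (hT : 0 < T) (hk : IntervalIntegrable k₁ volume 0 T) :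
    IntervalIntegrable (fun x => ∫ r in (0 : ℝ)..x, k₁ r) volume 0 T :=
  ContinuousOn.intervalIntegrable
    (by rw [uIcc_of_le hT.le]; exact continuousOn_primitive hT.le hk)

theorem KernelBound.integral_abs_primitive_le (hT : 0 < T) (hk : KernelBound T M k₁) :
    ∫ t in (0 : ℝ)..T, |∫ s in (0 : ℝ)..t, k₁ s| ≤ T * M := by
  have h := intervalIntegral.integral_mono_on hT.le
    (intervalIntegrable_primitive hT hk.int).abs intervalIntegrable_const
    (fun t ht => hk.abs_primitive_le ht)
  simpa using h

theorem memLp_conv (hT : 0 < T) (hk : KernelBound T M k₁) (hu : ContinuousOn u (Icc 0 T)) :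
    MemLp (conv k₁ u) 2 (timeMeasure T) := by
  obtain ⟨C, hC⟩ := isCompact_Icc.exists_bound_of_continuousOn hu
  have hui : IntervalIntegrable u volume 0 T :=
    ContinuousOn.intervalIntegrable (by rwa [uIcc_of_le hT.le])
  refine MemLp.of_bound ((integrable_timeMeasure_iff hT.le).2
    (intervalIntegrable_conv hT.le hk.int hui)).1 (M * C) ?_
  filter_upwards [ae_restrict_mem measurableSet_Ioo] with t ht
  exact hk.abs_conv_le (Ioo_subset_Icc_self ht) hC

theorem continuousOn_conv_of_kernelBound (hT : 0 < T) (hk : KernelBound T M k₁)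
    (hu : ContinuousOn u (Icc 0 T)) :
    ContinuousOn (conv (fun x => ∫ r in (0 : ℝ)..x, k₁ r) u) (Icc 0 T) :=
  continuousOn_conv_primitive hT.le hk.int
    (ContinuousOn.intervalIntegrable (by rwa [uIcc_of_le hT.le]))

theorem memLp_modeAcc (hT : 0 < T) (hk : KernelBound T M k₁) (hu : ContinuousOn u (Icc 0 T))
    (hf : MemLp f 2 (timeMeasure T)) : MemLp (modeAcc k₁ lam f u) 2 (timeMeasure T) :=
  hf.sub ((memLp_of_continuousOn (hu.add (continuousOn_conv_of_kernelBound hT hk hu))).const_mul _)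

theorem memLp_modeJerk (hT : 0 < T) (hk : KernelBound T M k₁) (hu : ContinuousOn u (Icc 0 T))
    (hv : ContinuousOn v (Icc 0 T)) (hf : MemLp f' 2 (timeMeasure T)) :
    MemLp (modeJerk k₁ lam f' u v) 2 (timeMeasure T) :=
  hf.sub (((memLp_of_continuousOn hv).add (memLp_conv hT hk hu)).const_mul _)

theorem memLp_modeSnap (hT : 0 < T) (hk : KernelBound T M k₁) {h : ℝ → ℝ}
    (hv : ContinuousOn v (Icc 0 T)) (hh : MemLp h 2 (timeMeasure T))
    (hf : MemLp f'' 2 (timeMeasure T)) :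
    MemLp (modeSnap k₁ lam a f'' v h) 2 (timeMeasure T) :=
  hf.sub ((hh.add (((hk.memLp hT).const_mul a).add (memLp_conv hT hk hv))).const_mul _)

theorem HasWeakTimeDeriv.add {u u' w w' : ℝ → ℝ} (h : HasWeakTimeDeriv T u w)
    (h' : HasWeakTimeDeriv T u' w')
    (hu : Integrable u (timeMeasure T)) (hw : Integrable w (timeMeasure T))
    (hu' : Integrable u' (timeMeasure T)) (hw' : Integrable w' (timeMeasure T)) :
    HasWeakTimeDeriv T (fun t => u t + u' t) (fun t => w t + w' t) := by
  have := h.sub (h'.const_mul (-1)) hu hw (hu'.const_mul _) (hw'.const_mul _)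
  simpa using this

theorem IsMode.weak_u (hT : 0 < T) (h : IsMode T M k₁ lam a b f u v) : HasWeakTimeDeriv T u v :=
  hasWeakTimeDeriv_primitive hT
    (ContinuousOn.intervalIntegrable (by rw [uIcc_of_le hT.le]; exact h.cont'))
    fun t ht => h.eq t (Ioo_subset_Icc_self ht)

theorem IsMode.weak_v (hT : 0 < T) (hk : KernelBound T M k₁) (hf : MemLp f 2 (timeMeasure T))
    (h : IsMode T M k₁ lam a b f u v) : HasWeakTimeDeriv T v (modeAcc k₁ lam f u) :=
  hasWeakTimeDeriv_primitive hT ((integrable_timeMeasure_iff hT.le).1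
    (integrable_of_memLp_two (memLp_modeAcc hT hk h.cont hf)))
    fun t ht => h.eq' t (Ioo_subset_Icc_self ht)

theorem IsMode.weak_acc (hT : 0 < T) (hk : KernelBound T M k₁) (hf : MemLp f 2 (timeMeasure T))
    (hf' : MemLp f' 2 (timeMeasure T)) (hw : HasWeakTimeDeriv T f f')
    (h : IsMode T M k₁ lam a b f u v) :
    HasWeakTimeDeriv T (modeAcc k₁ lam f u) (modeJerk k₁ lam f' u v) := by
  have hui : IntervalIntegrable u volume 0 T :=
    ContinuousOn.intervalIntegrable (by rw [uIcc_of_le hT.le]; exact h.cont)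
  have hc : HasWeakTimeDeriv T (conv (fun x => ∫ r in (0 : ℝ)..x, k₁ r) u) (conv k₁ u) :=
    hasWeakTimeDeriv_primitive hT (intervalIntegrable_conv hT.le hk.int hui) (c := 0)
      fun t ht => by rw [integral_conv hk.int hui (Ioo_subset_Icc_self ht), zero_add]
  have i1 := integrable_of_memLp_two (memLp_of_continuousOn h.cont)
  have i2 := integrable_of_memLp_two (memLp_of_continuousOn h.cont')
  have i3 := integrable_of_memLp_two
    (memLp_of_continuousOn (continuousOn_conv_of_kernelBound hT hk h.cont))
  have i4 := integrable_of_memLp_two (memLp_conv hT hk h.cont)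
  exact hw.sub (((h.weak_u hT).add hc i1 i2 i3 i4).const_mul (lam ^ 2))
    (integrable_of_memLp_two hf) (integrable_of_memLp_two hf') ((i1.add i3).const_mul _)
    ((i2.add i4).const_mul _)

/-- `(k₁ * u)' = u(0) k₁ + k₁ * u'`. -/
theorem IsMode.weak_conv (hT : 0 < T) (hk : KernelBound T M k₁)
    (h : IsMode T M k₁ lam a b f u v) :
    HasWeakTimeDeriv T (conv k₁ u) (fun t => a * k₁ t + conv k₁ v t) := by
  have hvi : IntervalIntegrable v volume 0 T :=
    ContinuousOn.intervalIntegrable (by rw [uIcc_of_le hT.le]; exact h.cont')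
  have hci := intervalIntegrable_conv hT.le hvi hk.int
  have hci' := intervalIntegrable_conv hT.le hk.int hvi
  refine hasWeakTimeDeriv_primitive hT ((hk.int.const_mul a).add hci') (c := 0) fun t ht => ?_
  have ht' := Ioo_subset_Icc_self ht
  have hsub : ∀ {g : ℝ → ℝ}, IntervalIntegrable g volume 0 T → IntervalIntegrable g volume 0 t :=
    fun hg => hg.mono_set (by
      rw [uIcc_of_le ht'.1, uIcc_of_le hT.le]; exact Icc_subset_Icc_right ht'.2)
  rw [zero_add, intervalIntegral.integral_add ((hsub hk.int).const_mul a) (hsub hci'),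
    intervalIntegral.integral_const_mul]
  have e1 : ∫ s in (0 : ℝ)..t, conv k₁ v s = ∫ s in (0 : ℝ)..t, conv v k₁ s :=
    intervalIntegral.integral_congr fun s _ => conv_comm _ _ _
  rw [e1, integral_conv hvi hk.int ht', conv_comm _ k₁, ← conv_one_left, conv_comm _ k₁,
    ← conv_const_mul, ← sub_eq_iff_eq_add',
    ← conv_sub (T := T) hk.int h.cont (by fun_prop) ht']
  refine conv_congr ht' fun s hs => ?_
  rw [h.eq s hs]; ring

theorem IsMode.weak_jerk (hT : 0 < T) (hk : KernelBound T M k₁) (hf : MemLp f 2 (timeMeasure T))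
    (hf' : MemLp f' 2 (timeMeasure T)) (hf'' : MemLp f'' 2 (timeMeasure T))
    (hw : HasWeakTimeDeriv T f' f'') (h : IsMode T M k₁ lam a b f u v) :
    HasWeakTimeDeriv T (modeJerk k₁ lam f' u v)
      (modeSnap k₁ lam a f'' v (modeAcc k₁ lam f u)) := by
  have i1 := integrable_of_memLp_two (memLp_of_continuousOn h.cont')
  have i2 := integrable_of_memLp_two (memLp_modeAcc (lam := lam) hT hk h.cont hf)
  have i3 := integrable_of_memLp_two (memLp_conv hT hk h.cont)
  have i4 : Integrable (fun t => a * k₁ t + conv k₁ v t) (timeMeasure T) :=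
    integrable_of_memLp_two (((hk.memLp hT).const_mul a).add (memLp_conv hT hk h.cont'))
  exact hw.sub (((h.weak_v hT hk hf).add (h.weak_conv hT hk) i1 i2 i3 i4).const_mul (lam ^ 2))
    (integrable_of_memLp_two hf') (integrable_of_memLp_two hf'') ((i1.add i3).const_mul _)
    ((i2.add i4).const_mul _)

/-- The energy of the data of a mode. -/
noncomputable def modeEnergy (T lam a b : ℝ) (f : ℝ → ℝ) : ℝ :=
  lam ^ 2 * a ^ 2 + b ^ 2 + ∫ t in (0 : ℝ)..T, f t ^ 2

theorem integral_sq_nonneg (hT : 0 < T) (g : ℝ → ℝ) : 0 ≤ ∫ t in (0 : ℝ)..T, g t ^ 2 :=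
  intervalIntegral.integral_nonneg hT.le fun _ _ => sq_nonneg _

theorem modeEnergy_nonneg (hT : 0 < T) (lam a b : ℝ) (f : ℝ → ℝ) :
    0 ≤ modeEnergy T lam a b f := by
  have := integral_sq_nonneg hT f
  unfold modeEnergy; positivity

theorem intervalIntegrable_sq (hT : 0 < T) {g : ℝ → ℝ} (hg : MemLp g 2 (timeMeasure T)) :
    IntervalIntegrable (fun t => g t ^ 2) volume 0 T :=
  (integrable_timeMeasure_iff hT.le).1 hg.integrable_sq

/-- The Cauchy–Schwarz inequality on `(0, T)`, from the expansion of `0 ≤ ∫ (T |f| - ∫ |f|)²`. -/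
theorem sq_integral_abs_le (hT : 0 < T) (hf : MemLp f 2 (timeMeasure T)) :
    (∫ t in (0 : ℝ)..T, |f t|) ^ 2 ≤ T * ∫ t in (0 : ℝ)..T, f t ^ 2 := by
  set A := ∫ t in (0 : ℝ)..T, |f t| with hA
  have hi1 : IntervalIntegrable (fun t => |f t|) volume 0 T :=
    ((integrable_timeMeasure_iff hT.le).1 (integrable_of_memLp_two hf)).abs
  have hi2 := intervalIntegrable_sq hT hf
  have h1 : 0 ≤ ∫ t in (0 : ℝ)..T, (T * |f t| - A) ^ 2 := integral_sq_nonneg hT _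
  have h2 : ∫ t in (0 : ℝ)..T, (T * |f t| - A) ^ 2
      = ∫ t in (0 : ℝ)..T, (T ^ 2 * f t ^ 2 - 2 * T * A * |f t| + A ^ 2) :=
    intervalIntegral.integral_congr fun t _ => by
      rw [← sq_abs (f t)]; ring
  rw [h2, intervalIntegral.integral_add ((hi2.const_mul _).sub (hi1.const_mul _))
    intervalIntegrable_const, intervalIntegral.integral_sub (hi2.const_mul _) (hi1.const_mul _),
    intervalIntegral.integral_const_mul, intervalIntegral.integral_const_mul,
    intervalIntegral.integral_const, ← hA] at h1
  simp only [sub_zero, smul_eq_mul] at h1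
  have h3 : 0 ≤ T * (T * (∫ t in (0 : ℝ)..T, f t ^ 2) - A ^ 2) := by linarith
  have := nonneg_of_mul_nonneg_right h3 hT
  linarith

/-- The constant in the energy bound of a mode. -/
noncomputable def energyConst (T M : ℝ) : ℝ := modeConst T M ^ 2 * (3 * (1 + T))

theorem energyConst_nonneg (hT : 0 < T) : 0 ≤ energyConst T M := by
  unfold energyConst; positivity

theorem sq_data_le (hT : 0 < T) (hf : MemLp f 2 (timeMeasure T)) :
    (modeConst T M * (lam * |a| + |b| + ∫ s in (0 : ℝ)..T, |f s|)) ^ 2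
      ≤ energyConst T M * modeEnergy T lam a b f := by
  have h1 := sq_integral_abs_le hT hf
  have h2 := integral_sq_nonneg hT f
  set F := ∫ s in (0 : ℝ)..T, |f s|
  set F2 := ∫ s in (0 : ℝ)..T, f s ^ 2
  have h3 : (lam * |a| + |b| + F) ^ 2 ≤ 3 * (lam ^ 2 * a ^ 2 + b ^ 2 + F ^ 2) := by
    rw [← sq_abs a, ← sq_abs b]
    nlinarith [sq_nonneg (lam * |a| - |b|), sq_nonneg (lam * |a| - F), sq_nonneg (|b| - F)]
  rw [mul_pow, energyConst, modeEnergy, mul_assoc]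
  refine mul_le_mul_of_nonneg_left ?_ (sq_nonneg _)
  have h4 : 0 ≤ lam ^ 2 * a ^ 2 + b ^ 2 := by positivity
  nlinarith [mul_nonneg hT.le h4]

theorem integral_sq_le_of_bound (hT : 0 < T) {g : ℝ → ℝ} {D : ℝ}
    (hg : MemLp g 2 (timeMeasure T)) (hD : ∀ t ∈ Icc 0 T, g t ^ 2 ≤ D) :
    ∫ t in (0 : ℝ)..T, g t ^ 2 ≤ T * D := by
  have := intervalIntegral.integral_mono_on hT.le (intervalIntegrable_sq hT hg)
    intervalIntegrable_const hD
  simpa using this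

/-- The mean square of `p - q`, for `p` square integrable and `q² ≤ D`. -/
theorem integral_sq_sub_le (hT : 0 < T) {p q : ℝ → ℝ} {D : ℝ} (hp : MemLp p 2 (timeMeasure T))
    (hq : MemLp q 2 (timeMeasure T)) (hD : ∀ t ∈ Icc 0 T, q t ^ 2 ≤ D) :
    ∫ t in (0 : ℝ)..T, (p t - q t) ^ 2 ≤ 2 * (∫ t in (0 : ℝ)..T, p t ^ 2) + 2 * (T * D) := by
  have h1 : ∫ t in (0 : ℝ)..T, (p t - q t) ^ 2
      ≤ ∫ t in (0 : ℝ)..T, (2 * p t ^ 2 + 2 * q t ^ 2) :=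
    intervalIntegral.integral_mono_on hT.le (intervalIntegrable_sq hT (hp.sub hq))
      (((intervalIntegrable_sq hT hp).const_mul 2).add ((intervalIntegrable_sq hT hq).const_mul 2))
      fun t _ => by nlinarith [sq_nonneg (p t + q t)]
  rw [intervalIntegral.integral_add ((intervalIntegrable_sq hT hp).const_mul 2)
    ((intervalIntegrable_sq hT hq).const_mul 2), intervalIntegral.integral_const_mul,
    intervalIntegral.integral_const_mul] at h1
  linarith [integral_sq_le_of_bound hT hq hD]

theorem IsMode.le_sqrt (hT : 0 < T) (hf : MemLp f 2 (timeMeasure T))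
    (h : IsMode T M k₁ lam a b f u v) {t : ℝ} (ht : t ∈ Icc 0 T) :
    lam * |u t| ≤ √(energyConst T M * modeEnergy T lam a b f) ∧
      |v t| ≤ √(energyConst T M * modeEnergy T lam a b f) :=
  ⟨(h.bound t ht).trans (Real.le_sqrt_of_sq_le (sq_data_le hT hf)),
    (h.bound' t ht).trans (Real.le_sqrt_of_sq_le (sq_data_le hT hf))⟩

theorem IsMode.integral_sq_conv_le (hT : 0 < T) (hk : KernelBound T M k₁) (hl : 0 < lam)
    (hf : MemLp f 2 (timeMeasure T)) (h : IsMode T M k₁ lam a b f u v) :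
    ∫ t in (0 : ℝ)..T, (lam * conv (fun x => ∫ r in (0 : ℝ)..x, k₁ r) u t) ^ 2
      ≤ T * ((T * M) ^ 2 * energyConst T M) * modeEnergy T lam a b f := by
  have hE0 : 0 ≤ modeEnergy T lam a b f := modeEnergy_nonneg hT _ _ _ _
  have hN0 : 0 ≤ energyConst T M := energyConst_nonneg hT
  set S := √(energyConst T M * modeEnergy T lam a b f) with hS
  have hSsq : S ^ 2 = energyConst T M * modeEnergy T lam a b f := Real.sq_sqrt (by positivity)
  have hS0 : 0 ≤ S := Real.sqrt_nonneg _
  have hu : ∀ t ∈ Icc 0 T, |u t| ≤ S / lam := fun t ht => by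
    rw [le_div_iff₀ hl, mul_comm]; exact (h.le_sqrt hT hf ht).1
  have := integral_sq_le_of_bound hT (D := (T * M * S) ^ 2)
    ((memLp_of_continuousOn (continuousOn_conv_of_kernelBound hT hk h.cont)).const_mul lam)
    (fun t ht => by
      have := abs_conv_le_of_exp (γ := 0) (D := S / lam) (g := u) le_rfl (by positivity)
        (intervalIntegrable_primitive hT hk.int) ht
        (fun s hs => by simpa using hu s ⟨hs.1, hs.2.trans ht.2⟩)
      simp only [zero_mul, Real.exp_zero, mul_one] at this
      rw [← sq_abs (lam * _), abs_mul, abs_of_pos hl]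
      have h2 := hk.integral_abs_primitive_le hT
      have hM := hk.nonneg
      refine pow_le_pow_left₀ (by positivity) ?_ 2
      calc _ ≤ lam * (T * M * (S / lam)) := by
            gcongr; exact this.trans (by gcongr)
        _ = _ := by field_simp)
  refine this.trans (le_of_eq ?_)
  rw [mul_pow _ S, hSsq]; ring

theorem sq_sub_add_add_le (x y z w : ℝ) :
    (x - (y + (z + w))) ^ 2 ≤ 4 * (x ^ 2 + y ^ 2 + z ^ 2 + w ^ 2) := by
  nlinarith [sq_nonneg (x + y), sq_nonneg (x + z), sq_nonneg (x + w), sq_nonneg (y - z),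
    sq_nonneg (y - w), sq_nonneg (z - w)]

set_option maxHeartbeats 1000000 in
/-- Bounds of the time derivatives of a mode in terms of the energy of its data. The energy bound
of `u` and `v`, uniform in the frequency, gives the bounds of the higher derivatives through the
equation. -/
theorem exists_mode_bounds (hT : 0 < T) (hM : 0 ≤ M) {c₀ : ℝ} (hc₀ : 0 < c₀) :
    ∃ C, 0 ≤ C ∧ ∀ (k₁ : ℝ → ℝ) (lam a b : ℝ) (f f' f'' u v : ℝ → ℝ), KernelBound T M k₁ →
      c₀ ≤ lam → MemLp f 2 (timeMeasure T) → IsMode T M k₁ lam a b f u v →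
      lam ^ 2 * (∫ t in (0 : ℝ)..T, u t ^ 2) ≤ C * modeEnergy T lam a b f ∧
      ∫ t in (0 : ℝ)..T, v t ^ 2 ≤ C * modeEnergy T lam a b f ∧
      ∫ t in (0 : ℝ)..T, modeAcc k₁ lam f u t ^ 2 ≤ C * (lam ^ 2 * modeEnergy T lam a b f) ∧
      (MemLp f' 2 (timeMeasure T) → ∫ t in (0 : ℝ)..T, modeJerk k₁ lam f' u v t ^ 2
        ≤ C * (lam ^ 4 * modeEnergy T lam a b f + ∫ t in (0 : ℝ)..T, f' t ^ 2)) ∧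
      (MemLp f'' 2 (timeMeasure T) →
        ∫ t in (0 : ℝ)..T, modeSnap k₁ lam a f'' v (modeAcc k₁ lam f u) t ^ 2
        ≤ C * (lam ^ 6 * modeEnergy T lam a b f + ∫ t in (0 : ℝ)..T, f'' t ^ 2)) := by
  set N := energyConst T M with hN
  have hN0 : 0 ≤ N := energyConst_nonneg hT
  -- `C₁` belongs to the bounds of `u` and `v`, and `C₂`, `C₃`, `C₄` to those of the derivatives of
  -- order two, three and four.
  set C₁ := T * N with hC₁
  set C₂ := 2 / c₀ ^ 2 + 2 * (T * ((1 + T * M) ^ 2 * N)) with hC₂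
  set C₃ := 2 + 2 * (T * ((1 + M / c₀) ^ 2 * N)) with hC₃
  set C₄ := 4 + 4 * C₂ + (4 * M / c₀ ^ 4 + 4 * (T * (M ^ 2 * N)) / c₀ ^ 2) with hC₄
  have h1 : 0 ≤ C₁ := by positivity
  have h2 : 0 ≤ C₂ := by positivity
  have h3 : 0 ≤ C₃ := by positivity
  have h4 : 0 ≤ C₄ := by positivity
  refine ⟨C₁ + C₂ + C₃ + C₄, by positivity, fun k₁ lam a b f f' f'' u v hk hl hf h => ?_⟩
  have hl0 : 0 < lam := hc₀.trans_le hl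
  set E := modeEnergy T lam a b f with hE
  have hE0 : 0 ≤ E := modeEnergy_nonneg hT _ _ _ _
  set S := √(N * E) with hS
  have hSsq : S ^ 2 = N * E := Real.sq_sqrt (by positivity)
  have hS0 : 0 ≤ S := Real.sqrt_nonneg _
  have hdata : modeConst T M * (lam * |a| + |b| + ∫ s in (0 : ℝ)..T, |f s|) ≤ S :=
    Real.le_sqrt_of_sq_le (sq_data_le hT hf)
  have hu : ∀ t ∈ Icc 0 T, |u t| ≤ S / lam := fun t ht => by
    rw [le_div_iff₀ hl0, mul_comm]; exact (h.bound t ht).trans hdata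
  have hv : ∀ t ∈ Icc 0 T, |v t| ≤ S := fun t ht => (h.bound' t ht).trans hdata
  have hinv : S / lam ≤ S / c₀ := by gcongr
  have hIf : ∫ t in (0 : ℝ)..T, f t ^ 2 ≤ E := by
    have : 0 ≤ lam ^ 2 * a ^ 2 + b ^ 2 := by positivity
    rw [hE, modeEnergy]; linarith
  have hq : 1 ≤ lam ^ 2 / c₀ ^ 2 := by
    rw [one_le_div (by positivity)]; gcongr
  have sq_le : ∀ {x y : ℝ}, |x| ≤ y → x ^ 2 ≤ y ^ 2 := fun {x y} hxy => by
    rw [← sq_abs]; gcongr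
  have bu : lam ^ 2 * (∫ t in (0 : ℝ)..T, u t ^ 2) ≤ C₁ * E := by
    have := integral_sq_le_of_bound hT (memLp_of_continuousOn h.cont) fun t ht => sq_le (hu t ht)
    calc _ ≤ lam ^ 2 * (T * (S / lam) ^ 2) := by gcongr
      _ = T * S ^ 2 := by field_simp
      _ = _ := by rw [hSsq]; ring
  have bv : ∫ t in (0 : ℝ)..T, v t ^ 2 ≤ C₁ * E := by
    have := integral_sq_le_of_bound hT (memLp_of_continuousOn h.cont') fun t ht => sq_le (hv t ht)
    rw [hSsq] at this; linarith
  have hκ : ∀ t ∈ Icc 0 T, |conv (fun x => ∫ r in (0 : ℝ)..x, k₁ r) u t| ≤ T * M * (S / lam) := by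
    intro t ht
    have := abs_conv_le_of_exp (γ := 0) (D := S / lam) (g := u) le_rfl (by positivity)
      (intervalIntegrable_primitive hT hk.int) ht
      (fun s hs => by simpa using hu s ⟨hs.1, hs.2.trans ht.2⟩)
    simp only [zero_mul, Real.exp_zero, mul_one] at this
    refine this.trans ?_
    gcongr
    exact hk.integral_abs_primitive_le hT
  have bh : ∫ t in (0 : ℝ)..T, modeAcc k₁ lam f u t ^ 2 ≤ C₂ * (lam ^ 2 * E) := by
    have := integral_sq_sub_le hT hf (q := fun t => lam ^ 2 *
      (u t + conv (fun x => ∫ r in (0 : ℝ)..x, k₁ r) u t)) (D := (lam * ((1 + T * M) * S)) ^ 2)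
      ((memLp_of_continuousOn (h.cont.add
        (continuousOn_conv_of_kernelBound hT hk h.cont))).const_mul _) (by
        intro t ht
        refine sq_le ?_
        rw [abs_mul, abs_of_pos (pow_pos hl0 2)]
        calc _ ≤ lam ^ 2 * (S / lam + T * M * (S / lam)) := by
              gcongr; exact (abs_add_le _ _).trans (add_le_add (hu t ht) (hκ t ht))
          _ = _ := by field_simp)
    calc _ ≤ _ := this
      _ ≤ 2 * (lam ^ 2 / c₀ ^ 2 * E) + 2 * (T * (lam * ((1 + T * M) * S)) ^ 2) := by
          gcongr
          exact hIf.trans (le_mul_of_one_le_left hE0 hq)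
      _ = _ := by rw [mul_pow, mul_pow _ S, hSsq]; rw [hC₂]; ring
  have hku : ∀ t ∈ Icc 0 T, |conv k₁ u t| ≤ M * (S / c₀) := fun t ht =>
    (hk.abs_conv_le ht hu).trans (by gcongr)
  have bj : MemLp f' 2 (timeMeasure T) → ∫ t in (0 : ℝ)..T, modeJerk k₁ lam f' u v t ^ 2
        ≤ C₃ * (lam ^ 4 * E + ∫ t in (0 : ℝ)..T, f' t ^ 2) := by
    intro hf'
    have := integral_sq_sub_le hT hf' (q := fun t => lam ^ 2 * (v t + conv k₁ u t))
      (D := (lam ^ 2 * ((1 + M / c₀) * S)) ^ 2)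
      (((memLp_of_continuousOn h.cont').add (memLp_conv hT hk h.cont)).const_mul _) (by
        intro t ht
        refine sq_le ?_
        rw [abs_mul, abs_of_pos (pow_pos hl0 2)]
        calc _ ≤ lam ^ 2 * (S + M * (S / c₀)) := by
              gcongr; exact (abs_add_le _ _).trans (add_le_add (hv t ht) (hku t ht))
          _ = _ := by field_simp)
    have hI := integral_sq_nonneg hT f'
    calc _ ≤ _ := this
      _ = 2 * (∫ t in (0 : ℝ)..T, f' t ^ 2)
          + 2 * (T * ((1 + M / c₀) ^ 2 * N)) * (lam ^ 4 * E) := by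
          rw [mul_pow, mul_pow _ S, hSsq]; ring
      _ ≤ C₃ * (∫ t in (0 : ℝ)..T, f' t ^ 2) + C₃ * (lam ^ 4 * E) := by
          have h5 : 2 ≤ C₃ := by rw [hC₃]; simp only [le_add_iff_nonneg_right]; positivity
          have h6 : 2 * (T * ((1 + M / c₀) ^ 2 * N)) ≤ C₃ := by rw [hC₃]; linarith
          gcongr
      _ = _ := by ring
  have bs : MemLp f'' 2 (timeMeasure T) →
      ∫ t in (0 : ℝ)..T, modeSnap k₁ lam a f'' v (modeAcc k₁ lam f u) t ^ 2
        ≤ C₄ * (lam ^ 6 * E + ∫ t in (0 : ℝ)..T, f'' t ^ 2) := by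
    intro hf''
    have hacc := memLp_modeAcc (lam := lam) hT hk h.cont hf
    have i1 := intervalIntegrable_sq hT hf''
    have i2 := intervalIntegrable_sq hT hacc
    have i3 := hk.int_sq
    have hp : ∀ t ∈ Icc 0 T, modeSnap k₁ lam a f'' v (modeAcc k₁ lam f u) t ^ 2
        ≤ 4 * f'' t ^ 2 + 4 * lam ^ 4 * modeAcc k₁ lam f u t ^ 2 + 4 * lam ^ 4 * a ^ 2 * k₁ t ^ 2
          + 4 * lam ^ 4 * (M * S) ^ 2 := by
      intro t ht
      have h5 : conv k₁ v t ^ 2 ≤ (M * S) ^ 2 := sq_le (hk.abs_conv_le ht hv)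
      have h6 := mul_le_mul_of_nonneg_left h5 (by positivity : 0 ≤ lam ^ 4)
      simp only [modeSnap]
      set x := f'' t
      set y := modeAcc k₁ lam f u t
      set z := k₁ t
      set w := conv k₁ v t
      have h7 : (x - lam ^ 2 * (y + (a * z + w))) ^ 2
          ≤ 4 * (x ^ 2 + (lam ^ 2 * y) ^ 2 + (lam ^ 2 * (a * z)) ^ 2 + (lam ^ 2 * w) ^ 2) := by
        rw [mul_add, mul_add]
        exact sq_sub_add_add_le _ _ _ _
      refine h7.trans ?_
      linear_combination 4 * h6
    have := intervalIntegral.integral_mono_on hT.le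
      (intervalIntegrable_sq hT (memLp_modeSnap (lam := lam) (a := a) hT hk h.cont' hacc hf''))
      ((((i1.const_mul 4).add (i2.const_mul (4 * lam ^ 4))).add
        (i3.const_mul (4 * lam ^ 4 * a ^ 2))).add intervalIntegrable_const) hp
    rw [intervalIntegral.integral_add (((i1.const_mul 4).add (i2.const_mul (4 * lam ^ 4))).add
        (i3.const_mul (4 * lam ^ 4 * a ^ 2))) intervalIntegrable_const,
      intervalIntegral.integral_add ((i1.const_mul 4).add (i2.const_mul (4 * lam ^ 4)))
        (i3.const_mul (4 * lam ^ 4 * a ^ 2)),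
      intervalIntegral.integral_add (i1.const_mul 4) (i2.const_mul (4 * lam ^ 4)),
      intervalIntegral.integral_const_mul, intervalIntegral.integral_const_mul,
      intervalIntegral.integral_const_mul, intervalIntegral.integral_const] at this
    simp only [sub_zero, smul_eq_mul] at this
    have hI := integral_sq_nonneg hT f''
    have ha : lam ^ 4 * a ^ 2 ≤ lam ^ 6 * E / c₀ ^ 4 := by
      have h5 : lam ^ 2 * a ^ 2 ≤ E := by
        have := integral_sq_nonneg hT f
        rw [hE, modeEnergy]; nlinarith [sq_nonneg b]
      have h6 : lam ^ 2 ≤ lam ^ 6 / c₀ ^ 4 := by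
        rw [le_div_iff₀ (by positivity)]
        have : c₀ ^ 4 ≤ lam ^ 4 := by gcongr
        calc lam ^ 2 * c₀ ^ 4 ≤ lam ^ 2 * lam ^ 4 := by gcongr
          _ = _ := by ring
      calc lam ^ 4 * a ^ 2 = lam ^ 2 * (lam ^ 2 * a ^ 2) := by ring
        _ ≤ lam ^ 6 / c₀ ^ 4 * E := by gcongr
        _ = _ := by ring
    have h46 : lam ^ 4 * E ≤ lam ^ 6 * E / c₀ ^ 2 := by
      calc lam ^ 4 * E ≤ lam ^ 2 / c₀ ^ 2 * (lam ^ 4 * E) :=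
            le_mul_of_one_le_left (by positivity) hq
        _ = _ := by ring
    calc _ ≤ _ := this
      _ ≤ 4 * (∫ t in (0 : ℝ)..T, f'' t ^ 2) + 4 * lam ^ 4 * (C₂ * (lam ^ 2 * E))
          + 4 * (lam ^ 6 * E / c₀ ^ 4) * M + T * (4 * (M ^ 2 * N) * (lam ^ 6 * E / c₀ ^ 2)) := by
          refine add_le_add (add_le_add (add_le_add le_rfl ?_) ?_) ?_
          · gcongr
          · rw [mul_assoc 4 (lam ^ 4)]
            have := hk.le_sq
            have := integral_sq_nonneg hT k₁
            gcongr
          · rw [mul_pow, hSsq]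
            calc T * (4 * lam ^ 4 * (M ^ 2 * (N * E))) = T * (4 * (M ^ 2 * N) * (lam ^ 4 * E)) := by
                  ring
              _ ≤ _ := by gcongr
      _ = 4 * (∫ t in (0 : ℝ)..T, f'' t ^ 2) + (4 * C₂ + (4 * M / c₀ ^ 4
          + 4 * (T * (M ^ 2 * N)) / c₀ ^ 2)) * (lam ^ 6 * E) := by ring
      _ ≤ C₄ * (∫ t in (0 : ℝ)..T, f'' t ^ 2) + C₄ * (lam ^ 6 * E) := by
          have h5 : 4 ≤ C₄ := by
            rw [hC₄, add_assoc]; simp only [le_add_iff_nonneg_right]; positivity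
          have h6 : 4 * C₂ + (4 * M / c₀ ^ 4 + 4 * (T * (M ^ 2 * N)) / c₀ ^ 2) ≤ C₄ := by
            rw [hC₄]; linarith
          gcongr
      _ = _ := by ring
  refine ⟨bu.trans ?_, bv.trans ?_, bh.trans ?_, fun hf' => (bj hf').trans ?_,
    fun hf'' => (bs hf'').trans ?_⟩
  · gcongr; linarith
  · gcongr; linarith
  · gcongr; linarith
  · have := integral_sq_nonneg hT f'
    gcongr; linarith
  · have := integral_sq_nonneg hT f''
    gcongr; linarith

end

/-! ### Solutions and their modes -/

section

variable {d : ℕ} {Ω : Set (EuclideanSpace ℝ (Fin d))}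

/-- The pairs `(ψ, ∇ψ)` with `ψ ∈ C_c^∞(Ω)` form a subspace. -/
def testSubmodule (Ω : Set (EuclideanSpace ℝ (Fin d))) : Submodule ℝ (L2 Ω × L2Vec Ω) where
  carrier := testGraph Ω
  zero_mem' := by
    refine ⟨fun _ => 0, contDiff_const, HasCompactSupport.zero, by simp [tsupport], ?_, ?_⟩
    · exact Lp.coeFn_zero _ _ _
    · refine (Lp.coeFn_zero _ _ _).trans (Filter.Eventually.of_forall fun x => ?_)
      simp [gradient]
  add_mem' := by
    rintro p q ⟨ψ, h1, h2, h3, h4, h5⟩ ⟨χ, g1, g2, g3, g4, g5⟩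
    refine ⟨fun x => ψ x + χ x, h1.add g1, h2.add g2, ?_, ?_, ?_⟩
    · exact (tsupport_add ψ χ).trans (union_subset h3 g3)
    · filter_upwards [h4, g4, Lp.coeFn_add p.1 q.1] with x e1 e2 e3
      rw [Prod.fst_add, e3, Pi.add_apply, e1, e2]
    · filter_upwards [h5, g5, Lp.coeFn_add p.2 q.2] with x e1 e2 e3
      rw [Prod.snd_add, e3, Pi.add_apply, e1, e2, gradient, gradient, gradient,
        fderiv_fun_add (h1.differentiable (by simp) x) (g1.differentiable (by simp) x), map_add]
  smul_mem' := by
    rintro c p ⟨ψ, h1, h2, h3, h4, h5⟩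
    refine ⟨fun x => c * ψ x, contDiff_const.mul h1, h2.mul_left, ?_, ?_, ?_⟩
    · exact (closure_mono (Function.support_mul_subset_right _ _)).trans h3
    · filter_upwards [h4, Lp.coeFn_smul c p.1] with x e1 e3
      rw [Prod.smul_fst, e3, Pi.smul_apply, e1, smul_eq_mul]
    · filter_upwards [h5, Lp.coeFn_smul c p.2] with x e1 e3
      rw [Prod.smul_snd, e3, Pi.smul_apply, e1, gradient, gradient,
        fderiv_const_mul (h1.differentiable (by simp) x), map_smul]

/-- The graph of the gradient on `H¹₀(Ω)` as a closed subspace. -/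
noncomputable def h10Submodule (Ω : Set (EuclideanSpace ℝ (Fin d))) :
    Submodule ℝ (L2 Ω × L2Vec Ω) :=
  (testSubmodule Ω).topologicalClosure

theorem mem_h10Submodule {p : L2 Ω × L2Vec Ω} : p ∈ h10Submodule Ω ↔ p ∈ h10Graph Ω :=
  Iff.rfl

theorem isClosed_h10Graph : IsClosed (h10Graph Ω) := isClosed_closure

/-- If `U = ∑ lamᵢ uᵢ φᵢ` then the gradient of `∑ uᵢ φᵢ` is `A U`, where `A` is the bounded operator
with `A φᵢ = lamᵢ⁻¹ ∇φᵢ`. -/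
theorem exists_gradient_operator {K : ℝ} (hK : 0 < K) {lam : ℕ → ℝ} {φ : HilbertBasis ℕ ℝ (L2 Ω)}
    (h : IsDirichletEigenbasis Ω K lam φ) :
    ∃ A : L2 Ω →L[ℝ] L2Vec Ω,
      (∀ u U : L2 Ω, (∀ i, inner ℝ U (φ i) = lam i * inner ℝ u (φ i)) → (u, A U) ∈ h10Graph Ω) ∧
      ∀ p ∈ h10Graph Ω, ∃ y : L2 Ω, (∀ U, K * inner ℝ (A U) p.2 = inner ℝ U y) ∧
        ∀ i, inner ℝ y (φ i) = lam i * inner ℝ p.1 (φ i) := by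
  choose G hG hGe using h.eigen
  have hl := h.pos
  -- By the eigenvalue equation, the gradients `G i` of the `φ i` are orthogonal, with norm
  -- `lam i / √K`.
  have horth : Orthonormal ℝ fun i => (√K / lam i) • G i := by
    rw [orthonormal_iff_ite]
    intro i j
    have h1 := hGe i _ (hG j)
    have h2 : inner ℝ (φ i) (φ j) = if i = j then (1 : ℝ) else 0 :=
      orthonormal_iff_ite.1 φ.orthonormal i j
    simp only [h2] at h1
    have hij : inner ℝ (G i) (G j) = lam i ^ 2 * (if i = j then 1 else 0) / K := by
      rw [← h1]; field_simp
    rw [inner_smul_left, inner_smul_right, hij]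
    simp only [conj_trivial]
    split_ifs with he
    · subst he
      have := (hl i).ne'
      field_simp
      rw [Real.sq_sqrt hK.le]
    · simp
  -- the isometry which maps `φ i` to `(√K / lam i) • G i`, divided by `√K`
  set J := horth.orthogonalFamily.linearIsometry with hJ
  have hsqK : √K ≠ 0 := (Real.sqrt_pos.2 hK).ne'
  set A : L2 Ω →L[ℝ] L2Vec Ω :=
    (√K)⁻¹ • (J.toContinuousLinearMap.comp (φ.repr.toContinuousLinearEquiv : L2 Ω →L[ℝ] _)) with hA
  have hAsum : ∀ U, HasSum (fun i => ((lam i)⁻¹ * inner ℝ U (φ i)) • G i) (A U) := by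
    intro U
    have h1 := (horth.orthogonalFamily.hasSum_linearIsometry (φ.repr U)).const_smul (√K)⁻¹
    have h2 : A U = (√K)⁻¹ • J (φ.repr U) := rfl
    rw [h2]
    convert! h1 using 1
    ext1 i
    rw [φ.repr_apply_apply, real_inner_comm]
    simp only [LinearIsometry.toSpanSingleton_apply, smul_smul]
    congr 1
    field_simp
  refine ⟨A, fun u U hU => ?_, fun p hp => ?_⟩
  · have h1 : HasSum (fun i => inner ℝ u (φ i) • φ i) u := by
      have := φ.hasSum_repr u
      simpa only [φ.repr_apply_apply, real_inner_comm] using this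
    have h2 : HasSum (fun i => inner ℝ u (φ i) • G i) (A U) := by
      convert! hAsum U using 1
      ext1 i
      rw [hU i, inv_mul_cancel_left₀ (hl i).ne']
    have h3 := h1.prodMk h2
    refine isClosed_h10Graph.mem_of_tendsto h3 (Filter.Eventually.of_forall fun s => ?_)
    exact mem_h10Submodule.1 ((h10Submodule Ω).sum_mem fun i _ =>
      (h10Submodule Ω).smul_mem (inner ℝ u (φ i)) (mem_h10Submodule.2 (hG i)))
  -- `y = K A* ∇w` for `p = (w, ∇w)`; its modes come from the eigenvalue equation tested with `w`.
  · refine ⟨K • ContinuousLinearMap.adjoint A p.2, fun U => ?_, fun i => ?_⟩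
    · rw [inner_smul_right, ContinuousLinearMap.adjoint_inner_right]
    · have hAφ : A (φ i) = (lam i)⁻¹ • G i := by
        refine (hAsum (φ i)).unique ?_
        convert! hasSum_ite_eq i ((lam i)⁻¹ • G i) using 1
        ext1 j
        have h2 : inner ℝ (φ i) (φ j) = if i = j then (1 : ℝ) else 0 :=
          orthonormal_iff_ite.1 φ.orthonormal i j
        rw [h2]
        by_cases hij : j = i
        · subst hij; simp
        · simp [hij, Ne.symm hij]
      rw [inner_smul_left, ContinuousLinearMap.adjoint_inner_left, hAφ, inner_smul_right,
        real_inner_comm, real_inner_comm (φ i) p.1]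
      have := hGe i p hp
      have hne := (hl i).ne'
      simp only [conj_trivial]
      field_simp
      linarith

theorem conv_congr_ae {T t : ℝ} {k g h : ℝ → ℝ} (ht : t ∈ Icc 0 T) (hgh : g =ᵐ[timeMeasure T] h) :
    conv k g t = conv k h t := by
  simp only [conv]
  rw [intervalIntegral.integral_of_le ht.1, intervalIntegral.integral_of_le ht.1,
    integral_Ioc_eq_integral_Ioo, integral_Ioc_eq_integral_Ioo]
  refine integral_congr_ae ?_
  have h1 : g =ᵐ[volume.restrict (Ioo 0 t)] h :=
    ae_mono (Measure.restrict_mono (Ioo_subset_Ioo_right ht.2) le_rfl) hgh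
  filter_upwards [h1] with s hs
  rw [hs]

/-- The modes of a weak solution solve the integrated mode equations. -/
theorem IsSolution.exists_mode {K T M : ℝ} (hT : 0 < T) {lam : ℕ → ℝ}
    {φ : HilbertBasis ℕ ℝ (L2 Ω)} (h : IsDirichletEigenbasis Ω K lam φ) {α k₁ : ℝ → ℝ}
    (hk : KernelBound T M k₁) (hker : ∀ t ∈ Ioo 0 T, kernel α t = ∫ s in (0 : ℝ)..t, k₁ s)
    {f : ℝ → L2 Ω} (hf : MemLp f 2 (timeMeasure T)) {u₀ u₁ : L2 Ω} {z : ℝ → L2 Ω}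
    (hz : IsSolution Ω K T α f u₀ u₁ z) (i : ℕ) :
    ∃ x : ℝ → ℝ, ContinuousOn x (Icc 0 T) ∧
      (fun t => inner ℝ (z t) (φ i)) =ᵐ[timeMeasure T] x ∧
      ∀ t ∈ Icc 0 T, x t = inner ℝ u₀ (φ i) + ∫ s in (0 : ℝ)..t, (inner ℝ u₁ (φ i) +
        ∫ r in (0 : ℝ)..s, (inner ℝ (f r) (φ i)
          - lam i ^ 2 * (x r + conv (fun x => ∫ r in (0 : ℝ)..x, k₁ r) x r))) := by
  obtain ⟨hz2, zt, G, hzt, hzw, hG2, hG, ⟨g, hgc, hgz, hg0⟩, hp⟩ := hz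
  obtain ⟨Gi, hGi, hGe⟩ := h.eigen i
  obtain ⟨hw, y, hyc, hyz, hy0⟩ := hp _ hGi
  simp only at hw hyz hy0
  set x : ℝ → ℝ := fun t => inner ℝ (g t) (φ i) with hx
  have hxc : ContinuousOn x (Icc 0 T) := hgc.inner continuousOn_const
  have hxz : (fun t => inner ℝ (z t) (φ i)) =ᵐ[timeMeasure T] x := by
    filter_upwards [hgz] with t ht
    simp only [hx, ht]
  -- By symmetry, the eigenvalue equation tested with the solution turns `K (∇z, ∇φ)` into `lam² x`.
  have hGx : ∀ᵐ t ∂timeMeasure T, K * inner ℝ (G t) Gi = lam i ^ 2 * x t := by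
    filter_upwards [hG, hxz] with t h1 h2
    have := hGe _ h1
    simp only at this
    rw [real_inner_comm, this, real_inner_comm, h2]
  set F : ℝ → ℝ := fun r => inner ℝ (f r) (φ i)
    - lam i ^ 2 * (x r + conv (fun x => ∫ r in (0 : ℝ)..x, k₁ r) x r) with hF
  have hFm : MemLp F 2 (timeMeasure T) := memLp_modeAcc hT hk hxc (memLp_modes hf (φ i))
  have hwF : HasWeakTimeDeriv T y F := by
    refine hw.congr hyz ?_
    filter_upwards [hGx, ae_restrict_mem measurableSet_Ioo] with t h1 ht
    have ht' := Ioo_subset_Icc_self ht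
    rw [conv_congr_left ht' hker, ← conv_const_mul, conv_congr_ae ht' hGx, h1, conv_const_mul]
    simp only [hF]; ring
  have hyi := integrable_of_memLp_two (memLp_of_continuousOn hyc)
  have hwx : HasWeakTimeDeriv T x y :=
    (hzw.inner_const (integrable_of_memLp_two hz2) (integrable_of_memLp_two hzt) (φ i)).congr
      hxz.symm hyz
  have hprim : ∀ {p q : ℝ → ℝ}, ContinuousOn p (Icc 0 T) → Integrable q (timeMeasure T) →
      HasWeakTimeDeriv T p q → ∀ t ∈ Icc 0 T, p t = p 0 + ∫ s in (0 : ℝ)..t, q s := by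
    intro p q hpc hq hpq
    obtain ⟨c, hc⟩ := hpq.ae_eq_primitive hT
      (integrable_of_memLp_two (memLp_of_continuousOn hpc)) hq
    have heq := eqOn_of_ae_eq_of_continuousOn hT hpc
      (continuousOn_const.add (continuousOn_primitive hT.le
        ((integrable_timeMeasure_iff hT.le).1 hq))) hc
    have h0 : p 0 = c := by simpa using heq ⟨le_rfl, hT.le⟩
    intro t ht
    rw [h0]; exact heq ht
  have e1 := hprim hxc hyi hwx
  have e2 := hprim hyc (integrable_of_memLp_two hFm) hwF
  refine ⟨x, hxc, hxz, fun t ht => ?_⟩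
  rw [e1 t ht]
  have hx0 : x 0 = inner ℝ u₀ (φ i) := by simp only [hx, hg0]
  rw [hx0]
  congr 1
  refine intervalIntegral.integral_congr fun s hs => ?_
  rw [uIcc_of_le ht.1] at hs
  rw [e2 s ⟨hs.1, hs.2.trans ht.2⟩, hy0]

/-- Two weak solutions with the same data agree: the modes of their difference solve the homogeneous
mode equation. -/
theorem IsSolution.ae_unique {K T M : ℝ} (hT : 0 < T) {lam : ℕ → ℝ}
    {φ : HilbertBasis ℕ ℝ (L2 Ω)} (h : IsDirichletEigenbasis Ω K lam φ) {α k₁ : ℝ → ℝ}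
    (hk : KernelBound T M k₁) (hker : ∀ t ∈ Ioo 0 T, kernel α t = ∫ s in (0 : ℝ)..t, k₁ s)
    {f : ℝ → L2 Ω} (hf : MemLp f 2 (timeMeasure T)) {u₀ u₁ : L2 Ω} {z z' : ℝ → L2 Ω}
    (hz : IsSolution Ω K T α f u₀ u₁ z) (hz' : IsSolution Ω K T α f u₀ u₁ z') :
    z =ᵐ[timeMeasure T] z' := by
  have key : ∀ i, ∀ᵐ t ∂timeMeasure T, inner ℝ (z t) (φ i) = inner ℝ (z' t) (φ i) := by
    intro i
    obtain ⟨x, hxc, hxz, hx⟩ := hz.exists_mode hT h hk hker hf i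
    obtain ⟨x', hxc', hxz', hx'⟩ := hz'.exists_mode hT h hk hker hf i
    have hκ := intervalIntegrable_primitive hT hk.int
    have hfi := memLp_modes hf (φ i)
    have hI : ∀ {x : ℝ → ℝ}, ContinuousOn x (Icc 0 T) → IntervalIntegrable (fun r =>
        inner ℝ (f r) (φ i) - lam i ^ 2 * (x r + conv (fun x => ∫ r in (0 : ℝ)..x, k₁ r) x r))
        volume 0 T := fun hxc => (integrable_timeMeasure_iff hT.le).1
          (integrable_of_memLp_two (memLp_modeAcc hT hk hxc hfi))
    have hsub : ∀ {g : ℝ → ℝ} {t : ℝ}, t ∈ Icc 0 T → IntervalIntegrable g volume 0 T →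
        IntervalIntegrable g volume 0 t := fun ht hg => hg.mono_set (by
          rw [uIcc_of_le ht.1, uIcc_of_le hT.le]; exact Icc_subset_Icc_right ht.2)
    have hI2 : ∀ {x : ℝ → ℝ}, ContinuousOn x (Icc 0 T) → IntervalIntegrable (fun s =>
        inner ℝ u₁ (φ i) + ∫ r in (0 : ℝ)..s, (inner ℝ (f r) (φ i)
          - lam i ^ 2 * (x r + conv (fun x => ∫ r in (0 : ℝ)..x, k₁ r) x r))) volume 0 T :=
      fun hxc => ContinuousOn.intervalIntegrable (by
        rw [uIcc_of_le hT.le]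
        exact continuousOn_const.add (continuousOn_primitive hT.le (hI hxc)))
    have hzero := mode_unique hT hκ (hk.integral_abs_primitive_le hT) (lam := lam i)
      (δ := fun t => x t - x' t) (hxc.sub hxc') (by
        intro t ht
        rw [hx t ht, hx' t ht, add_sub_add_left_eq_sub,
          ← intervalIntegral.integral_sub (hsub ht (hI2 hxc)) (hsub ht (hI2 hxc')),
          ← intervalIntegral.integral_neg]
        refine intervalIntegral.integral_congr fun s hs => ?_
        rw [uIcc_of_le ht.1] at hs
        have hs' : s ∈ Icc 0 T := ⟨hs.1, hs.2.trans ht.2⟩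
        rw [add_sub_add_left_eq_sub,
          ← intervalIntegral.integral_sub (hsub hs' (hI hxc)) (hsub hs' (hI hxc')),
          ← intervalIntegral.integral_neg]
        refine intervalIntegral.integral_congr fun r hr => ?_
        rw [uIcc_of_le hs.1] at hr
        rw [conv_sub hκ hxc hxc' ⟨hr.1, hr.2.trans hs'.2⟩]
        ring)
    filter_upwards [hxz, hxz', ae_restrict_mem measurableSet_Ioo] with t h1 h2 ht
    rw [h1, h2]
    exact sub_eq_zero.1 (hzero t (Ioo_subset_Icc_self ht))
  filter_upwards [ae_all_iff.2 key] with t ht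
  exact eq_of_forall_inner_basis φ ht

end

/-! ### Existence of the solution -/

section

variable {d : ℕ} {Ω : Set (EuclideanSpace ℝ (Fin d))}

/-- The sum over the modes of the energies of the data with the weights `lam ^ (2 s)`. -/
theorem tsum_modeEnergy {T : ℝ} (hT : 0 < T) {lam : ℕ → ℝ} (hl : ∀ i, 0 < lam i)
    (φ : HilbertBasis ℕ ℝ (L2 Ω)) (s : ℕ) {f : ℝ → L2 Ω} (hf : MemLp f 2 (timeMeasure T))
    (u₀ u₁ : L2 Ω) :
    ∑' i, ENNReal.ofReal (lam i ^ (2 * s) * modeEnergy T (lam i) (inner ℝ u₀ (φ i))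
        (inner ℝ u₁ (φ i)) (fun t => inner ℝ (f t) (φ i)))
      = hNorm lam φ (s + 1) u₀ ^ 2 + hNorm lam φ s u₁ ^ 2 + normHH lam φ T 0 s f ^ 2 := by
  rw [normHH_zero_sq φ s hf, lintegral_hNorm_sq hT.le hl φ s (fun i => memLp_modes hf (φ i))
    (Filter.Eventually.of_forall fun t i => rfl), hNorm_sq, hNorm_sq, ← ENNReal.tsum_add,
    ← ENNReal.tsum_add]
  refine tsum_congr fun i => ?_
  have h1 := integral_sq_nonneg hT fun t => inner ℝ (f t) (φ i)
  have h2 := (hl i).le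
  rw [← ENNReal.ofReal_add (by positivity) (by positivity),
    ← ENNReal.ofReal_add (by positivity) (by positivity)]
  congr 1
  rw [modeEnergy]
  ring

theorem exists_of_modes_le {T : ℝ} (hT : 0 < T) (φ : HilbertBasis ℕ ℝ (L2 Ω)) {c : ℕ → ℝ → ℝ}
    {E : ℕ → ℝ} {C : ℝ} (hC : 0 ≤ C) (hc : ∀ i, MemLp (c i) 2 (timeMeasure T))
    (hb : ∀ i, ∫ t in (0 : ℝ)..T, c i t ^ 2 ≤ C * E i) (hE : ∑' i, ENNReal.ofReal (E i) ≠ ⊤) :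
    ∃ U : ℝ → L2 Ω, MemLp U 2 (timeMeasure T) ∧
      ∀ᵐ t ∂timeMeasure T, ∀ i, inner ℝ (U t) (φ i) = c i t := by
  refine exists_of_modes φ (fun i => (hc i).1) ?_
  have h1 : ∀ i, ∫⁻ t in Ioo 0 T, ENNReal.ofReal (c i t ^ 2)
      ≤ ENNReal.ofReal C * ENNReal.ofReal (E i) := by
    intro i
    have := lintegral_sq_eq hT.le (hc i) zero_le_one
    simp only [one_mul] at this
    rw [this, ← ENNReal.ofReal_mul hC]
    exact ENNReal.ofReal_le_ofReal (hb i)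
  refine ne_top_of_le_ne_top ?_ (ENNReal.tsum_le_tsum h1)
  rw [ENNReal.tsum_mul_left]
  exact ENNReal.mul_ne_top ENNReal.ofReal_ne_top hE

/-- The weak equation tested with `(w, y)`, where `yᵢ = lamᵢ wᵢ`, from the equations of the modes.
All functions are given by their modes: `u' = (Vᵢ)`, `W = (lamᵢ Uᵢ)`, `Z = (lamᵢ (κ * Uᵢ))`. -/
theorem hasWeakTimeDeriv_of_mode_equations {T : ℝ} {lam : ℕ → ℝ} (φ : HilbertBasis ℕ ℝ (L2 Ω))
    {ut f W Z : ℝ → L2 Ω} (hut : Integrable ut (timeMeasure T)) (hf : Integrable f (timeMeasure T))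
    (hW : Integrable W (timeMeasure T)) (hZ : Integrable Z (timeMeasure T))
    (hmode : ∀ i, HasWeakTimeDeriv T (fun t => inner ℝ (ut t) (φ i)) (fun t =>
      inner ℝ (f t) (φ i) - lam i * (inner ℝ (W t) (φ i) + inner ℝ (Z t) (φ i))))
    {w y : L2 Ω} (hy : ∀ i, inner ℝ y (φ i) = lam i * inner ℝ w (φ i)) :
    HasWeakTimeDeriv T (fun t => inner ℝ (ut t) w)
      (fun t => inner ℝ (f t) w - (inner ℝ (W t) y + inner ℝ (Z t) y)) := by
  intro η h1 h2 h3
  have hd := continuous_deriv_of_smooth h1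
  have iut := integrable_test_smul hd h2.deriv hut
  have i_f := integrable_test_smul h1.continuous h2 hf
  have iW := integrable_test_smul h1.continuous h2 hW
  have iZ := integrable_test_smul h1.continuous h2 hZ
  -- The assertion is `⟨X₁, w⟩ = ⟨X₂, y⟩`, which is verified in the basis `φ`.
  set X₁ : L2 Ω := (∫ t in Ioo 0 T, deriv η t • ut t) + ∫ t in Ioo 0 T, η t • f t with hX₁
  set X₂ : L2 Ω := (∫ t in Ioo 0 T, η t • W t) + ∫ t in Ioo 0 T, η t • Z t with hX₂
  have pair : ∀ x : L2 Ω, ∀ {θ : ℝ → ℝ} {g : ℝ → L2 Ω},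
      Integrable (fun t => θ t • g t) (timeMeasure T) →
      inner ℝ (∫ t in Ioo 0 T, θ t • g t) x = ∫ t in Ioo 0 T, θ t * inner ℝ (g t) x := by
    intro x θ g hg
    rw [real_inner_comm, ← integral_inner hg]
    simp only [inner_smul_right, real_inner_comm]
  have pint : ∀ x : L2 Ω, ∀ {θ : ℝ → ℝ} {g : ℝ → L2 Ω},
      Integrable (fun t => θ t • g t) (timeMeasure T) →
      Integrable (fun t => θ t * inner ℝ (g t) x) (timeMeasure T) := by
    intro x θ g hg
    simpa only [inner_smul_left, conj_trivial] using hg.inner_const (𝕜 := ℝ) x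
  have hmodes : ∀ i, inner ℝ X₁ (φ i) = lam i * inner ℝ X₂ (φ i) := by
    intro i
    have hm := hmode i η h1 h2 h3
    simp only [smul_eq_mul] at hm
    rw [hX₁, hX₂, inner_add_left, inner_add_left, pair _ iut, pair _ i_f, pair _ iW, pair _ iZ, hm,
      ← integral_add (pint _ iW) (pint _ iZ), ← integral_const_mul, neg_add_eq_sub,
      ← integral_sub (pint _ i_f)]
    · refine integral_congr_ae (Filter.Eventually.of_forall fun t => ?_)
      simp only; ring
    · have := (pint (φ i) i_f).sub (((pint (φ i) iW).add (pint (φ i) iZ)).const_mul (lam i))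
      refine this.congr (Filter.Eventually.of_forall fun t => ?_)
      simp only [Pi.sub_apply, Pi.add_apply]; ring
  have hX : inner ℝ X₁ w = inner ℝ X₂ y := by
    rw [← φ.tsum_inner_mul_inner X₁ w, ← φ.tsum_inner_mul_inner X₂ y]
    refine tsum_congr fun i => ?_
    rw [hmodes i, real_inner_comm w, real_inner_comm y, hy i]; ring
  rw [hX₁, hX₂, inner_add_left, inner_add_left, pair _ iut, pair _ i_f, pair _ iW, pair _ iZ] at hX
  simp only [smul_eq_mul]
  have e : ∫ t in Ioo 0 T, η t * (inner ℝ (f t) w - (inner ℝ (W t) y + inner ℝ (Z t) y))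
      = (∫ t in Ioo 0 T, η t * inner ℝ (f t) w) - ((∫ t in Ioo 0 T, η t * inner ℝ (W t) y)
        + ∫ t in Ioo 0 T, η t * inner ℝ (Z t) y) := by
    rw [← integral_add (pint _ iW) (pint _ iZ), ← integral_sub (pint _ i_f)]
    · refine integral_congr_ae (Filter.Eventually.of_forall fun t => ?_)
      simp only; ring
    · exact (pint _ iW).add (pint _ iZ)
  rw [e]
  linarith

/-- Convolution with a continuous scalar kernel commutes with inner products. -/
theorem inner_conv_eq {T t : ℝ} {κ : ℝ → ℝ} (hκ : ContinuousOn κ (Icc 0 T))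
    (φ : HilbertBasis ℕ ℝ (L2 Ω)) {W : ℝ → L2 Ω} (hW : Integrable W (timeMeasure T))
    (ht : t ∈ Icc 0 T) {z : L2 Ω}
    (hz : ∀ i, inner ℝ z (φ i) = conv κ (fun s => inner ℝ (W s) (φ i)) t) (y : L2 Ω) :
    inner ℝ z y = conv κ (fun s => inner ℝ (W s) y) t := by
  have hWt : IntegrableOn W (Ioc 0 t) := by
    have : IntegrableOn W (Ioc 0 T) := by rw [integrableOn_Ioc_iff_integrableOn_Ioo]; exact hW
    exact this.mono_set (Ioc_subset_Ioc_right ht.2)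
  have hint : Integrable (fun s => κ (t - s) • W s) (volume.restrict (Ioc 0 t)) := by
    obtain ⟨C, hC⟩ := isCompact_Icc.exists_bound_of_continuousOn hκ
    have hmaps : ∀ s ∈ Ioc 0 t, t - s ∈ Icc 0 T := fun s hs =>
      ⟨by linarith [hs.2], by linarith [hs.1, ht.2]⟩
    have hm : AEStronglyMeasurable (fun s => κ (t - s)) (volume.restrict (Ioc 0 t)) :=
      (hκ.comp (by fun_prop) hmaps).aestronglyMeasurable measurableSet_Ioc
    refine Integrable.bdd_smul hWt C hm ?_
    filter_upwards [ae_restrict_mem measurableSet_Ioc] with s hs using hC _ (hmaps s hs)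
  have hall : ∀ x : L2 Ω, inner ℝ (∫ s in Ioc 0 t, κ (t - s) • W s) x
      = conv κ (fun s => inner ℝ (W s) x) t := by
    intro x
    rw [real_inner_comm, ← integral_inner hint, conv, intervalIntegral.integral_of_le ht.1]
    simp only [inner_smul_right, real_inner_comm]
  rw [← hall y]
  congr 1
  exact eq_of_forall_inner_basis φ fun i => by rw [hz i, hall]

/-- Existence of a weak solution. It is the sum of the solutions of the mode equations with the
modes of the data; all series converge, because the energies of the data are summable and the bounds
of the modes are uniform. -/
theorem exists_solution {K T M : ℝ} (hK : 0 < K) (hT : 0 < T) {lam : ℕ → ℝ}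
    {φ : HilbertBasis ℕ ℝ (L2 Ω)} (h : IsDirichletEigenbasis Ω K lam φ) {c₀ : ℝ} (hc₀ : 0 < c₀)
    (hc₀l : ∀ i, c₀ ≤ lam i) {α k₁ : ℝ → ℝ} (hk : KernelBound T M k₁)
    (hker : ∀ t ∈ Ioo 0 T, kernel α t = ∫ s in (0 : ℝ)..t, k₁ s) {f : ℝ → L2 Ω}
    (hf : MemLp f 2 (timeMeasure T)) {u₀ : L2 Ω} (u₁ : L2 Ω) (hu₀ : hNorm lam φ 1 u₀ < ⊤) :
    ∃ (u : ℝ → L2 Ω) (U V : ℕ → ℝ → ℝ), IsSolution Ω K T α f u₀ u₁ u ∧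
      (∀ i, IsMode T M k₁ (lam i) (inner ℝ u₀ (φ i)) (inner ℝ u₁ (φ i))
        (fun t => inner ℝ (f t) (φ i)) (U i) (V i)) ∧
      ∀ᵐ t ∂timeMeasure T, ∀ i, inner ℝ (u t) (φ i) = U i t := by
  have hl := h.pos
  have hfi : ∀ i, MemLp (fun t => inner ℝ (f t) (φ i)) 2 (timeMeasure T) := fun i =>
    memLp_modes hf (φ i)
  have hmode : ∀ i, ∃ U V : ℝ → ℝ, IsMode T M k₁ (lam i) (inner ℝ u₀ (φ i)) (inner ℝ u₁ (φ i))
      (fun t => inner ℝ (f t) (φ i)) U V := by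
    intro i
    obtain ⟨U, V, h1, h2, h3, h4, h5⟩ := exists_mode hT hk.nonneg hk.int hk.le (hl i)
      (inner ℝ u₀ (φ i)) (inner ℝ u₁ (φ i)) ((integrable_timeMeasure_iff hT.le).1
        (integrable_of_memLp_two (hfi i)))
    exact ⟨U, V, h1, h2, h3, h4, fun t ht => (h5 t ht).1, fun t ht => (h5 t ht).2⟩
  choose U V hUV using hmode
  set E : ℕ → ℝ := fun i => modeEnergy T (lam i) (inner ℝ u₀ (φ i)) (inner ℝ u₁ (φ i))
    (fun t => inner ℝ (f t) (φ i)) with hEdef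
  have hE0 : ∀ i, 0 ≤ E i := fun i => modeEnergy_nonneg hT _ _ _ _
  have hfn : normHH lam φ T 0 0 f ≠ ⊤ := by
    rw [← sq_rpow_half (normHH lam φ T 0 0 f), normHH_zero_sq φ 0 hf]
    refine ENNReal.rpow_ne_top_of_nonneg (by norm_num) ?_
    have h2 := lintegral_rpow_enorm_lt_top_of_eLpNorm_lt_top (by norm_num) (by norm_num) hf.2
    have h3 : (2 : ℝ≥0∞).toReal = ((2 : ℕ) : ℝ) := by norm_num
    simp only [h3, ENNReal.rpow_natCast] at h2
    simpa only [hNorm_zero_eq] using h2.ne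
  have hEfin : ∑' i, ENNReal.ofReal (E i) ≠ ⊤ := by
    have := tsum_modeEnergy hT hl φ 0 hf u₀ u₁
    simp only [mul_zero, pow_zero, one_mul] at this
    rw [this]
    refine ENNReal.add_ne_top.2 ⟨ENNReal.add_ne_top.2 ⟨ENNReal.pow_ne_top hu₀.ne, ?_⟩,
      ENNReal.pow_ne_top hfn⟩
    rw [hNorm_zero_eq]
    exact ENNReal.pow_ne_top enorm_ne_top
  obtain ⟨C, hC, hCb⟩ := exists_mode_bounds (M := M) hT hk.nonneg hc₀
  have hb := fun i => hCb k₁ (lam i) _ _ _ (fun _ => 0) (fun _ => 0) (U i) (V i) hk (hc₀l i)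
    (hfi i) (hUV i)
  have hUm : ∀ i, MemLp (U i) 2 (timeMeasure T) := fun i => memLp_of_continuousOn (hUV i).cont
  -- `W` is the sum of the `lam i * U i`, so that its image under the operator `A` below is the
  -- gradient of the solution. The functions `ut`, `u` and `Z` are the sums of the `V i`, of the `U
  -- i` and of the `lam i * (κ * U i)`.
  obtain ⟨W, hW2, hWm⟩ := exists_of_modes_le hT φ (c := fun i t => lam i * U i t) (E := E) hC
    (fun i => (hUm i).const_mul _) (fun i => by
      have := (hb i).1
      simp only [mul_pow]
      rwa [intervalIntegral.integral_const_mul]) hEfin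
  obtain ⟨ut, hut2, hutm⟩ := exists_of_modes_le hT φ (c := V) (E := E) hC
    (fun i => memLp_of_continuousOn (hUV i).cont') (fun i => (hb i).2.1) hEfin
  obtain ⟨u, hu2, hum⟩ := exists_of_modes_le hT φ (c := U) (E := E) (C := C / c₀ ^ 2)
    (by positivity) hUm (fun i => by
      have h1 := (hb i).1
      have h2 := integral_sq_nonneg hT (U i)
      rw [div_mul_eq_mul_div, le_div_iff₀ (by positivity), mul_comm]
      refine le_trans ?_ h1
      gcongr
      exact hc₀l i) hEfin
  set κ : ℝ → ℝ := fun x => ∫ r in (0 : ℝ)..x, k₁ r with hκ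
  have hκc : ContinuousOn κ (Icc 0 T) := continuousOn_primitive hT.le hk.int
  obtain ⟨Z, hZ2, hZm⟩ := exists_of_modes_le hT φ (c := fun i t => lam i * conv κ (U i) t) (E := E)
    (C := T * ((T * M) ^ 2 * energyConst T M))
    (by have := energyConst_nonneg (M := M) hT; positivity)
    (fun i => (memLp_of_continuousOn
      (continuousOn_conv_of_kernelBound hT hk (hUV i).cont)).const_mul _)
    (fun i => (hUV i).integral_sq_conv_le hT hk (hl i) (hfi i)) hEfin
  obtain ⟨A, hA, hA'⟩ := exists_gradient_operator hK h
  have hut1 := integrable_of_memLp_two hut2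
  have hwu : HasWeakTimeDeriv T u ut := by
    refine hasWeakTimeDeriv_of_modes φ (integrable_of_memLp_two hu2) hut1 fun i =>
      ((hUV i).weak_u hT).congr ?_ ?_
    · filter_upwards [hum] with t ht using ht i
    · filter_upwards [hutm] with t ht using ht i
  refine ⟨u, U, V, ⟨hu2, ut, fun t => A (W t), hut2, hwu, A.comp_memLp' hW2, ?_, ?_, ?_⟩, hUV, hum⟩
  · filter_upwards [hum, hWm] with t h1 h2
    exact hA _ _ fun i => by rw [h1 i, h2 i]
  · -- the continuous representative of `u`
    have hio : IntegrableOn ut (Ioc 0 T) := by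
      rw [integrableOn_Ioc_iff_integrableOn_Ioo]; exact hut1
    refine ⟨fun t => u₀ + ∫ s in (0 : ℝ)..t, ut s, ?_, ?_, by simp⟩
    · refine continuousOn_const.add ?_
      have := intervalIntegral.continuousOn_primitive_interval (μ := volume) (f := ut) (a := 0)
        (b := T) (by rw [uIcc_of_le hT.le, integrableOn_Icc_iff_integrableOn_Ioc]; exact hio)
      rwa [uIcc_of_le hT.le] at this
    · filter_upwards [hum, ae_restrict_mem measurableSet_Ioo] with t h1 ht
      have ht' := Ioo_subset_Icc_self ht
      refine eq_of_forall_inner_basis φ fun i => ?_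
      have hmt : ∀ᵐ s ∂(volume.restrict (Ioc 0 t)), inner ℝ (φ i) (ut s) = V i s := by
        have h2 : ∀ᵐ s ∂(volume.restrict (Ioc 0 T)), ∀ i, inner ℝ (ut s) (φ i) = V i s := by
          rw [← restrict_Ioo_eq_restrict_Ioc]; exact hutm
        filter_upwards [ae_mono (Measure.restrict_mono (Ioc_subset_Ioc_right ht'.2) le_rfl) h2]
          with s hs
        rw [real_inner_comm, hs i]
      rw [h1 i, (hUV i).eq t ht', inner_add_left, intervalIntegral.integral_of_le ht'.1,
        intervalIntegral.integral_of_le ht'.1, real_inner_comm _ (∫ s in Ioc 0 t, ut s),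
        ← integral_inner (hio.mono_set (Ioc_subset_Ioc_right ht'.2)), integral_congr_ae hmt]
  · intro p hp
    obtain ⟨y, hy, hyi⟩ := hA' p hp
    refine ⟨?_, ?_⟩
    · have hweak := hasWeakTimeDeriv_of_mode_equations (lam := lam) φ hut1
        (integrable_of_memLp_two hf) (integrable_of_memLp_two hW2) (integrable_of_memLp_two hZ2)
        (fun i => ((hUV i).weak_v hT hk (hfi i)).congr
          (by filter_upwards [hutm] with t ht using ht i)
          (by
            filter_upwards [hWm, hZm] with t h1 h2
            rw [h1 i, h2 i, modeAcc]; ring)) hyi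
      refine hweak.congr .rfl ?_
      filter_upwards [hZm, ae_restrict_mem measurableSet_Ioo] with t h2 ht
      have ht' := Ioo_subset_Icc_self ht
      have hZy := inner_conv_eq hκc φ (integrable_of_memLp_two hW2) ht' (z := Z t) (fun i => by
        rw [h2 i, ← conv_const_mul]
        refine conv_congr_ae ht' ?_
        filter_upwards [hWm] with s hs using (hs i).symm) y
      rw [hZy, conv_congr_left ht' hker, ← conv_const_mul, hy (W t)]
      simp only [hy]
      ring
    · -- the continuous representative of `(u', w)`
      have hsumE : Summable E := by
        have := ENNReal.summable_toReal hEfin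
        simpa only [ENNReal.toReal_ofReal (hE0 _)] using this
      have hN := energyConst_nonneg (M := M) hT
      have hsumw : Summable fun i => inner ℝ p.1 (φ i) ^ 2 := by
        have := φ.summable_inner_mul_inner p.1 p.1
        refine this.congr fun i => ?_
        rw [real_inner_comm p.1 (φ i), sq]
      refine ⟨fun t => ∑' i, V i t * inner ℝ p.1 (φ i), ?_, ?_, ?_⟩
      · refine continuousOn_tsum (u := fun i => energyConst T M * E i + inner ℝ p.1 (φ i) ^ 2)
          (fun i => (hUV i).cont'.mul continuousOn_const) ((hsumE.mul_left _).add hsumw)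
          fun i t ht => ?_
        have h1 := ((hUV i).le_sqrt hT (hfi i) ht).2
        have h2 : √(energyConst T M * E i) ^ 2 = energyConst T M * E i :=
          Real.sq_sqrt (mul_nonneg hN (hE0 i))
        rw [Real.norm_eq_abs, abs_mul, ← h2, ← sq_abs (inner ℝ p.1 (φ i))]
        have h3 : |V i t| * |inner ℝ p.1 (φ i)|
            ≤ √(energyConst T M * E i) * |inner ℝ p.1 (φ i)| := by gcongr
        nlinarith [sq_nonneg (√(energyConst T M * E i) - |inner ℝ p.1 (φ i)|),
          sq_nonneg (√(energyConst T M * E i)), sq_nonneg |inner ℝ p.1 (φ i)|]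
      · filter_upwards [hutm] with t ht
        rw [← φ.tsum_inner_mul_inner]
        refine tsum_congr fun i => ?_
        rw [ht i, real_inner_comm p.1]
      · rw [← φ.tsum_inner_mul_inner u₁]
        refine tsum_congr fun i => ?_
        have : V i 0 = inner ℝ u₁ (φ i) := by
          rw [(hUV i).eq' 0 ⟨le_rfl, hT.le⟩]; simp
        rw [this, real_inner_comm p.1]

end

/-! ### Regularity estimates -/

section

variable {d : ℕ} {Ω : Set (EuclideanSpace ℝ (Fin d))}

theorem rpow_half_le_of_le_sq {x y : ℝ≥0∞} (h : x ≤ y ^ 2) : x ^ (1 / 2 : ℝ) ≤ y := by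
  rw [← sq_rpow_half y]
  exact ENNReal.rpow_le_rpow h (by norm_num)

theorem pow_le_mul_pow_of_le {c₀ l : ℝ} (hc₀ : 0 < c₀) (hl : c₀ ≤ l) {n m : ℕ} (hnm : n ≤ m)
    (hm : m ≤ 8) : l ^ n ≤ max 1 c₀⁻¹ ^ 8 * l ^ m := by
  have hl0 : 0 < l := hc₀.trans_le hl
  have h1 : 1 ≤ max 1 c₀⁻¹ * l := by
    calc 1 = c₀⁻¹ * c₀ := by field_simp
      _ ≤ max 1 c₀⁻¹ * l := by gcongr; exact le_max_right _ _
  calc l ^ n = l ^ n * 1 := (mul_one _).symm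
    _ ≤ l ^ n * (max 1 c₀⁻¹ * l) ^ (m - n) := by gcongr; exact one_le_pow₀ h1
    _ = max 1 c₀⁻¹ ^ (m - n) * l ^ m := by
        rw [mul_pow, mul_left_comm, ← pow_add, Nat.add_sub_cancel' hnm]
    _ ≤ _ := by
        gcongr
        · exact le_max_left _ _
        · omega

/-- The four a priori estimates for a function whose modes solve the mode equations. The square of
each norm on the left is a sum over the modes of weighted mean squares of time derivatives, which
`exists_mode_bounds` compares with weighted energies of the data, and the sums of these are the
squares of the norms on the right. -/
theorem regularity_estimates {T M : ℝ} (hT : 0 < T) (hM : 0 ≤ M) {c₀ : ℝ} (hc₀ : 0 < c₀) :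
    ∃ Q : ℝ, 0 < Q ∧ ∀ (lam : ℕ → ℝ) (φ : HilbertBasis ℕ ℝ (L2 Ω)) (k₁ : ℝ → ℝ)
      (f : ℝ → L2 Ω) (u₀ u₁ : L2 Ω) (u : ℝ → L2 Ω) (U V : ℕ → ℝ → ℝ),
      (∀ i, c₀ ≤ lam i) → KernelBound T M k₁ → MemLp f 2 (timeMeasure T) →
      (∀ i, IsMode T M k₁ (lam i) (inner ℝ u₀ (φ i)) (inner ℝ u₁ (φ i))
        (fun t => inner ℝ (f t) (φ i)) (U i) (V i)) →
      (∀ᵐ t ∂timeMeasure T, ∀ i, inner ℝ (u t) (φ i) = U i t) →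
      (hNorm lam φ 1 u₀ < ⊤ → normHL2 T 0 f < ⊤ → normHL2 T 1 u ≤
        ENNReal.ofReal Q * (hNorm lam φ 1 u₀ + ‖u₁‖ₑ + normHL2 T 0 f)) ∧
      (normHL2 T 1 f < ⊤ → normHH lam φ T 0 1 f < ⊤ →
        hNorm lam φ 2 u₀ < ⊤ → hNorm lam φ 1 u₁ < ⊤ →
        normHL2 T 2 u + normHH lam φ T 0 2 u ≤
          ENNReal.ofReal Q * (hNorm lam φ 2 u₀ + hNorm lam φ 1 u₁
            + normHL2 T 1 f + normHH lam φ T 0 1 f)) ∧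
      (normHH lam φ T 1 1 f < ⊤ → normHH lam φ T 0 2 f < ⊤ →
        hNorm lam φ 3 u₀ < ⊤ → hNorm lam φ 2 u₁ < ⊤ →
        normHL2 T 3 u + normHH lam φ T 1 2 u ≤
          ENNReal.ofReal Q * (hNorm lam φ 3 u₀ + hNorm lam φ 2 u₁
            + normHH lam φ T 1 1 f + normHH lam φ T 0 2 f)) ∧
      (normHH lam φ T 2 2 f < ⊤ → normHH lam φ T 0 3 f < ⊤ →
        hNorm lam φ 4 u₀ < ⊤ → hNorm lam φ 3 u₁ < ⊤ →
        normHL2 T 4 u + normHH lam φ T 2 2 u ≤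
          ENNReal.ofReal Q * (hNorm lam φ 4 u₀ + hNorm lam φ 3 u₁
            + normHH lam φ T 2 2 f + normHH lam φ T 0 3 f)) := by
  obtain ⟨C, hC, hCb⟩ := exists_mode_bounds (M := M) hT hM hc₀
  -- `q ^ 8` is the price for raising the power of the frequency, up to the eighth.
  set q := max 1 c₀⁻¹ with hq
  have hq1 : 1 ≤ q ^ 8 := one_le_pow₀ (le_max_left _ _)
  have hq0 : 0 ≤ q ^ 8 := zero_le_one.trans hq1
  set B := C * (q ^ 8 * q ^ 8) with hB
  have hB0 : 0 ≤ B := by positivity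
  -- Each of the two norms on the left has at most five time derivatives, each with constant `B`;
  -- the summand `1` makes `Q` positive.
  refine ⟨2 * √(5 * B) + 1, by positivity, ?_⟩
  intro lam φ k₁ f u₀ u₁ u U V hl hk hf hUV hum
  have hl0 : ∀ i, 0 < lam i := fun i => hc₀.trans_le (hl i)
  set E : ℕ → ℝ := fun i => modeEnergy T (lam i) (inner ℝ u₀ (φ i)) (inner ℝ u₁ (φ i))
    (fun t => inner ℝ (f t) (φ i)) with hEdef
  have hE0 : ∀ i, 0 ≤ E i := fun i => modeEnergy_nonneg hT _ _ _ _
  have hfi : ∀ i, MemLp (fun t => inner ℝ (f t) (φ i)) 2 (timeMeasure T) := fun i =>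
    memLp_modes hf (φ i)
  have hpow : ∀ i {n m : ℕ}, n ≤ m → m ≤ 8 → lam i ^ n ≤ q ^ 8 * lam i ^ m := fun i n m h1 h2 =>
    pow_le_mul_pow_of_le hc₀ (hl i) h1 h2
  -- Weakening of a bound by an energy to higher powers of the frequency.
  have hup : ∀ i {x y : ℝ} {n m : ℕ}, 0 ≤ y → n ≤ m → m ≤ 8 → x ≤ C * (lam i ^ n * y) →
      x ≤ C * q ^ 8 * (lam i ^ m * y) := by
    intro i x y n m hy h1 h2 hx
    refine hx.trans ?_
    have := mul_le_mul_of_nonneg_right (hpow i h1 h2) hy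
    calc _ ≤ C * (q ^ 8 * lam i ^ m * y) := by gcongr
      _ = _ := by ring
  have hCB : C * q ^ 8 ≤ B := by
    rw [hB]; gcongr; exact le_mul_of_one_le_left hq0 hq1
  have hCB' : C ≤ B := (le_mul_of_one_le_right hC hq1).trans hCB
  -- The functions of the `i`-th mode.
  let acc : ℕ → ℝ → ℝ := fun i => modeAcc k₁ (lam i) (fun t => inner ℝ (f t) (φ i)) (U i)
  have hU2 : ∀ i, MemLp (U i) 2 (timeMeasure T) := fun i => memLp_of_continuousOn (hUV i).cont
  have hV2 : ∀ i, MemLp (V i) 2 (timeMeasure T) := fun i => memLp_of_continuousOn (hUV i).cont'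
  have hA2 : ∀ i, MemLp (acc i) 2 (timeMeasure T) := fun i =>
    memLp_modeAcc hT hk (hUV i).cont (hfi i)
  have hwU : ∀ i, HasWeakTimeDeriv T (U i) (V i) := fun i => (hUV i).weak_u hT
  have hwV : ∀ i, HasWeakTimeDeriv T (V i) (acc i) := fun i => (hUV i).weak_v hT hk (hfi i)
  have hb := fun i => hCb k₁ (lam i) _ _ _ (fun _ => 0) (fun _ => 0) (U i) (V i) hk (hl i)
    (hfi i) (hUV i)
  have bU : ∀ i, ∫ t in (0 : ℝ)..T, U i t ^ 2 ≤ C * q ^ 8 * E i := by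
    intro i
    have h1 := hpow i (Nat.zero_le 2) (by norm_num)
    have h2 := integral_sq_nonneg hT (U i)
    calc ∫ t in (0 : ℝ)..T, U i t ^ 2 = lam i ^ 0 * ∫ t in (0 : ℝ)..T, U i t ^ 2 := by simp
      _ ≤ q ^ 8 * lam i ^ 2 * ∫ t in (0 : ℝ)..T, U i t ^ 2 := by gcongr
      _ = q ^ 8 * (lam i ^ 2 * ∫ t in (0 : ℝ)..T, U i t ^ 2) := by ring
      _ ≤ q ^ 8 * (C * E i) := mul_le_mul_of_nonneg_left (hb i).1 hq0
      _ = _ := by ring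
  have hEup : ∀ i {m : ℕ}, m ≤ 8 → E i ≤ q ^ 8 * (lam i ^ m * E i) := by
    intro i m hm
    have := mul_le_mul_of_nonneg_right (hpow i (Nat.zero_le m) hm) (hE0 i)
    simpa [mul_assoc] using this
  have bU' : ∀ i {m : ℕ}, m ≤ 8 → ∫ t in (0 : ℝ)..T, U i t ^ 2 ≤ B * (lam i ^ m * E i) := by
    intro i m hm
    calc _ ≤ _ := bU i
      _ ≤ C * q ^ 8 * (q ^ 8 * (lam i ^ m * E i)) := by gcongr; exact hEup i hm
      _ = _ := by rw [hB]; ring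
  have bV' : ∀ i {m : ℕ}, m ≤ 8 → ∫ t in (0 : ℝ)..T, V i t ^ 2 ≤ B * (lam i ^ m * E i) := by
    intro i m hm
    have h0 : 0 ≤ lam i ^ m * E i := mul_nonneg (pow_nonneg (hl0 i).le _) (hE0 i)
    exact (hup i (n := 0) (hE0 i) (Nat.zero_le m) hm (by simpa using (hb i).2.1)).trans (by gcongr)
  have bA' : ∀ i {m : ℕ}, 2 ≤ m → m ≤ 8 →
      ∫ t in (0 : ℝ)..T, acc i t ^ 2 ≤ B * (lam i ^ m * E i) := by
    intro i m h2 hm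
    have h0 : 0 ≤ lam i ^ m * E i := mul_nonneg (pow_nonneg (hl0 i).le _) (hE0 i)
    exact (hup i (hE0 i) h2 hm (hb i).2.2.1).trans (by gcongr)
  have bU4 : ∀ i {m : ℕ}, 2 ≤ m → m ≤ 8 →
      lam i ^ 4 * ∫ t in (0 : ℝ)..T, U i t ^ 2 ≤ B * (lam i ^ m * E i) := by
    intro i m h2 hm
    have h0 : 0 ≤ lam i ^ m * E i := mul_nonneg (pow_nonneg (hl0 i).le _) (hE0 i)
    refine (hup i (hE0 i) h2 hm ?_).trans (by gcongr)
    have := mul_le_mul_of_nonneg_left (hb i).1 (pow_nonneg (hl0 i).le 2)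
    calc _ = lam i ^ 2 * (lam i ^ 2 * ∫ t in (0 : ℝ)..T, U i t ^ 2) := by ring
      _ ≤ _ := this
      _ = _ := by ring
  have bV4 : ∀ i {m : ℕ}, 4 ≤ m → m ≤ 8 →
      lam i ^ 4 * ∫ t in (0 : ℝ)..T, V i t ^ 2 ≤ B * (lam i ^ m * E i) := by
    intro i m h2 hm
    have h0 : 0 ≤ lam i ^ m * E i := mul_nonneg (pow_nonneg (hl0 i).le _) (hE0 i)
    refine (hup i (hE0 i) h2 hm ?_).trans (by gcongr)
    have := mul_le_mul_of_nonneg_left (hb i).2.1 (pow_nonneg (hl0 i).le 4)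
    calc _ ≤ _ := this
      _ = _ := by ring
  have bA4 : ∀ i {m : ℕ}, 6 ≤ m → m ≤ 8 →
      lam i ^ 4 * ∫ t in (0 : ℝ)..T, acc i t ^ 2 ≤ B * (lam i ^ m * E i) := by
    intro i m h2 hm
    have h0 : 0 ≤ lam i ^ m * E i := mul_nonneg (pow_nonneg (hl0 i).le _) (hE0 i)
    refine (hup i (hE0 i) h2 hm ?_).trans (by gcongr)
    have := mul_le_mul_of_nonneg_left (hb i).2.2.1 (pow_nonneg (hl0 i).le 4)
    calc _ ≤ _ := this
      _ = _ := by ring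
  have hsumE := fun s => tsum_modeEnergy hT hl0 φ s hf u₀ u₁
  have hfin : ∀ {x y : ℝ≥0∞} (m : ℕ), m ≤ 4 → x ≤ ENNReal.ofReal (√((m + 1) * B)) * y →
      x ≤ ENNReal.ofReal (√(5 * B)) * y := by
    intro x y m hm hx
    refine hx.trans ?_
    gcongr
    have : (m : ℝ) ≤ 4 := by exact_mod_cast hm
    linarith
  have htwo : ∀ {x x' y y' : ℝ≥0∞}, x ≤ ENNReal.ofReal (√(5 * B)) * y ^ (1 / 2 : ℝ) →
      x' ≤ ENNReal.ofReal (√(5 * B)) * y ^ (1 / 2 : ℝ) → y ≤ y' ^ 2 →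
      x + x' ≤ ENNReal.ofReal (2 * √(5 * B) + 1) * y' := by
    intro x x' y y' h1 h2 hy
    have h3 := rpow_half_le_of_le_sq hy
    calc x + x' ≤ ENNReal.ofReal (√(5 * B)) * y' + ENNReal.ofReal (√(5 * B)) * y' := by
          refine add_le_add (h1.trans ?_) (h2.trans ?_) <;> gcongr
      _ = ENNReal.ofReal (2 * √(5 * B)) * y' := by
          rw [← add_mul, ← ENNReal.ofReal_add (by positivity) (by positivity), ← two_mul]
      _ ≤ _ := by gcongr; linarith
  have hsq : ∀ a b c e : ℝ≥0∞, a ^ 2 + b ^ 2 + c ^ 2 + e ^ 2 ≤ (a + b + c + e) ^ 2 := by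
    intro a b c e
    have : (a + b + c + e) ^ 2 = a ^ 2 + b ^ 2 + c ^ 2 + e ^ 2
        + 2 * (a * b + a * c + a * e + b * c + b * e + c * e) := by ring
    rw [this]; exact le_self_add
  refine ⟨fun hu₀ hfn => ?_, fun _ hfn hu₀ hu₁ => ?_, fun hfn hfn' hu₀ hu₁ => ?_,
    fun hfn hfn' hu₀ hu₁ => ?_⟩
  -- The energy itself, without a weight, bounds `u` and its first derivative.
  · rw [normHL2_eq lam φ] at hfn ⊢
    rw [normHL2_eq lam φ]
    have hR : ∑' i, ENNReal.ofReal (lam i ^ 0 * E i) = _ := hsumE 0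
    have hRfin : ∑' i, ENNReal.ofReal (lam i ^ 0 * E i) ≠ ⊤ := by
      rw [hR, hNorm_zero_eq]
      exact ENNReal.add_ne_top.2 ⟨ENNReal.add_ne_top.2 ⟨ENNReal.pow_ne_top hu₀.ne,
        ENNReal.pow_ne_top enorm_ne_top⟩, ENNReal.pow_ne_top hfn.ne⟩
    have h1 := normHH_le_of_modes hT hc₀ hl φ 1 0 (c := fun j => match j with
      | 0 => U
      | _ => V) hum (by intro j hj i; interval_cases j; exacts [hU2 i, hV2 i])
      (by intro j hj i; interval_cases j; exact hwU i) hB0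
      (by
        intro j hj i
        simp only [mul_zero, pow_zero, one_mul]
        interval_cases j
        · simpa using bU' i (Nat.zero_le 8)
        · simpa using bV' i (Nat.zero_le 8)) hRfin
    have h3 := htwo (x' := 0) (hfin 1 (by norm_num) h1) zero_le (y' := hNorm lam φ 1 u₀ + ‖u₁‖ₑ
      + normHH lam φ T 0 0 f) (by
        rw [hR, ← hNorm_zero_eq lam φ]
        simpa using hsq (hNorm lam φ 1 u₀) (hNorm lam φ 0 u₁) (normHH lam φ T 0 0 f) 0)
    simpa using h3
  -- With the weight `lam²`, it bounds the second derivative and `lam² u`.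
  · rw [normHL2_eq lam φ 2]
    have hR : ∑' i, ENNReal.ofReal (lam i ^ 2 * E i) = _ := hsumE 1
    have hRfin : ∑' i, ENNReal.ofReal (lam i ^ 2 * E i) ≠ ⊤ := by
      rw [hR]
      exact ENNReal.add_ne_top.2 ⟨ENNReal.add_ne_top.2 ⟨ENNReal.pow_ne_top hu₀.ne,
        ENNReal.pow_ne_top hu₁.ne⟩, ENNReal.pow_ne_top hfn.ne⟩
    have h1 := normHH_le_of_modes hT hc₀ hl φ 2 0 (c := fun j => match j with
      | 0 => U
      | 1 => V
      | _ => acc) hum (by intro j hj i; interval_cases j; exacts [hU2 i, hV2 i, hA2 i])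
      (by intro j hj i; interval_cases j; exacts [hwU i, hwV i]) hB0
      (by
        intro j hj i
        simp only [mul_zero, pow_zero, one_mul]
        interval_cases j
        exacts [bU' i (by norm_num), bV' i (by norm_num), bA' i le_rfl (by norm_num)]) hRfin
    have h2 := normHH_le_of_modes hT hc₀ hl φ 0 2 (c := fun _ => U) hum (fun _ _ i => hU2 i)
      (fun j hj => absurd hj (Nat.not_lt_zero j)) hB0 (fun j _ i => bU4 i le_rfl (by norm_num))
      hRfin
    refine htwo (hfin 2 (by norm_num) h1) (hfin 0 (by norm_num) h2) ?_
    rw [hR]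
    refine le_trans ?_ (hsq _ _ _ _)
    refine add_le_add ?_ le_rfl
    exact le_self_add
  -- With the weight `lam⁴`, and together with `F`, the mean square of the derivative of `f`, it
  -- bounds the third derivative.
  · rw [normHL2_eq lam φ 3]
    obtain ⟨D, hD⟩ := exists_of_sobNorm_lt_top hfn
    have hD1 := memLp_modes (hD.memLp 1 le_rfl)
    have hD0 : ∀ i, HasWeakTimeDeriv T (fun t => inner ℝ (f t) (φ i))
        (fun t => inner ℝ (D 1 t) (φ i)) := fun i =>
      (((hD.deriv 0 one_pos).congr hD.zero.symm .rfl).inner_const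
        (integrable_of_memLp_two hf) (integrable_of_memLp_two (hD.memLp 1 le_rfl)) (φ i))
    let jerk : ℕ → ℝ → ℝ := fun i =>
      modeJerk k₁ (lam i) (fun t => inner ℝ (D 1 t) (φ i)) (U i) (V i)
    have hJ2 : ∀ i, MemLp (jerk i) 2 (timeMeasure T) := fun i =>
      memLp_modeJerk hT hk (hUV i).cont (hUV i).cont' (hD1 (φ i))
    have hwA : ∀ i, HasWeakTimeDeriv T (acc i) (jerk i) := fun i =>
      (hUV i).weak_acc hT hk (hfi i) (hD1 (φ i)) (hD0 i)
    set F : ℕ → ℝ := fun i => ∫ t in (0 : ℝ)..T, inner ℝ (D 1 t) (φ i) ^ 2 with hF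
    have hF0 : ∀ i, 0 ≤ F i := fun i => integral_sq_nonneg hT _
    have bJ : ∀ i, ∫ t in (0 : ℝ)..T, jerk i t ^ 2
        ≤ B * (lam i ^ 4 * E i + lam i ^ 2 * F i) := by
      intro i
      have h1 := (hCb k₁ (lam i) _ _ _ (fun t => inner ℝ (D 1 t) (φ i)) (fun _ => 0) (U i) (V i)
        hk (hl i) (hfi i) (hUV i)).2.2.2.1 (hD1 (φ i))
      have h2 := mul_le_mul_of_nonneg_right (hpow i (Nat.zero_le 2) (by norm_num)) (hF0 i)
      have h3 : 0 ≤ lam i ^ 4 * E i := mul_nonneg (pow_nonneg (hl0 i).le _) (hE0 i)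
      have h4 : 0 ≤ lam i ^ 2 * F i := mul_nonneg (pow_nonneg (hl0 i).le _) (hF0 i)
      calc _ ≤ C * (lam i ^ 4 * E i + F i) := h1
        _ ≤ C * (q ^ 8 * (lam i ^ 4 * E i) + q ^ 8 * (lam i ^ 2 * F i)) :=
            mul_le_mul_of_nonneg_left (add_le_add (le_mul_of_one_le_left h3 hq1)
              (by simpa [mul_assoc] using h2)) hC
        _ = C * q ^ 8 * (lam i ^ 4 * E i + lam i ^ 2 * F i) := by ring
        _ ≤ _ := by gcongr
    have hR : ∑' i, ENNReal.ofReal (lam i ^ 4 * E i + lam i ^ 2 * F i)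
        = (hNorm lam φ 3 u₀ ^ 2 + hNorm lam φ 2 u₁ ^ 2 + normHH lam φ T 0 2 f ^ 2)
          + ∫⁻ t in Ioo 0 T, hNorm lam φ 1 (D 1 t) ^ 2 := by
      rw [lintegral_hNorm_sq hT.le hl0 φ 1 (fun i => hD1 (φ i))
        (Filter.Eventually.of_forall fun t i => rfl), ← hsumE 2, ← ENNReal.tsum_add]
      refine tsum_congr fun i => ENNReal.ofReal_add ?_ ?_
      · exact mul_nonneg (pow_nonneg (hl0 i).le _) (hE0 i)
      · exact mul_nonneg (pow_nonneg (hl0 i).le _) (hF0 i)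
    have hle := lintegral_le_normHH_sq (lam := lam) (s := 1) φ hD le_rfl
    have hR' : ∑' i, ENNReal.ofReal (lam i ^ 4 * E i + lam i ^ 2 * F i)
        ≤ hNorm lam φ 3 u₀ ^ 2 + hNorm lam φ 2 u₁ ^ 2 + normHH lam φ T 1 1 f ^ 2
          + normHH lam φ T 0 2 f ^ 2 := by
      rw [hR, add_right_comm _ (normHH lam φ T 1 1 f ^ 2)]
      gcongr
    have hRfin : ∑' i, ENNReal.ofReal (lam i ^ 4 * E i + lam i ^ 2 * F i) ≠ ⊤ := by
      refine ne_top_of_le_ne_top ?_ hR'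
      exact ENNReal.add_ne_top.2 ⟨ENNReal.add_ne_top.2 ⟨ENNReal.add_ne_top.2
        ⟨ENNReal.pow_ne_top hu₀.ne, ENNReal.pow_ne_top hu₁.ne⟩, ENNReal.pow_ne_top hfn.ne⟩,
        ENNReal.pow_ne_top hfn'.ne⟩
    have hext : ∀ i {x : ℝ}, x ≤ B * (lam i ^ 4 * E i) →
        x ≤ B * (lam i ^ 4 * E i + lam i ^ 2 * F i) := by
      intro i x hx
      have h4 : 0 ≤ lam i ^ 2 * F i := mul_nonneg (pow_nonneg (hl0 i).le _) (hF0 i)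
      exact hx.trans (by gcongr; linarith)
    have h1 := normHH_le_of_modes hT hc₀ hl φ 3 0 (c := fun j => match j with
      | 0 => U
      | 1 => V
      | 2 => acc
      | _ => jerk) hum (by intro j hj i; interval_cases j; exacts [hU2 i, hV2 i, hA2 i, hJ2 i])
      (by intro j hj i; interval_cases j; exacts [hwU i, hwV i, hwA i]) hB0
      (by
        intro j hj i
        simp only [mul_zero, pow_zero, one_mul]
        interval_cases j
        exacts [hext i (bU' i (by norm_num)), hext i (bV' i (by norm_num)),
          hext i (bA' i (by norm_num) (by norm_num)), bJ i]) hRfin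
    have h2 := normHH_le_of_modes hT hc₀ hl φ 1 2 (c := fun j => match j with
      | 0 => U
      | _ => V) hum (by intro j hj i; interval_cases j; exacts [hU2 i, hV2 i])
      (by intro j hj i; interval_cases j; exact hwU i) hB0
      (by
        intro j hj i
        interval_cases j
        exacts [hext i (bU4 i (by norm_num) (by norm_num)),
          hext i (bV4 i (by norm_num) (by norm_num))]) hRfin
    exact htwo (hfin 3 (by norm_num) h1) (hfin 1 (by norm_num) h2) (hR'.trans (hsq _ _ _ _))
  -- With the weight `lam⁶`, and together with `F` and `G`, the mean squares of the first two
  -- derivatives of `f`, it bounds the fourth derivative.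
  · rw [normHL2_eq lam φ 4]
    obtain ⟨D, hD⟩ := exists_of_sobNorm_lt_top hfn
    have hDm1 := hD.memLp 1 one_le_two
    have hDm2 := hD.memLp 2 le_rfl
    have hD1 := memLp_modes hDm1
    have hD2 := memLp_modes hDm2
    have hD0 : ∀ i, HasWeakTimeDeriv T (fun t => inner ℝ (f t) (φ i))
        (fun t => inner ℝ (D 1 t) (φ i)) := fun i =>
      (((hD.deriv 0 two_pos).congr hD.zero.symm .rfl).inner_const
        (integrable_of_memLp_two hf) (integrable_of_memLp_two hDm1) (φ i))
    have hD12 : ∀ i, HasWeakTimeDeriv T (fun t => inner ℝ (D 1 t) (φ i))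
        (fun t => inner ℝ (D 2 t) (φ i)) := fun i =>
      (hD.deriv 1 one_lt_two).inner_const
        (integrable_of_memLp_two hDm1) (integrable_of_memLp_two hDm2) (φ i)
    let jerk : ℕ → ℝ → ℝ := fun i =>
      modeJerk k₁ (lam i) (fun t => inner ℝ (D 1 t) (φ i)) (U i) (V i)
    let snap : ℕ → ℝ → ℝ := fun i =>
      modeSnap k₁ (lam i) (inner ℝ u₀ (φ i)) (fun t => inner ℝ (D 2 t) (φ i)) (V i) (acc i)
    have hJ2 : ∀ i, MemLp (jerk i) 2 (timeMeasure T) := fun i =>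
      memLp_modeJerk hT hk (hUV i).cont (hUV i).cont' (hD1 (φ i))
    have hS2 : ∀ i, MemLp (snap i) 2 (timeMeasure T) := fun i =>
      memLp_modeSnap hT hk (hUV i).cont' (hA2 i) (hD2 (φ i))
    have hwA : ∀ i, HasWeakTimeDeriv T (acc i) (jerk i) := fun i =>
      (hUV i).weak_acc hT hk (hfi i) (hD1 (φ i)) (hD0 i)
    have hwJ : ∀ i, HasWeakTimeDeriv T (jerk i) (snap i) := fun i =>
      (hUV i).weak_jerk hT hk (hfi i) (hD1 (φ i)) (hD2 (φ i)) (hD12 i)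
    set F : ℕ → ℝ := fun i => ∫ t in (0 : ℝ)..T, inner ℝ (D 1 t) (φ i) ^ 2 with hF
    set G : ℕ → ℝ := fun i => ∫ t in (0 : ℝ)..T, inner ℝ (D 2 t) (φ i) ^ 2 with hG
    have hF0 : ∀ i, 0 ≤ F i := fun i => integral_sq_nonneg hT _
    have hG0 : ∀ i, 0 ≤ G i := fun i => integral_sq_nonneg hT _
    have p6 : ∀ i, 0 ≤ lam i ^ 6 * E i := fun i => mul_nonneg (pow_nonneg (hl0 i).le _) (hE0 i)
    have p4 : ∀ i, 0 ≤ lam i ^ 4 * F i := fun i => mul_nonneg (pow_nonneg (hl0 i).le _) (hF0 i)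
    have p4' : ∀ i, 0 ≤ lam i ^ 4 * G i := fun i => mul_nonneg (pow_nonneg (hl0 i).le _) (hG0 i)
    have bJ : ∀ i, ∫ t in (0 : ℝ)..T, jerk i t ^ 2
        ≤ B * (lam i ^ 6 * E i + (lam i ^ 4 * F i + lam i ^ 4 * G i)) := by
      intro i
      have h1 := (hCb k₁ (lam i) _ _ _ (fun t => inner ℝ (D 1 t) (φ i)) (fun _ => 0) (U i) (V i)
        hk (hl i) (hfi i) (hUV i)).2.2.2.1 (hD1 (φ i))
      have h2 := mul_le_mul_of_nonneg_right (hpow i (Nat.zero_le 4) (by norm_num)) (hF0 i)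
      have h3 := mul_le_mul_of_nonneg_right (hpow i (n := 4) (m := 6) (by norm_num) (by norm_num))
        (hE0 i)
      have := p6 i
      have := p4 i
      calc _ ≤ C * (lam i ^ 4 * E i + F i) := h1
        _ ≤ C * (q ^ 8 * (lam i ^ 6 * E i) + q ^ 8 * (lam i ^ 4 * F i)) :=
            mul_le_mul_of_nonneg_left (add_le_add (by simpa [mul_assoc] using h3)
              (by simpa [mul_assoc] using h2)) hC
        _ = C * q ^ 8 * (lam i ^ 6 * E i + lam i ^ 4 * F i) := by ring
        _ ≤ _ := by gcongr; linarith [p4' i]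
    have bS : ∀ i, ∫ t in (0 : ℝ)..T, snap i t ^ 2
        ≤ B * (lam i ^ 6 * E i + (lam i ^ 4 * F i + lam i ^ 4 * G i)) := by
      intro i
      have h1 := (hCb k₁ (lam i) _ _ _ (fun _ => 0) (fun t => inner ℝ (D 2 t) (φ i)) (U i) (V i)
        hk (hl i) (hfi i) (hUV i)).2.2.2.2 (hD2 (φ i))
      have h2 := mul_le_mul_of_nonneg_right (hpow i (Nat.zero_le 4) (by norm_num)) (hG0 i)
      have := p6 i
      have := p4' i
      calc _ ≤ C * (lam i ^ 6 * E i + G i) := h1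
        _ ≤ C * (q ^ 8 * (lam i ^ 6 * E i) + q ^ 8 * (lam i ^ 4 * G i)) :=
            mul_le_mul_of_nonneg_left (add_le_add (le_mul_of_one_le_left (p6 i) hq1)
              (by simpa [mul_assoc] using h2)) hC
        _ = C * q ^ 8 * (lam i ^ 6 * E i + lam i ^ 4 * G i) := by ring
        _ ≤ _ := by gcongr; linarith [p4 i]
    have hR : ∑' i, ENNReal.ofReal (lam i ^ 6 * E i + (lam i ^ 4 * F i + lam i ^ 4 * G i))
        = (hNorm lam φ 4 u₀ ^ 2 + hNorm lam φ 3 u₁ ^ 2 + normHH lam φ T 0 3 f ^ 2)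
          + ((∫⁻ t in Ioo 0 T, hNorm lam φ 2 (D 1 t) ^ 2)
            + ∫⁻ t in Ioo 0 T, hNorm lam φ 2 (D 2 t) ^ 2) := by
      rw [lintegral_hNorm_sq hT.le hl0 φ 2 (fun i => hD1 (φ i))
        (Filter.Eventually.of_forall fun t i => rfl),
        lintegral_hNorm_sq hT.le hl0 φ 2 (fun i => hD2 (φ i))
        (Filter.Eventually.of_forall fun t i => rfl), ← hsumE 3, ← ENNReal.tsum_add,
        ← ENNReal.tsum_add]
      refine tsum_congr fun i => ?_
      rw [ENNReal.ofReal_add (p6 i) (add_nonneg (p4 i) (p4' i)),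
        ENNReal.ofReal_add (p4 i) (p4' i)]
    have hle : (∫⁻ t in Ioo 0 T, hNorm lam φ 2 (D 1 t) ^ 2)
        + ∫⁻ t in Ioo 0 T, hNorm lam φ 2 (D 2 t) ^ 2 ≤ normHH lam φ T 2 2 f ^ 2 := by
      rw [normHH, sobNorm_eq _ hD, rpow_half_sq, Finset.sum_range_succ, Finset.sum_range_succ,
        Finset.sum_range_one, add_assoc]
      exact le_add_self
    have hR' : ∑' i, ENNReal.ofReal (lam i ^ 6 * E i + (lam i ^ 4 * F i + lam i ^ 4 * G i))
        ≤ hNorm lam φ 4 u₀ ^ 2 + hNorm lam φ 3 u₁ ^ 2 + normHH lam φ T 2 2 f ^ 2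
          + normHH lam φ T 0 3 f ^ 2 := by
      rw [hR, add_right_comm _ (normHH lam φ T 2 2 f ^ 2)]
      gcongr
    have hRfin : ∑' i, ENNReal.ofReal (lam i ^ 6 * E i
        + (lam i ^ 4 * F i + lam i ^ 4 * G i)) ≠ ⊤ := by
      refine ne_top_of_le_ne_top ?_ hR'
      exact ENNReal.add_ne_top.2 ⟨ENNReal.add_ne_top.2 ⟨ENNReal.add_ne_top.2
        ⟨ENNReal.pow_ne_top hu₀.ne, ENNReal.pow_ne_top hu₁.ne⟩, ENNReal.pow_ne_top hfn.ne⟩,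
        ENNReal.pow_ne_top hfn'.ne⟩
    have hext : ∀ i {x : ℝ}, x ≤ B * (lam i ^ 6 * E i) →
        x ≤ B * (lam i ^ 6 * E i + (lam i ^ 4 * F i + lam i ^ 4 * G i)) := by
      intro i x hx
      exact hx.trans (by gcongr; linarith [p4 i, p4' i])
    have h1 := normHH_le_of_modes hT hc₀ hl φ 4 0 (c := fun j => match j with
      | 0 => U
      | 1 => V
      | 2 => acc
      | 3 => jerk
      | _ => snap) hum
      (by intro j hj i; interval_cases j; exacts [hU2 i, hV2 i, hA2 i, hJ2 i, hS2 i])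
      (by intro j hj i; interval_cases j; exacts [hwU i, hwV i, hwA i, hwJ i]) hB0
      (by
        intro j hj i
        simp only [mul_zero, pow_zero, one_mul]
        interval_cases j
        exacts [hext i (bU' i (by norm_num)), hext i (bV' i (by norm_num)),
          hext i (bA' i (by norm_num) (by norm_num)), bJ i, bS i]) hRfin
    have h2 := normHH_le_of_modes hT hc₀ hl φ 2 2 (c := fun j => match j with
      | 0 => U
      | 1 => V
      | _ => acc) hum (by intro j hj i; interval_cases j; exacts [hU2 i, hV2 i, hA2 i])
      (by intro j hj i; interval_cases j; exacts [hwU i, hwV i]) hB0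
      (by
        intro j hj i
        interval_cases j
        exacts [hext i (bU4 i (by norm_num) (by norm_num)),
          hext i (bV4 i (by norm_num) (by norm_num)),
          hext i (bA4 i (by norm_num) (by norm_num))]) hRfin
    exact htwo (hfin 4 (by norm_num) h1) (hfin 2 (by norm_num) h2) (hR'.trans (hsq _ _ _ _))

end

/-! ### Eigenbases of compact positive operators -/

/-- A real function on an infinite type, all of whose upper level sets are finite, can be listed in
decreasing order. -/
theorem exists_equiv_nat_antitone {ι : Type*} [Infinite ι] (m : ι → ℝ)
    (hfin : ∀ i, {j | m i ≤ m j}.Finite) : ∃ e : ℕ ≃ ι, Antitone (m ∘ e) := by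
  classical
  let _ : LinearOrder ι := IsWellOrder.linearOrder WellOrderingRel
  -- Ordered by decreasing value, with ties broken by an arbitrary linear order, the type is
  -- linearly ordered with finite initial segments, hence isomorphic to `ℕ`.
  let g : ι → ℝᵒᵈ ×ₗ ι := fun i => toLex (OrderDual.toDual (m i), i)
  have hg : Function.Injective g := fun i j h => congrArg Prod.snd (toLex.injective h)
  have hgm : ∀ {i j}, g i ≤ g j → m j ≤ m i := fun {i j} h => by
    rcases (Prod.Lex.le_iff).1 h with h | h
    · exact (OrderDual.toDual_lt_toDual.1 h).le
    · exact (OrderDual.toDual.injective h.1).symm.le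
  let eg : ι ≃ range g := Equiv.ofInjective g hg
  have hinf : Infinite (range g) := eg.infinite_iff.1 inferInstance
  have hIic : ∀ b : range g, (Iic b).Finite := by
    rintro ⟨_, b, rfl⟩
    refine ((hfin b).image eg).subset ?_
    rintro ⟨_, i, rfl⟩ hi
    exact ⟨i, hgm hi, rfl⟩
  let _ : LocallyFiniteOrder (range g) :=
    LocallyFiniteOrder.ofFiniteIcc fun a b => (hIic b).subset Icc_subset_Iic_self
  let _ : SuccOrder (range g) := LinearLocallyFiniteOrder.succOrder _
  let _ : PredOrder (range g) := LinearLocallyFiniteOrder.predOrder _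
  have : NoMaxOrder (range g) := by
    refine ⟨fun a => ?_⟩
    by_contra! h
    exact (hIic a).not_infinite (by
      rw [show Iic a = univ from eq_univ_of_forall h]
      exact infinite_univ)
  obtain ⟨a₀⟩ : Nonempty (range g) := inferInstance
  obtain ⟨b, hb, hmin⟩ := (hIic a₀).exists_minimal ⟨a₀, mem_Iic.2 le_rfl⟩
  let _ : OrderBot (range g) :=
    { bot := b
      bot_le := fun a => by
        rcases le_total a a₀ with h | h
        · exact (le_total b a).elim id (hmin h)
        · exact (mem_Iic.1 hb).trans h }
  let o : range g ≃o ℕ := orderIsoNatOfLinearSuccPredArch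
  refine ⟨o.symm.toEquiv.trans eg.symm, fun i j hij => hgm ?_⟩
  have h1 : ∀ x : range g, g (eg.symm x) = x := fun x =>
    congrArg Subtype.val (eg.apply_symm_apply x)
  have h2 : o.symm i ≤ o.symm j := o.symm.monotone hij
  simpa [h1] using h2

/-- An orthonormal family of eigenvectors of a compact operator has only finitely many members with
eigenvalue above a given positive level. -/
theorem finite_setOf_le_eigenvalue {E ι : Type*} [NormedAddCommGroup E] [InnerProductSpace ℝ E]
    {S : E →L[ℝ] E} (hc : IsCompactOperator S) {v : ι → E} (hv : Orthonormal ℝ v) {m : ι → ℝ}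
    (hS : ∀ i, S (v i) = m i • v i) {ε : ℝ} (hε : 0 < ε) : {i | ε ≤ m i}.Finite := by
  have hK := hc.isCompact_closure_image_closedBall (f := (S : E →ₗ[ℝ] E)) 1
  obtain ⟨t, ht, hcov⟩ := Metric.totallyBounded_iff.1 hK.totallyBounded (ε / 2) (by positivity)
  have hmem : ∀ i, ∃ y ∈ t, S (v i) ∈ Metric.ball y (ε / 2) := by
    intro i
    have : S (v i) ∈ closure ((S : E →ₗ[ℝ] E) '' Metric.closedBall 0 1) :=
      subset_closure ⟨v i, by simp [hv.1 i], rfl⟩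
    simpa using hcov this
  choose c hct hcb using hmem
  refine Finite.of_finite_image (f := c) (ht.subset (image_subset_iff.2 fun i _ => hct i)) ?_
  intro i hi j hj hij
  by_contra hne
  have h1 : dist (S (v i)) (S (v j)) < ε := by
    have h2 := hcb i
    have h3 := hcb j
    rw [Metric.mem_ball] at h2 h3
    rw [← hij] at h3
    linarith [dist_triangle_right (S (v i)) (S (v j)) (c i)]
  -- the images of two different members are orthogonal, each of norm at least `ε`
  have h4 : ‖S (v i) - S (v j)‖ ^ 2 = m i ^ 2 + m j ^ 2 := by
    rw [hS, hS, @norm_sub_sq_real, norm_smul, norm_smul, hv.1, hv.1, inner_smul_left,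
      inner_smul_right, hv.2 hne]
    simp
  rw [dist_eq_norm] at h1
  have h5 : ε ≤ m i := hi
  nlinarith [norm_nonneg (S (v i) - S (v j)), sq_nonneg (m j)]

/-- The spectral theorem for a compact positive definite operator, with the eigenvalues in
decreasing order. The basis is the union of orthonormal bases of the eigenspaces. -/
theorem exists_antitone_eigenbasis {E : Type*} [NormedAddCommGroup E] [InnerProductSpace ℝ E]
    [CompleteSpace E] (hE : ¬ FiniteDimensional ℝ E) {S : E →L[ℝ] E} (hc : IsCompactOperator S)
    (hs : S.IsSymmetric) (hpos : ∀ x ≠ 0, 0 < inner ℝ (S x) x) :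
    ∃ (μ : ℕ → ℝ) (φ : HilbertBasis ℕ ℝ E), Antitone μ ∧ (∀ i, 0 < μ i) ∧
      ∀ i, S (φ i) = μ i • φ i := by
  classical
  let V : ℝ → Submodule ℝ E := fun μ => Module.End.eigenspace (S : E →ₗ[ℝ] E) μ
  have hV0 : V 0 = ⊥ := by
    rw [Submodule.eq_bot_iff]
    intro x hx
    by_contra hne
    have h1 : S x = 0 := by simpa [V] using hx
    simpa [h1] using hpos x hne
  have hfd : ∀ μ, FiniteDimensional ℝ (V μ) := by
    intro μ
    by_cases h : μ = 0
    · rw [h, hV0]; infer_instance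
    · exact ContinuousLinearMap.finite_dimensional_eigenspace hc μ h
  have hof : OrthogonalFamily ℝ (fun μ => V μ) fun μ => (V μ).subtypeₗᵢ :=
    hs.orthogonalFamily_eigenspaces
  let b : ∀ μ, OrthonormalBasis (Fin (Module.finrank ℝ (V μ))) ℝ (V μ) :=
    fun μ => stdOrthonormalBasis ℝ (V μ)
  let v : (Σ μ : ℝ, Fin (Module.finrank ℝ (V μ))) → E := fun a => (b a.1 a.2 : E)
  have hv : Orthonormal ℝ v := hof.orthonormal_sigma_orthonormal fun μ => (b μ).orthonormal
  have hSv : ∀ a, S (v a) = a.1 • v a := fun a => Module.End.mem_eigenspace_iff.1 (b a.1 a.2).2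
  have hm : ∀ a : Σ μ : ℝ, Fin (Module.finrank ℝ (V μ)), 0 < a.1 := by
    intro a
    have h1 := hpos (v a) (hv.ne_zero a)
    rw [hSv, inner_smul_left, real_inner_self_eq_norm_sq, hv.1] at h1
    simpa using h1
  have hbot : (Submodule.span ℝ (range v))ᗮ = ⊥ := by
    rw [← ContinuousLinearMap.orthogonalComplement_iSup_eigenspaces_eq_bot hc hs]
    refine le_antisymm (Submodule.orthogonal_le (iSup_le fun μ => ?_))
      (Submodule.orthogonal_le (Submodule.span_le.2 ?_))
    · have h1 : (⊤ : Submodule ℝ (V μ)).map (V μ).subtype ≤ Submodule.span ℝ (range v) := by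
        rw [← (b μ).toBasis.span_eq, Submodule.map_span, Submodule.span_le]
        rintro _ ⟨_, ⟨i, rfl⟩, rfl⟩
        exact Submodule.subset_span ⟨⟨μ, i⟩, by simp [v]⟩
      simpa using h1
    · rintro _ ⟨a, rfl⟩
      exact Submodule.mem_iSup_of_mem a.1 (b a.1 a.2).2
  have : Infinite (Σ μ : ℝ, Fin (Module.finrank ℝ (V μ))) := by
    by_contra hfin
    rw [not_infinite_iff_finite] at hfin
    have h1 : FiniteDimensional ℝ (Submodule.span ℝ (range v)) :=
      FiniteDimensional.span_of_finite ℝ (finite_range v)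
    have h2 : Submodule.span ℝ (range v) = ⊤ := Submodule.orthogonal_eq_bot_iff.1 hbot
    rw [h2] at h1
    exact hE (Module.finite_def.2 (Module.Finite.iff_fg.1 h1))
  obtain ⟨e, he⟩ := exists_equiv_nat_antitone
    (fun a : Σ μ : ℝ, Fin (Module.finrank ℝ (V μ)) => a.1)
    fun a => finite_setOf_le_eigenvalue hc hv hSv (hm a)
  have hve : Orthonormal ℝ (v ∘ e) := hv.comp e e.injective
  refine ⟨fun i => (e i).1, HilbertBasis.mkOfOrthogonalEqBot hve ?_, he, fun i => hm (e i),
    fun i => ?_⟩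
  · rw [range_comp, e.range_eq_univ, image_univ, hbot]
  · rw [HilbertBasis.coe_mkOfOrthogonalEqBot]
    exact hSv (e i)

/-! ### The Poincaré inequality and the approximation by cell averages -/

section

variable {d : ℕ} {Ω : Set (EuclideanSpace ℝ (Fin d))}

/-- The Cauchy–Schwarz inequality for `g` and `1`. -/
theorem lintegral_sq_le_mul_lintegral_sq {X : Type*} [MeasurableSpace X] (μ : Measure X)
    {g : X → ℝ≥0∞} (hg : AEMeasurable g μ) :
    (∫⁻ x, g x ∂μ) ^ 2 ≤ μ univ * ∫⁻ x, g x ^ 2 ∂μ := by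
  have h := ENNReal.lintegral_mul_le_Lp_mul_Lq μ Real.HolderConjugate.two_two
    (f := fun _ => 1) (g := g) aemeasurable_const hg
  simp only [Pi.mul_apply, one_mul, lintegral_const, ENNReal.rpow_two, one_pow] at h
  calc _ ≤ ((μ univ) ^ (1 / 2 : ℝ) * (∫⁻ x, g x ^ 2 ∂μ) ^ (1 / 2 : ℝ)) ^ 2 := by gcongr
    _ = _ := by rw [mul_pow, rpow_half_sq, rpow_half_sq]

theorem enorm_sq_eq_lintegral {X F : Type*} [MeasurableSpace X] {μ : Measure X}
    [NormedAddCommGroup F] (p : Lp F 2 μ) : ‖p‖ₑ ^ 2 = ∫⁻ x, ‖p x‖ₑ ^ 2 ∂μ := by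
  rw [Lp.enorm_def, eLpNorm_eq_lintegral_rpow_enorm_toReal two_ne_zero ENNReal.ofNat_ne_top]
  simp only [ENNReal.toReal_ofNat, ENNReal.rpow_two]
  exact rpow_half_sq _

theorem continuous_gradient {ψ : EuclideanSpace ℝ (Fin d) → ℝ} (hψ : ContDiff ℝ ∞ ψ) :
    Continuous (gradient ψ) :=
  (LinearIsometryEquiv.continuous _).comp (hψ.continuous_fderiv (by simp))

/-- A function is close to its translates, with error controlled by the gradient. -/
theorem lintegral_translate_sub_sq_le {ψ : EuclideanSpace ℝ (Fin d) → ℝ} (hψ : ContDiff ℝ ∞ ψ)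
    (z : EuclideanSpace ℝ (Fin d)) :
    ∫⁻ x, ‖ψ (x + z) - ψ x‖ₑ ^ 2 ≤ ‖z‖ₑ ^ 2 * ∫⁻ x, ‖gradient ψ x‖ₑ ^ 2 := by
  have hc := continuous_gradient hψ
  have hpt : ∀ x, ‖ψ (x + z) - ψ x‖ₑ ^ 2
      ≤ ‖z‖ₑ ^ 2 * ∫⁻ s in Ioc (0 : ℝ) 1, ‖gradient ψ (x + s • z)‖ₑ ^ 2 := by
    intro x
    have hline : ∀ s : ℝ, HasDerivAt (fun s : ℝ => ψ (x + s • z))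
        (inner ℝ (gradient ψ (x + s • z)) z) s := by
      intro s
      have h1 : HasDerivAt (fun s : ℝ => x + s • z) z s := by
        simpa using ((hasDerivAt_id s).smul_const z).const_add x
      have h2 := ((hψ.differentiable (by simp)) (x + s • z)).hasGradientAt.hasFDerivAt
      rw [← InnerProductSpace.toDual_apply_apply (𝕜 := ℝ)]
      exact h2.comp_hasDerivAt s h1
    have hcs : Continuous fun s : ℝ => inner ℝ (gradient ψ (x + s • z)) z := by fun_prop
    have h3 := intervalIntegral.integral_eq_sub_of_hasDerivAt (fun s _ => hline s)
      (hcs.intervalIntegrable 0 1)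
    simp only [one_smul, zero_smul, add_zero] at h3
    rw [← h3, intervalIntegral.integral_of_le zero_le_one]
    calc _ ≤ (∫⁻ s in Ioc (0 : ℝ) 1, ‖z‖ₑ * ‖gradient ψ (x + s • z)‖ₑ) ^ 2 := by
          gcongr
          refine (enorm_integral_le_lintegral_enorm _).trans (lintegral_mono fun s => ?_)
          rw [mul_comm, ← ofReal_norm, ← ofReal_norm, ← ofReal_norm,
            ← ENNReal.ofReal_mul (norm_nonneg _)]
          exact ENNReal.ofReal_le_ofReal (norm_inner_le_norm _ _)
      _ = ‖z‖ₑ ^ 2 * (∫⁻ s in Ioc (0 : ℝ) 1, ‖gradient ψ (x + s • z)‖ₑ) ^ 2 := by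
          rw [lintegral_const_mul' _ _ (by simp), mul_pow]
      _ ≤ _ := by
          gcongr
          refine (lintegral_sq_le_mul_lintegral_sq _ ?_).trans (by simp)
          exact (hc.comp (by fun_prop : Continuous fun s : ℝ =>
            x + s • z)).measurable.enorm.aemeasurable
  calc _ ≤ ∫⁻ x, ‖z‖ₑ ^ 2 * ∫⁻ s in Ioc (0 : ℝ) 1, ‖gradient ψ (x + s • z)‖ₑ ^ 2 :=
        lintegral_mono hpt
    _ = ‖z‖ₑ ^ 2 * ∫⁻ x, ∫⁻ s in Ioc (0 : ℝ) 1, ‖gradient ψ (x + s • z)‖ₑ ^ 2 :=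
        lintegral_const_mul' _ _ (by simp)
    _ = ‖z‖ₑ ^ 2 * ∫⁻ s in Ioc (0 : ℝ) 1, ∫⁻ x, ‖gradient ψ (x + s • z)‖ₑ ^ 2 := by
        rw [lintegral_lintegral_swap]
        have : Continuous fun q : EuclideanSpace ℝ (Fin d) × ℝ => gradient ψ (q.1 + q.2 • z) := by
          fun_prop
        exact (this.measurable.enorm.pow_const 2).aemeasurable
    _ = _ := by
        simp only [lintegral_add_right_eq_self (μ := volume) fun x => ‖gradient ψ x‖ₑ ^ 2]
        simp

theorem gradient_eq_zero_of_notMem {ψ : EuclideanSpace ℝ (Fin d) → ℝ}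
    (hψ : tsupport ψ ⊆ Ω) {x : EuclideanSpace ℝ (Fin d)} (hx : x ∉ Ω) : gradient ψ x = 0 := by
  have h1 : ψ =ᶠ[nhds x] fun _ => 0 := notMem_tsupport_iff_eventuallyEq.1 fun h => hx (hψ h)
  rw [gradient, h1.fderiv_eq]
  simp

/-- The gradient of a test function has the same norm in `L²(ℝᵈ)` as in `L²(Ω)`. -/
theorem lintegral_gradient_sq_eq {ψ : EuclideanSpace ℝ (Fin d) → ℝ}
    (hs : tsupport ψ ⊆ Ω) {q : L2Vec Ω}
    (hq : q =ᵐ[volume.restrict Ω] gradient ψ) : ∫⁻ x, ‖gradient ψ x‖ₑ ^ 2 = ‖q‖ₑ ^ 2 := by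
  rw [enorm_sq_eq_lintegral, ← setLIntegral_eq_of_support_subset (s := Ω)]
  · exact lintegral_congr_ae (by filter_upwards [hq] with x hx; rw [hx])
  · intro x hx
    by_contra hxΩ
    exact hx (by simp [gradient_eq_zero_of_notMem hs hxΩ])

/-- The **Poincaré inequality** on `H¹₀(Ω)`. -/
theorem exists_poincare (hd : 1 ≤ d) (hΩo : IsOpen Ω) (hΩb : Bornology.IsBounded Ω) :
    ∃ C : ℝ, 0 < C ∧ ∀ p ∈ h10Graph Ω, ‖p.1‖ ≤ C * ‖p.2‖ := by
  obtain ⟨R, hR0, hR⟩ := hΩb.subset_ball_lt 0 0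
  refine ⟨2 * R, by positivity, fun p hp => ?_⟩
  refine closure_minimal (t := {p : L2 Ω × L2Vec Ω | ‖p.1‖ ≤ 2 * R * ‖p.2‖}) ?_ ?_ hp
  swap
  · exact isClosed_le (by fun_prop) (by fun_prop)
  rintro ⟨w, W⟩ ⟨ψ, h1, h2, h3, h4, h5⟩
  -- The translation by `z` moves `Ω` off itself, so that `ψ (x + z) - ψ x = -ψ x` on `Ω`.
  let z : EuclideanSpace ℝ (Fin d) := EuclideanSpace.single ⟨0, hd⟩ (2 * R)
  have hz : ‖z‖ = 2 * R := by
    rw [PiLp.norm_single, Real.norm_of_nonneg (by positivity)]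
  have hout : ∀ x ∈ Ω, ψ (x + z) = 0 := by
    intro x hx
    by_contra hne
    have h6 := hR (h3 (subset_tsupport _ hne))
    have h7 := hR hx
    rw [mem_ball_zero_iff] at h6 h7
    have h8 : ‖z‖ ≤ ‖x + z‖ + ‖x‖ := by
      simpa using norm_sub_le (x + z) x
    linarith
  have key : ‖w‖ₑ ^ 2 ≤ (‖z‖ₑ * ‖W‖ₑ) ^ 2 := by
    rw [mul_pow, ← lintegral_gradient_sq_eq h3 h5, enorm_sq_eq_lintegral]
    refine le_trans ?_ (lintegral_translate_sub_sq_le h1 z)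
    refine le_trans (le_of_eq ?_) (setLIntegral_le_lintegral Ω _)
    refine lintegral_congr_ae ?_
    filter_upwards [h4, ae_restrict_mem hΩo.measurableSet] with x hx hxΩ
    rw [hx, hout x hxΩ, zero_sub, enorm_neg]
  have h9 : ‖w‖ₑ ≤ ‖z‖ₑ * ‖W‖ₑ := (ENNReal.pow_le_pow_left_iff two_ne_zero).1 key
  rw [← ofReal_norm, ← ofReal_norm, ← ofReal_norm, ← ENNReal.ofReal_mul (norm_nonneg _),
    ENNReal.ofReal_le_ofReal_iff (by positivity), hz] at h9
  exact h9

/-- The half-open cell of the grid of mesh `h` with index `k`. -/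
def gridCell (h : ℝ) (k : Fin d → ℤ) : Set (EuclideanSpace ℝ (Fin d)) :=
  {x | ∀ i, ⌊x i / h⌋ = k i}

theorem volume_setOf_forall_mem (s : Fin d → Set ℝ) :
    volume {x : EuclideanSpace ℝ (Fin d) | ∀ i, x i ∈ s i} = ∏ i, volume (s i) := by
  rw [← volume_pi_pi, ← (EuclideanSpace.volume_preserving_symm_measurableEquiv_toLp
    (Fin d)).measure_preimage_equiv]
  congr 1
  ext x
  simp

theorem gridCell_eq {h : ℝ} (hh : 0 < h) (k : Fin d → ℤ) :
    gridCell h k = {x | ∀ i, x i ∈ Ico (k i * h) ((k i + 1) * h)} := by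
  ext x
  refine forall_congr' fun i => ?_
  rw [Int.floor_eq_iff, le_div_iff₀ hh, div_lt_iff₀ hh, mem_Ico]

theorem volume_gridCell {h : ℝ} (hh : 0 < h) (k : Fin d → ℤ) :
    volume (gridCell h k) = ENNReal.ofReal h ^ d := by
  rw [gridCell_eq hh, volume_setOf_forall_mem]
  simp [Real.volume_Ico, add_mul]

theorem measurableSet_gridCell (h : ℝ) (k : Fin d → ℤ) : MeasurableSet (gridCell h k) := by
  rw [gridCell, ofPred_forall]
  refine MeasurableSet.iInter fun i => ?_
  have : Measurable fun x : EuclideanSpace ℝ (Fin d) => ⌊x i / h⌋ := by fun_prop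
  exact this (measurableSet_singleton _)

/-- The average over the cell of the grid containing `x`. -/
noncomputable def cellAverage (h : ℝ) (ψ : EuclideanSpace ℝ (Fin d) → ℝ)
    (x : EuclideanSpace ℝ (Fin d)) : ℝ :=
  (h ^ d)⁻¹ * ∫ y in gridCell h (fun i => ⌊x i / h⌋), ψ y

/-- A smooth function with compact support is close to its cell averages. -/
theorem lintegral_sub_cellAverage_sq_le {h : ℝ} (hh : 0 < h)
    {ψ : EuclideanSpace ℝ (Fin d) → ℝ} (hψ : ContDiff ℝ ∞ ψ) (hc : HasCompactSupport ψ) :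
    ∫⁻ x, ‖ψ x - cellAverage h ψ x‖ₑ ^ 2
      ≤ ENNReal.ofReal (2 ^ d * d * h ^ 2) * ∫⁻ x, ‖gradient ψ x‖ₑ ^ 2 := by
  have hcont := hψ.continuous
  -- The difference of two points of one cell lies in the cube `Z`, whose volume is `2 ^ d` times
  -- that of a cell; so the deviation from the average is an average of differences of translates.
  let Z : Set (EuclideanSpace ℝ (Fin d)) := {z | ∀ i, z i ∈ Ioo (-h) h}
  have hZm : MeasurableSet Z := by
    simp only [Z, ofPred_forall]
    refine MeasurableSet.iInter fun i => ?_
    have : Measurable fun x : EuclideanSpace ℝ (Fin d) => x i := by fun_prop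
    exact this measurableSet_Ioo
  have hZv : volume Z = 2 ^ d * ENNReal.ofReal h ^ d := by
    rw [volume_setOf_forall_mem]
    simp only [Real.volume_Ioo, Finset.prod_const, Finset.card_univ, Fintype.card_fin]
    rw [← mul_pow, (by ring : h - -h = 2 * h),
      ENNReal.ofReal_mul (by norm_num)]
    simp
  have hZn : ∀ z ∈ Z, ‖z‖ₑ ^ 2 ≤ ENNReal.ofReal (d * h ^ 2) := by
    intro z hz
    rw [← ofReal_norm, ← ENNReal.ofReal_pow (norm_nonneg _), EuclideanSpace.real_norm_sq_eq]
    refine ENNReal.ofReal_le_ofReal ?_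
    calc ∑ i, z i ^ 2 ≤ ∑ _i : Fin d, h ^ 2 := Finset.sum_le_sum fun i _ => by
          have := hz i
          exact sq_le_sq' this.1.le this.2.le
      _ = _ := by simp
  set c : ℝ≥0∞ := ENNReal.ofReal h ^ d with hcdef
  have hc0 : c ≠ 0 := pow_ne_zero _ (by simpa using hh)
  have hct : c ≠ ⊤ := ENNReal.pow_ne_top ENNReal.ofReal_ne_top
  have hpt : ∀ x, ‖ψ x - cellAverage h ψ x‖ₑ ^ 2
      ≤ c⁻¹ * ∫⁻ z in Z, ‖ψ (x + z) - ψ x‖ₑ ^ 2 := by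
    intro x
    set Q := gridCell h (fun i => ⌊x i / h⌋) with hQ
    have hQv : volume Q = c := volume_gridCell hh _
    have hQr : volume.real Q = h ^ d := by
      rw [Measure.real, hQv, ENNReal.toReal_pow, ENNReal.toReal_ofReal hh.le]
    have hint : Integrable ψ (volume.restrict Q) :=
      (hcont.integrable_of_hasCompactSupport hc).restrict
    have hrew : ψ x - cellAverage h ψ x = (h ^ d)⁻¹ * ∫ y in Q, (ψ x - ψ y) := by
      have hfin : IsFiniteMeasure (volume.restrict Q) :=
        ⟨by rw [Measure.restrict_apply_univ, hQv]; exact hct.lt_top⟩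
      rw [integral_sub (integrable_const _) hint, setIntegral_const, hQr, cellAverage, mul_sub,
        smul_eq_mul, inv_mul_cancel_left₀ (pow_pos hh d).ne']
    have hsub : ∀ y ∈ Q, y - x ∈ Z := by
      intro y hy i
      have h1 := hy i
      have h2 := Int.abs_sub_lt_one_of_floor_eq_floor h1
      rw [← sub_div, abs_div, abs_of_pos hh, div_lt_one hh, abs_lt] at h2
      exact h2
    have hcinv : ‖(h ^ d)⁻¹‖ₑ = c⁻¹ := by
      rw [← ofReal_norm, Real.norm_of_nonneg (by positivity), ENNReal.ofReal_inv_of_pos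
        (by positivity), ENNReal.ofReal_pow hh.le]
    calc ‖ψ x - cellAverage h ψ x‖ₑ ^ 2 = c⁻¹ ^ 2 * ‖∫ y in Q, (ψ x - ψ y)‖ₑ ^ 2 := by
          rw [hrew, enorm_mul, mul_pow, hcinv]
      _ ≤ c⁻¹ ^ 2 * (∫⁻ y in Q, ‖ψ x - ψ y‖ₑ) ^ 2 := by
          gcongr
          exact enorm_integral_le_lintegral_enorm _
      _ ≤ c⁻¹ ^ 2 * (c * ∫⁻ y in Q, ‖ψ x - ψ y‖ₑ ^ 2) := by
          gcongr
          refine (lintegral_sq_le_mul_lintegral_sq _ (by fun_prop)).trans ?_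
          rw [Measure.restrict_apply_univ, hQv]
      _ = c⁻¹ * ∫⁻ y in Q, ‖ψ x - ψ y‖ₑ ^ 2 := by
          rw [sq, mul_assoc, ← mul_assoc c⁻¹ c, ENNReal.inv_mul_cancel hc0 hct, one_mul]
      _ ≤ c⁻¹ * ∫⁻ z in Z, ‖ψ (x + z) - ψ x‖ₑ ^ 2 := by
          refine mul_le_mul_right ?_ _
          rw [← lintegral_indicator (measurableSet_gridCell _ _), ← lintegral_indicator hZm,
            ← lintegral_add_left_eq_self _ x]
          refine lintegral_mono fun z => ?_
          by_cases hz : x + z ∈ Q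
          · have := hsub _ hz
            rw [add_sub_cancel_left] at this
            rw [indicator_of_mem hz, indicator_of_mem this, enorm_sub_rev]
          · rw [indicator_of_notMem hz]
            exact zero_le
  calc _ ≤ ∫⁻ x, c⁻¹ * ∫⁻ z in Z, ‖ψ (x + z) - ψ x‖ₑ ^ 2 := lintegral_mono hpt
    _ = c⁻¹ * ∫⁻ x, ∫⁻ z in Z, ‖ψ (x + z) - ψ x‖ₑ ^ 2 :=
        lintegral_const_mul' _ _ (ENNReal.inv_ne_top.2 hc0)
    _ = c⁻¹ * ∫⁻ z in Z, ∫⁻ x, ‖ψ (x + z) - ψ x‖ₑ ^ 2 := by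
        rw [lintegral_lintegral_swap]
        have : Continuous fun q : EuclideanSpace ℝ (Fin d) × EuclideanSpace ℝ (Fin d) =>
            ψ (q.1 + q.2) - ψ q.1 := by fun_prop
        exact (this.measurable.enorm.pow_const 2).aemeasurable
    _ ≤ c⁻¹ * ∫⁻ z in Z, ENNReal.ofReal (d * h ^ 2) * ∫⁻ x, ‖gradient ψ x‖ₑ ^ 2 := by
        refine mul_le_mul_right ?_ _
        refine setLIntegral_mono' hZm fun z hz => ?_
        refine (lintegral_translate_sub_sq_le hψ z).trans ?_
        gcongr
        exact hZn z hz
    _ = (c⁻¹ * c) * (2 ^ d * ENNReal.ofReal (d * h ^ 2)) * ∫⁻ x, ‖gradient ψ x‖ₑ ^ 2 := by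
        rw [setLIntegral_const, hZv]
        ring
    _ = _ := by
        rw [ENNReal.inv_mul_cancel hc0 hct, one_mul, mul_assoc (2 ^ d : ℝ),
          ENNReal.ofReal_mul (p := 2 ^ d) (by positivity), ENNReal.ofReal_pow (by norm_num),
          ENNReal.ofReal_ofNat]

end

/-! ### The Dirichlet eigenbasis -/

section

variable {d : ℕ} {Ω : Set (EuclideanSpace ℝ (Fin d))}

theorem coeFn_finsetSum {X ι : Type*} [MeasurableSpace X] {μ : Measure X} (s : Finset ι)
    (f : ι → Lp ℝ 2 μ) : (∑ k ∈ s, f k : Lp ℝ 2 μ) =ᵐ[μ] fun x => ∑ k ∈ s, f k x := by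
  classical
  induction s using Finset.induction_on with
  | empty => simpa using! Lp.coeFn_zero ℝ 2 μ
  | insert a s ha ih =>
    rw [Finset.sum_insert ha]
    filter_upwards [Lp.coeFn_add (f a) (∑ k ∈ s, f k), ih] with x h1 h2
    rw [h1, Pi.add_apply, h2, Finset.sum_insert ha]

/-- Up to an arbitrarily small multiple of the norm of the gradient, functions in `H¹₀(Ω)` are
reproduced by an operator of finite rank, the averaging over the cells of a grid. -/
theorem exists_average_operator (hΩo : IsOpen Ω) (hΩb : Bornology.IsBounded Ω) {h : ℝ}
    (hh : 0 < h) : ∃ F : L2 Ω →L[ℝ] L2 Ω, IsCompactOperator F ∧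
      ∀ p ∈ h10Graph Ω, ‖p.1 - F p.1‖ ≤ √(2 ^ d * d * h ^ 2) * ‖p.2‖ := by
  classical
  obtain ⟨R, hR0, hR⟩ := hΩb.subset_ball_lt 0 0
  -- Only finitely many cells meet `Ω`.
  have hfin : {k : Fin d → ℤ | ∃ x ∈ Ω, k = fun i => ⌊x i / h⌋}.Finite := by
    refine (Finite.pi' fun _ : Fin d => finite_Icc ⌊-R / h⌋ ⌊R / h⌋).subset ?_
    rintro _ ⟨x, hx, rfl⟩ i
    have h1 : |x i| ≤ R := by
      have h2 := hR hx
      rw [mem_ball_zero_iff] at h2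
      exact (PiLp.norm_apply_le x i).trans h2.le
    rw [abs_le] at h1
    exact ⟨Int.floor_le_floor (by gcongr; exact h1.1), Int.floor_le_floor (by gcongr; exact h1.2)⟩
  let N := hfin.toFinset
  have hcell : ∀ k : Fin d → ℤ, (volume.restrict Ω) (gridCell h k) ≠ ⊤ := fun k =>
    ne_top_of_le_ne_top (by rw [volume_gridCell hh]; finiteness)
      (Measure.restrict_apply_le Ω (gridCell h k))
  let g : (Fin d → ℤ) → L2 Ω := fun k =>
    indicatorConstLp 2 (measurableSet_gridCell h k) (hcell k) (1 : ℝ)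
  let F : L2 Ω →L[ℝ] L2 Ω :=
    ∑ k ∈ N, (h ^ d)⁻¹ • (ContinuousLinearMap.toSpanSingleton ℝ (g k)).comp (innerSL ℝ (g k))
  refine ⟨F, ?_, fun p hp => ?_⟩
  · refine (compactOperator (RingHom.id ℝ) (L2 Ω) (L2 Ω)).sum_mem fun k _ => ?_
    refine (compactOperator (RingHom.id ℝ) (L2 Ω) (L2 Ω)).smul_mem _ ?_
    exact (isCompactOperator_of_locallyCompactSpace_dom (innerSL ℝ (g k))).clm_comp
      (ContinuousLinearMap.toSpanSingleton ℝ (g k))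
  refine closure_minimal (t := {p : L2 Ω × L2Vec Ω |
    ‖p.1 - F p.1‖ ≤ √(2 ^ d * d * h ^ 2) * ‖p.2‖}) ?_ ?_ hp
  swap
  · exact isClosed_le (by fun_prop) (by fun_prop)
  rintro ⟨w, W⟩ ⟨ψ, h1, h2, h3, h4, h5⟩
  have hψ0 : ∀ x ∉ Ω, ψ x = 0 := fun x hx => image_eq_zero_of_notMem_tsupport fun h => hx (h3 h)
  have hinner : ∀ k, inner ℝ (g k) w = ∫ y in gridCell h k, ψ y := by
    intro k
    rw [L2.inner_indicatorConstLp_one, integral_congr_ae (g := ψ) (ae_restrict_of_ae h4),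
      Measure.restrict_comm (measurableSet_gridCell h k)]
    exact setIntegral_eq_integral_of_forall_compl_eq_zero hψ0
  have hF : F w = ∑ k ∈ N, ((h ^ d)⁻¹ * ∫ y in gridCell h k, ψ y) • g k := by
    simp only [F, sum_apply]
    refine Finset.sum_congr rfl fun k _ => ?_
    simp [hinner, smul_smul]
  have hFae : ∀ᵐ x ∂volume.restrict Ω, F w x = cellAverage h ψ x := by
    have h6 : ∀ᵐ x ∂volume.restrict Ω, ∀ k ∈ N,
        (((h ^ d)⁻¹ * ∫ y in gridCell h k, ψ y) • g k : L2 Ω) x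
          = ((h ^ d)⁻¹ * ∫ y in gridCell h k, ψ y) * (gridCell h k).indicator (fun _ => 1) x := by
      rw [Filter.eventually_all_finset]
      intro k _
      filter_upwards [Lp.coeFn_smul ((h ^ d)⁻¹ * ∫ y in gridCell h k, ψ y) (g k),
        indicatorConstLp_coeFn (p := 2) (hs := measurableSet_gridCell h k) (hμs := hcell k)
          (c := (1 : ℝ))] with x e1 e2
      rw [e1, Pi.smul_apply, e2, smul_eq_mul]
    rw [hF]
    filter_upwards [coeFn_finsetSum N fun k => ((h ^ d)⁻¹ * ∫ y in gridCell h k, ψ y) • g k, h6,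
      ae_restrict_mem hΩo.measurableSet] with x e1 e2 hx
    rw [e1, Finset.sum_congr rfl e2, Finset.sum_eq_single fun i => ⌊x i / h⌋]
    · rw [indicator_of_mem (show x ∈ gridCell h _ from fun i => rfl), mul_one, cellAverage]
    · intro k _ hk
      rw [indicator_of_notMem, mul_zero]
      exact fun hmem => hk (funext fun i => (hmem i).symm)
    · intro hnot
      exact absurd (hfin.mem_toFinset.2 ⟨x, hx, rfl⟩) hnot
  have key : ‖w - F w‖ₑ ^ 2 ≤ ENNReal.ofReal (2 ^ d * d * h ^ 2) * ‖W‖ₑ ^ 2 := by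
    rw [← lintegral_gradient_sq_eq h3 h5, enorm_sq_eq_lintegral]
    refine le_trans ?_ (lintegral_sub_cellAverage_sq_le hh h1 h2)
    refine le_trans (le_of_eq ?_) (setLIntegral_le_lintegral Ω _)
    refine lintegral_congr_ae ?_
    filter_upwards [h4, hFae, Lp.coeFn_sub w (F w)] with x e1 e2 e3
    rw [e3, Pi.sub_apply, e1, e2]
  have key' : ‖w - F w‖ ^ 2 ≤ (√(2 ^ d * d * h ^ 2) * ‖W‖) ^ 2 := by
    rw [← ofReal_norm, ← ofReal_norm, ← ENNReal.ofReal_pow (norm_nonneg _),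
      ← ENNReal.ofReal_pow (norm_nonneg _), ← ENNReal.ofReal_mul (by positivity),
      ENNReal.ofReal_le_ofReal_iff (by positivity)] at key
    rwa [mul_pow, Real.sq_sqrt (by positivity)]
  exact le_of_sq_le_sq key' (by positivity)

/-- The graph of the gradient on `H¹₀(Ω)` with the norm `(‖w‖² + ‖∇w‖²)^{1/2}`, that is, the Hilbert
space `H¹₀(Ω)`. -/
noncomputable def h10Space (Ω : Set (EuclideanSpace ℝ (Fin d))) :
    Submodule ℝ (WithLp 2 (L2 Ω × L2Vec Ω)) :=
  (h10Submodule Ω).comap (WithLp.linearEquiv 2 ℝ (L2 Ω × L2Vec Ω)).toLinearMap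

theorem mem_h10Space {p : WithLp 2 (L2 Ω × L2Vec Ω)} : p ∈ h10Space Ω ↔ p.ofLp ∈ h10Graph Ω :=
  Iff.rfl

instance completeSpace_h10Space : CompleteSpace (h10Space Ω) := by
  refine IsClosed.completeSpace_coe (hs := ?_)
  exact isClosed_h10Graph.preimage (WithLp.prod_continuous_ofLp 2 _ _)

/-- The inclusion of `H¹₀(Ω)` in `L²(Ω)`. -/
noncomputable def h10Incl (Ω : Set (EuclideanSpace ℝ (Fin d))) : h10Space Ω →L[ℝ] L2 Ω :=
  (WithLp.fstL 2 ℝ (L2 Ω) (L2Vec Ω)).comp (h10Space Ω).subtypeL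

/-- **Rellich's theorem**: the inclusion of `H¹₀(Ω)` in `L²(Ω)` is compact, as the limit in norm of
operators of finite rank. -/
theorem isCompactOperator_h10Incl (hΩo : IsOpen Ω) (hΩb : Bornology.IsBounded Ω) :
    IsCompactOperator (h10Incl Ω) := by
  have hpos : ∀ n : ℕ, (0 : ℝ) < 1 / ((n : ℝ) + 1) := fun n => by positivity
  choose F hFc hF using fun n : ℕ => exists_average_operator hΩo hΩb (hpos n)
  refine isCompactOperator_of_tendsto (l := Filter.atTop)
    (F := fun n => (F n).comp (h10Incl Ω)) ?_
    (Filter.Eventually.of_forall fun n => (hFc n).comp_clm (h10Incl Ω))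
  refine (tendsto_iff_norm_sub_tendsto_zero (E := h10Space Ω →L[ℝ] L2 Ω)).2 ?_
  have hlim : Filter.Tendsto (fun n : ℕ => √(2 ^ d * d * (1 / ((n : ℝ) + 1)) ^ 2))
      Filter.atTop (nhds 0) := by
    have h1 := ((tendsto_one_div_add_atTop_nhds_zero_nat (𝕜 := ℝ)).pow 2).const_mul
      ((2 : ℝ) ^ d * d)
    simpa using h1.sqrt
  refine squeeze_zero (fun n => ContinuousLinearMap.opNorm_nonneg _) (fun n => ?_) hlim
  refine ContinuousLinearMap.opNorm_le_bound _ (Real.sqrt_nonneg _) fun w => ?_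
  have h1 := hF n w.1.ofLp w.2
  have h2 : ‖w.1.ofLp.2‖ ≤ ‖w‖ := by
    refine le_of_sq_le_sq ?_ (norm_nonneg _)
    rw [Submodule.coe_norm, WithLp.prod_norm_sq_eq_of_L2]
    exact le_add_of_nonneg_left (sq_nonneg _)
  calc _ = ‖w.1.ofLp.1 - F n w.1.ofLp.1‖ := by
        rw [norm_sub_rev]
        rfl
    _ ≤ _ := h1.trans (by gcongr)

theorem exists_mem_testGraph {ψ : EuclideanSpace ℝ (Fin d) → ℝ} (h1 : ContDiff ℝ ∞ ψ)
    (h2 : HasCompactSupport ψ) (h3 : tsupport ψ ⊆ Ω) :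
    ∃ p ∈ testGraph Ω, p.1 =ᵐ[volume.restrict Ω] ψ := by
  have hm : MemLp ψ 2 (volume.restrict Ω) :=
    (h1.continuous.memLp_of_hasCompactSupport h2).restrict Ω
  have hs : HasCompactSupport (gradient ψ) :=
    h2.mono' fun x hx => by
      by_contra hnot
      exact hx (gradient_eq_zero_of_notMem (Ω := tsupport ψ) subset_rfl hnot)
  have hg : MemLp (gradient ψ) 2 (volume.restrict Ω) :=
    ((continuous_gradient h1).memLp_of_hasCompactSupport hs).restrict Ω
  exact ⟨(hm.toLp ψ, hg.toLp _), ⟨ψ, h1, h2, h3, hm.coeFn_toLp, hg.coeFn_toLp⟩, hm.coeFn_toLp⟩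

/-- Test functions are dense in `L²(Ω)`. -/
theorem eq_zero_of_forall_inner_h10Graph (hΩo : IsOpen Ω) (hΩb : Bornology.IsBounded Ω) {y : L2 Ω}
    (hy : ∀ p ∈ h10Graph Ω, inner ℝ y p.1 = 0) : y = 0 := by
  have hfin : IsFiniteMeasure (volume.restrict Ω) :=
    ⟨by rw [Measure.restrict_apply_univ]; exact hΩb.measure_lt_top⟩
  have hint : Integrable y (volume.restrict Ω) := (Lp.memLp y).integrable one_le_two
  have h0 := hΩo.ae_eq_zero_of_integral_contDiff_smul_eq_zero (μ := volume.restrict Ω) (f := y)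
    (hint.locallyIntegrable.locallyIntegrableOn Ω) fun ψ h1 h2 h3 => by
      obtain ⟨p, hp, hpψ⟩ := exists_mem_testGraph h1 h2 h3
      rw [← hy p (subset_closure hp), L2.inner_def]
      refine integral_congr_ae ?_
      filter_upwards [hpψ] with x hx
      rw [hx]
      simp
  refine Lp.ext ?_
  filter_upwards [h0, ae_restrict_mem hΩo.measurableSet, Lp.coeFn_zero ℝ 2 (volume.restrict Ω)]
    with x e1 e2 e3
  rw [e1 e2, e3, Pi.zero_apply]

/-- `L²(Ω)` is infinite dimensional, since `Ω` holds infinitely many disjoint nonempty open sets. -/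
theorem not_finiteDimensional_L2 (hd : 1 ≤ d) (hΩo : IsOpen Ω) (hΩb : Bornology.IsBounded Ω)
    (hΩn : Ω.Nonempty) : ¬ FiniteDimensional ℝ (L2 Ω) := by
  intro hfd
  have : Nonempty (Fin d) := ⟨⟨0, hd⟩⟩
  have : Nontrivial (EuclideanSpace ℝ (Fin d)) := inferInstance
  obtain ⟨x₀, hx₀⟩ := hΩn
  have : Infinite Ω := (infinite_of_mem_nhds x₀ (hΩo.mem_nhds hx₀)).to_subtype
  obtain ⟨U, hUi, hUo, hUd⟩ := exists_seq_infinite_isOpen_pairwise_disjoint Ω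
  let S : ℕ → Set (EuclideanSpace ℝ (Fin d)) := fun n => Subtype.val '' U n
  have hSo : ∀ n, IsOpen (S n) := fun n => hΩo.isOpenMap_subtype_val _ (hUo n)
  have hSΩ : ∀ n, S n ⊆ Ω := fun n => by
    rintro _ ⟨x, -, rfl⟩
    exact x.2
  have hSv : ∀ n, (volume.restrict Ω) (S n) ≠ ⊤ := fun n => by
    rw [Measure.restrict_apply (hSo n).measurableSet]
    exact (hΩb.subset inter_subset_right).measure_lt_top.ne
  let g : ℕ → L2 Ω := fun n => indicatorConstLp 2 (hSo n).measurableSet (hSv n) (1 : ℝ)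
  have hinner : ∀ n m, inner ℝ (g n) (g m) = (volume.restrict Ω).real (S n ∩ S m) := by
    intro n m
    simp only [g]
    rw [L2.inner_indicatorConstLp_indicatorConstLp _ _ (hSv n) (hSv m)]
    simp
  have hli : LinearIndependent ℝ g := by
    refine linearIndependent_of_ne_zero_of_inner_eq_zero (fun n h0 => ?_) fun n m hnm => ?_
    · have h1 := hinner n n
      rw [h0, inner_zero_left, inter_self, eq_comm, measureReal_eq_zero_iff (hSv n),
        Measure.restrict_apply (hSo n).measurableSet, inter_eq_left.2 (hSΩ n)] at h1
      exact ((hSo n).measure_pos volume ((hUi n).nonempty.image _)).ne' h1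
    · change inner ℝ (g n) (g m) = 0
      rw [hinner, ((disjoint_image_iff Subtype.val_injective).2 (hUd hnm)).inter_eq]
      simp
  have : Finite ℕ := hli.finite
  exact _root_.not_finite ℕ

/-- The Dirichlet eigenvalues of `-KΔ` are bounded below by the Poincaré constant. -/
theorem IsDirichletEigenbasis.le {K C : ℝ} (hK : 0 < K) (hC : 0 < C)
    (hP : ∀ p ∈ h10Graph Ω, ‖p.1‖ ≤ C * ‖p.2‖) {lam : ℕ → ℝ} {φ : HilbertBasis ℕ ℝ (L2 Ω)}
    (h : IsDirichletEigenbasis Ω K lam φ) (i : ℕ) : √K / C ≤ lam i := by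
  obtain ⟨G, hG, hGe⟩ := h.eigen i
  have h1 := hGe _ hG
  have h2 := hP _ hG
  simp only [real_inner_self_eq_norm_sq, φ.orthonormal.1 i] at h1 h2
  refine le_of_sq_le_sq ?_ (h.pos i).le
  rw [div_pow, Real.sq_sqrt hK.le, div_le_iff₀ (by positivity)]
  have h3 : 1 ≤ (C * ‖G‖) ^ 2 := one_le_pow₀ h2
  nlinarith

/-- For `J` the inclusion of `H¹₀(Ω)` in `L²(Ω)`, an eigenvector `J J* φ = μ φ` satisfies
`(φ, w) + (∇φ, ∇w) = μ⁻¹ (φ, w)` for `w ∈ H¹₀(Ω)`, hence is a Dirichlet eigenfunction of `-KΔ` with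
eigenvalue `K (μ⁻¹ - 1)`. This is positive by the Poincaré inequality, and it increases as `μ`
decreases. -/
theorem exists_isDirichletEigenbasis (hd : 1 ≤ d) (hΩo : IsOpen Ω)
    (hΩb : Bornology.IsBounded Ω) (hΩn : Ω.Nonempty) {K : ℝ} (hK : 0 < K) :
    ∃ (lam : ℕ → ℝ) (φ : HilbertBasis ℕ ℝ (L2 Ω)), IsDirichletEigenbasis Ω K lam φ := by
  obtain ⟨C, hC, hP⟩ := exists_poincare hd hΩo hΩb
  set J := h10Incl Ω with hJ
  let A := ContinuousLinearMap.adjoint J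
  have hAin : ∀ (y : L2 Ω) (w : h10Space Ω), inner ℝ (A y) w = inner ℝ y (J w) := fun y w =>
    ContinuousLinearMap.adjoint_inner_left J w y
  have hc : IsCompactOperator (J.comp A) := (isCompactOperator_h10Incl hΩo hΩb).comp_clm A
  have hin : ∀ x y, inner ℝ (J.comp A x) y = inner ℝ (A x) (A y) := fun x y =>
    (real_inner_comm _ _).trans ((hAin y (A x)).symm.trans (real_inner_comm _ _))
  have hs : (J.comp A).IsSymmetric := fun x y => by
    have h1 := hin x y
    have h2 := hin y x
    rw [real_inner_comm] at h2
    exact h1.trans ((real_inner_comm _ _).trans h2.symm)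
  have hpos : ∀ x ≠ 0, 0 < inner ℝ (J.comp A x) x := by
    intro x hx
    rw [hin, real_inner_self_eq_norm_sq]
    refine pow_pos (norm_pos_iff.2 fun h0 => hx ?_) 2
    refine eq_zero_of_forall_inner_h10Graph hΩo hΩb fun p hp => ?_
    have h1 := hAin x ⟨WithLp.toLp 2 p, mem_h10Space.2 hp⟩
    rw [h0, inner_zero_left] at h1
    exact h1.symm
  obtain ⟨μ, φ, hμ, hμ0, hφ⟩ := exists_antitone_eigenbasis
    (not_finiteDimensional_L2 hd hΩo hΩb hΩn) hc hs hpos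
  -- `g i` is `φ i` as an element of `H¹₀(Ω)`, that is, together with its gradient.
  let g : ℕ → h10Space Ω := fun i => (μ i)⁻¹ • A (φ i)
  have hg1 : ∀ i, (g i).1.ofLp.1 = φ i := fun i => by
    have h1 : J (g i) = φ i := by
      have h2 : J (A (φ i)) = μ i • φ i := hφ i
      rw [map_smul, h2, smul_smul, inv_mul_cancel₀ (hμ0 i).ne', one_smul]
    exact h1
  have hweak : ∀ i, ∀ p ∈ h10Graph Ω, inner ℝ (g i).1.ofLp.2 p.2
      = ((μ i)⁻¹ - 1) * inner ℝ (φ i) p.1 := by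
    intro i p hp
    have h1 : inner ℝ (g i) (⟨WithLp.toLp 2 p, mem_h10Space.2 hp⟩ : h10Space Ω)
        = (μ i)⁻¹ * inner ℝ (φ i) p.1 :=
      (real_inner_smul_left (A (φ i)) _ _).trans (congrArg ((μ i)⁻¹ * ·) (hAin (φ i) _))
    rw [Submodule.coe_inner, WithLp.prod_inner_apply, hg1] at h1
    linear_combination h1
  have hgm : ∀ i, (φ i, (g i).1.ofLp.2) ∈ h10Graph Ω := fun i => by
    rw [← hg1]
    exact (g i).2
  have hval : ∀ i, 0 < (μ i)⁻¹ - 1 := by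
    intro i
    have h1 := hweak i _ (hgm i)
    have h2 := hP _ (hgm i)
    simp only [real_inner_self_eq_norm_sq, φ.orthonormal.1 i] at h1 h2
    have h3 : 0 < ‖(g i).1.ofLp.2‖ := by
      by_contra! hle
      nlinarith
    nlinarith [pow_pos h3 2]
  refine ⟨fun i => √(K * ((μ i)⁻¹ - 1)), φ, fun i => Real.sqrt_pos.2 (mul_pos hK (hval i)),
    fun i j hij => ?_, fun i => ⟨(g i).1.ofLp.2, hgm i, fun p hp => ?_⟩⟩
  · refine Real.sqrt_le_sqrt (mul_le_mul_of_nonneg_left ?_ hK.le)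
    have := inv_anti₀ (hμ0 j) (hμ hij)
    linarith
  · rw [hweak i p hp, Real.sq_sqrt (mul_pos hK (hval i)).le, mul_assoc]

end

end VOWave

theorem mainTheorem2 {d : ℕ} (hd : 1 ≤ d) (Ω : Set (EuclideanSpace ℝ (Fin d)))
    (hΩo : IsOpen Ω) (hΩb : Bornology.IsBounded Ω) (hΩn : Ω.Nonempty)
    (K : ℝ) (hK : 0 < K) :
    (∃ (lam : ℕ → ℝ) (φ : HilbertBasis ℕ ℝ (VOWave.L2 Ω)),
      VOWave.IsDirichletEigenbasis Ω K lam φ) ∧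
    ∀ (T αs B : ℝ), 0 < T → ∃ Q : ℝ, 0 < Q ∧
      ∀ (lam : ℕ → ℝ) (φ : HilbertBasis ℕ ℝ (VOWave.L2 Ω)),
        VOWave.IsDirichletEigenbasis Ω K lam φ →
      ∀ α : ℝ → ℝ, VOWave.AssumptionA T αs B α →
      ∀ (f : ℝ → VOWave.L2 Ω) (u₀ u₁ : VOWave.L2 Ω),
        VOWave.normHL2 T 0 f < ⊤ → VOWave.hNorm lam φ 1 u₀ < ⊤ →
        ∃ u : ℝ → VOWave.L2 Ω,
          VOWave.IsSolution Ω K T α f u₀ u₁ u ∧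
          (∀ v : ℝ → VOWave.L2 Ω, VOWave.IsSolution Ω K T α f u₀ u₁ v →
            v =ᵐ[VOWave.timeMeasure T] u) ∧
          VOWave.normHL2 T 1 u ≤
            ENNReal.ofReal Q * (VOWave.hNorm lam φ 1 u₀ + ‖u₁‖ₑ + VOWave.normHL2 T 0 f) ∧
          (VOWave.normHL2 T 1 f < ⊤ → VOWave.normHH lam φ T 0 1 f < ⊤ →
            VOWave.hNorm lam φ 2 u₀ < ⊤ → VOWave.hNorm lam φ 1 u₁ < ⊤ →
            VOWave.normHL2 T 2 u + VOWave.normHH lam φ T 0 2 u ≤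
              ENNReal.ofReal Q * (VOWave.hNorm lam φ 2 u₀ + VOWave.hNorm lam φ 1 u₁
                + VOWave.normHL2 T 1 f + VOWave.normHH lam φ T 0 1 f)) ∧
          (VOWave.normHH lam φ T 1 1 f < ⊤ → VOWave.normHH lam φ T 0 2 f < ⊤ →
            VOWave.hNorm lam φ 3 u₀ < ⊤ → VOWave.hNorm lam φ 2 u₁ < ⊤ →
            VOWave.normHL2 T 3 u + VOWave.normHH lam φ T 1 2 u ≤
              ENNReal.ofReal Q * (VOWave.hNorm lam φ 3 u₀ + VOWave.hNorm lam φ 2 u₁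
                + VOWave.normHH lam φ T 1 1 f + VOWave.normHH lam φ T 0 2 f)) ∧
          (VOWave.normHH lam φ T 2 2 f < ⊤ → VOWave.normHH lam φ T 0 3 f < ⊤ →
            VOWave.hNorm lam φ 4 u₀ < ⊤ → VOWave.hNorm lam φ 3 u₁ < ⊤ →
            VOWave.normHL2 T 4 u + VOWave.normHH lam φ T 2 2 u ≤
              ENNReal.ofReal Q * (VOWave.hNorm lam φ 4 u₀ + VOWave.hNorm lam φ 3 u₁
                + VOWave.normHH lam φ T 2 2 f + VOWave.normHH lam φ T 0 3 f)) := by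
  refine ⟨VOWave.exists_isDirichletEigenbasis hd hΩo hΩb hΩn hK, fun T αs B hT => ?_⟩
  obtain ⟨M, hM, hker⟩ := VOWave.exists_kernel_primitive hT αs B
  obtain ⟨C, hC, hP⟩ := VOWave.exists_poincare hd hΩo hΩb
  -- a lower bound for the frequencies in terms of `Ω` and `K` only
  have hc₀ : 0 < √K / C := div_pos (Real.sqrt_pos.2 hK) hC
  obtain ⟨Q, hQ, hreg⟩ := VOWave.regularity_estimates (Ω := Ω) hT hM hc₀
  refine ⟨Q, hQ, fun lam φ h α hα f u₀ u₁ hf hu₀ => ?_⟩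
  obtain ⟨k₁, hk₁, hk₁s, hk₁M, hk₁sM, hkα⟩ := hker α hα
  have hk : VOWave.KernelBound T M k₁ := ⟨hM, hk₁, hk₁s, hk₁M, hk₁sM⟩
  have hl := fun i => h.le hK hC hP i
  obtain ⟨D, hD⟩ := VOWave.exists_of_sobNorm_lt_top hf
  have hfm : MemLp f 2 (VOWave.timeMeasure T) := (memLp_congr_ae hD.zero).1 (hD.memLp 0 le_rfl)
  obtain ⟨u, U, V, hu, hUV, hum⟩ := VOWave.exists_solution hK hT h hc₀ hl hk hkα hfm u₁ hu₀
  obtain ⟨h0, h1, h2, h3⟩ := hreg lam φ k₁ f u₀ u₁ u U V hl hk hfm hUV hum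
  exact ⟨u, hu, fun v hv => hv.ae_unique hT h hk hkα hfm hu, h0 hu₀ hf, h1, h2, h3⟩
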